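/- **Setting.** Let $(\varepsilon_t)_{t\in\mathbb Z}$ be i.i.d. square integrable real random variables with density $f_\varepsilon$, let $\Theta\subset\mathbb R^d$ be a Borel set, $\theta_0\in\Theta$, let $H,G:\Theta\times\mathbb R^{\mathbb N}\to\mathbb R$ be measurable, and let $(X_t)_{t\in\mathbb Z}$ be a stationary process such that almost surely, for all $t$, $$X_t=H(\theta_0;X_{t-1},X_{t-2},\dots)+\varepsilon_t\,G(\theta_0;X_{t-1},X_{t-2},\dots),\qquad X_t=F(\varepsilon_t,\varepsilon_{t-1},\dots)$$ for some measurable $F$. Put $m_t(\theta)=H(\theta;X_{t-1},X_{t-2},\dots)$, $\sigma_t(\theta)=G(\theta;X_{t-1},X_{t-2},\dots)$, $m_t=m_t(\theta_0)$, $\sigma_t=\sigma_t(\theta_0)$. For $t\ge1$ let $\overline m_t(\theta)=H_t(\theta;X_{t-1},\dots,X_1)$ and $\overline\sigma_t(\theta)=G_t(\theta;X_{t-1},\dots,X_1)$ with measurable functions $H_t,G_t$. For $\ell\ge1$ let $m_{t\ell}(\theta),\sigma_{t\ell}(\theta)$ be obtained from $m_t(\theta),\sigma_t(\theta)$, written as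 functions of $(\varepsilon_t,\varepsilon_{t-1},\dots)$ through $F$, by replacing $(\varepsilon_{t-\ell},\varepsilon_{t-\ell-1},\dots)$ with the corresponding terms of an independent copy of the noise. Let $f_X$ be the continuous density of $X_t$. Let $K\ge0$ be a continuously differentiable probability density supported in $[-1,1]$ with $\int xK(x)\,dx=0$, let $b=b_n>0$, $K_b(x)=b^{-1}K(x/b)$, and $$\check f_X(v)=\frac1{n^2}\sum_{i,j=1}^n\frac1{\sigma_i}K_b\Big(\frac{v-m_i}{\sigma_i}-\varepsilon_j\Big).$$ **Assumptions.** Let $I$ be a compact interval. * (A2) There is $\gamma>0$ such that a.s. $\inf_{\theta\in\Theta}\sigma_i(\theta)\ge\gamma$ for all $i\in\mathbb Z$ and $\inf_{\theta\in\Theta}\overline\sigma_i(\theta)\ge\gamma$ for all $i\ge1$. There are $s,a\in(0,1)$, $\kappa,\epsilon>0$ such that, with $\Theta_{0,\epsilon}=\{\theta\in\Theta:\|\theta-\theta_0\|<\epsilon\}$ and all suprema over $\theta\in\Theta_{0,\epsilon}$: $\mathbb E[\sup|m_t(\theta)|^s+\sup|\sigma_t(\theta)|^s]<\infty$; $\mathbb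 E[\sup|m_i(\theta)-m_{i\ell}(\theta)|^s+\sup|\sigma_i^2(\theta)-\sigma_{i\ell}^2(\theta)|^s]\le\kappa a^\ell$ for all $i\in\mathbb Z$, $\ell\ge1$; and $\mathbb E[\sup|m_i(\theta)-\overline m_i(\theta)|^s+\sup|\sigma_i^2(\theta)-\overline\sigma_i^2(\theta)|^s]\le\kappa a^i$ for all $i\ge1$. * (A5) $f_\varepsilon$ is twice differentiable, and $f_\varepsilon,f_\varepsilon',f_\varepsilon''$ are bounded. * (A6) For each $v\in I$ the variable $L_v=(v-m_t)/\sigma_t$ has a density $h_v$; $g_v(x)=\mathbb E[\sigma_t^{-1}\mid L_v=x]\,h_v(x)\ge0$ (a version of it); $(x,v)\mapsto g_v(x)$ is jointly measurable; and there is $s_0>0$ with $\int g_v^2\,d\mu<\infty$ for all $v\in I$, where $d\mu(x)=\sup_{|s|\le s_0}f_\varepsilon(x+s)\,dx$. * (A7) $\int (\sup_{v\in I}g_v)^{2+o}\,d\mu<\infty$ for some $o\in(0,1)$, and there are $\eta,C>0$ such that the bracketing numbers satisfy $N_{[]}(r,\{g_v:v\in I\},L^2(\mu))\le C r^{-\eta}$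 for all $r\in(0,1]$. **Theorem.** Suppose that $nb^{2+\delta}\to\infty$ for some $\delta\in(0,1)$ and $nb^4\to0$. 1. Under (A2), (A5), (A6), for every $v\in I$, $$\sqrt n\,[\check f_X(v)-f_X(v)]=\frac1{\sqrt n}\sum_{i=1}^n\Big[g_v(\varepsilon_i)+\frac1{\sigma_i}f_\varepsilon\Big(\frac{v-m_i}{\sigma_i}\Big)-2f_X(v)\Big]+o_{\mathbb P}(1),$$ and $\sqrt n\,[\check f_X(v)-f_X(v)]=O_{\mathbb P}(1)$. 2. If in addition (A7) holds, the remainder in this expansion is $o_{\mathbb P}(1)$ uniformly in $v\in I$, and $\sqrt n\,\sup_{v\in I}|\check f_X(v)-f_X(v)|=O_{\mathbb P}(1)$. -/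

import Mathlib

open MeasureTheory ProbabilityTheory Filter Topology
open scoped ENNReal

/-- `f` is a (nonnegative, measurable) Lebesgue density of the measure `ν` on the real line. -/
structure IsDensity (f : ℝ → ℝ) (ν : Measure ℝ) : Prop where
  measurable : Measurable f
  nonneg : ∀ x, 0 ≤ f x
  eq_withDensity : ν = volume.withDensity (fun x => ENNReal.ofReal (f x))

/-- `Z n` tends to `0` in (outer) probability. -/
def IsLittleOP {Ω : Type*} [MeasurableSpace Ω] (P : Measure Ω) (Z : ℕ → Ω → ℝ≥0∞) : Prop :=
  ∀ η : ℝ, 0 < η → Tendsto (fun n => P {ω | ENNReal.ofReal η < Z n ω}) atTop (𝓝 0)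

/-- `Z n` is bounded in (outer) probability. -/
def IsBigOP {Ω : Type*} [MeasurableSpace Ω] (P : Measure Ω) (Z : ℕ → Ω → ℝ≥0∞) : Prop :=
  ∀ η : ℝ, 0 < η → ∃ C : ℝ, ∀ᶠ n in atTop, P {ω | ENNReal.ofReal C < Z n ω} ≤ ENNReal.ofReal η

/-- `y` up to (excluding) the index `ℓ`, and `y'` from the index `ℓ` on. -/
def splice (ℓ : ℕ) (y y' : ℕ → ℝ) : ℕ → ℝ := fun j => if j < ℓ then y j else y' j

/-- A causal autoregressive location-scale time series
`X_t = H(θ₀; X_{t-1}, X_{t-2}, …) + ε_t G(θ₀; X_{t-1}, X_{t-2}, …)`, `t ∈ ℤ`, with i.i.d. square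
integrable noise and `X_t = F(ε_t, ε_{t-1}, …)` (so that `X` is strictly stationary). -/
structure LocationScaleModel {Ω : Type*} [MeasurableSpace Ω] (P : Measure Ω) (d : ℕ) where
  /-- the parameter set -/
  Θ : Set (EuclideanSpace ℝ (Fin d))
  measurableSet_Θ : MeasurableSet Θ
  /-- the true parameter -/
  θ₀ : Θ
  /-- conditional mean as a function of the infinite past -/
  H : Θ → (ℕ → ℝ) → ℝ
  /-- volatility as a function of the infinite past -/
  G : Θ → (ℕ → ℝ) → ℝ
  measurable_H : Measurable (fun p : Θ × (ℕ → ℝ) => H p.1 p.2)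
  measurable_G : Measurable (fun p : Θ × (ℕ → ℝ) => G p.1 p.2)
  /-- approximation of the conditional mean at time `t ≥ 1` through `X_{t-1}, …, X_1` -/
  Hbar : (t : ℕ) → Θ → (Fin (t - 1) → ℝ) → ℝ
  /-- approximation of the volatility at time `t ≥ 1` through `X_{t-1}, …, X_1` -/
  Gbar : (t : ℕ) → Θ → (Fin (t - 1) → ℝ) → ℝ
  measurable_Hbar : ∀ t, Measurable (fun p : Θ × (Fin (t - 1) → ℝ) => Hbar t p.1 p.2)
  measurable_Gbar : ∀ t, Measurable (fun p : Θ × (Fin (t - 1) → ℝ) => Gbar t p.1 p.2)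
  /-- the noise -/
  ε : ℤ → Ω → ℝ
  measurable_ε : ∀ t, Measurable (ε t)
  indep_ε : iIndepFun ε P
  identDistrib_ε : ∀ t, IdentDistrib (ε t) (ε 0) P P
  memLp_ε : MemLp (ε 0) 2 P
  /-- the observed process -/
  X : ℤ → Ω → ℝ
  measurable_X : ∀ t, Measurable (X t)
  /-- the representation of the process through the noise -/
  F : (ℕ → ℝ) → ℝ
  measurable_F : Measurable F
  causal : ∀ t : ℤ, ∀ᵐ ω ∂P, X t ω = F (fun j : ℕ => ε (t - j) ω)
  recursion : ∀ t : ℤ, ∀ᵐ ω ∂P,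
    X t ω = H θ₀ (fun k : ℕ => X (t - 1 - k) ω) + ε t ω * G θ₀ (fun k : ℕ => X (t - 1 - k) ω)

namespace LocationScaleModel

variable {Ω : Type*} [MeasurableSpace Ω] {P : Measure Ω} {d : ℕ} (M : LocationScaleModel P d)

/-- The conditional mean `m_t(θ)`. -/
def mean (t : ℤ) (θ : M.Θ) (ω : Ω) : ℝ := M.H θ (fun k : ℕ => M.X (t - 1 - k) ω)

/-- The volatility `σ_t(θ)`. -/
def vol (t : ℤ) (θ : M.Θ) (ω : Ω) : ℝ := M.G θ (fun k : ℕ => M.X (t - 1 - k) ω)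

/-- The truncated conditional mean, computed from `X_{t-1}, …, X_1` (for `t ≥ 1`). -/
def meanBar (t : ℕ) (θ : M.Θ) (ω : Ω) : ℝ :=
  M.Hbar t θ (fun j : Fin (t - 1) => M.X ((t : ℤ) - 1 - (j : ℕ)) ω)

/-- The truncated volatility, computed from `X_{t-1}, …, X_1` (for `t ≥ 1`). -/
def volBar (t : ℕ) (θ : M.Θ) (ω : Ω) : ℝ :=
  M.Gbar t θ (fun j : Fin (t - 1) => M.X ((t : ℤ) - 1 - (j : ℕ)) ω)

/-- The noise history `Y_t = (ε_t, ε_{t-1}, …)`. -/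
def noisePast (t : ℤ) (ω : Ω) : ℕ → ℝ := fun j => M.ε (t - j) ω

/-- The conditional mean `m_t(θ)` as a function of the noise history `Y_t`. -/
def meanOfNoise (θ : M.Θ) (y : ℕ → ℝ) : ℝ := M.H θ (fun k => M.F (fun j => y (k + 1 + j)))

/-- The volatility `σ_t(θ)` as a function of the noise history `Y_t`. -/
def volOfNoise (θ : M.Θ) (y : ℕ → ℝ) : ℝ := M.G θ (fun k => M.F (fun j => y (k + 1 + j)))

/-- The coupled version `m_{tℓ}(θ)`: the noise up to time `t - ℓ` is replaced by that of an
independent copy, realized as the second coordinate of the product space `Ω × Ω`. -/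
def meanCoupled (t : ℤ) (ℓ : ℕ) (θ : M.Θ) (p : Ω × Ω) : ℝ :=
  M.meanOfNoise θ (splice ℓ (M.noisePast t p.1) (M.noisePast t p.2))

/-- The coupled version `σ_{tℓ}(θ)`. -/
def volCoupled (t : ℤ) (ℓ : ℕ) (θ : M.Θ) (p : Ω × Ω) : ℝ :=
  M.volOfNoise θ (splice ℓ (M.noisePast t p.1) (M.noisePast t p.2))

/-- The part of the parameter set at distance less than `r` from the true parameter. -/
def nbhd (r : ℝ) : Set M.Θ := {θ | ‖(θ : EuclideanSpace ℝ (Fin d)) - M.θ₀‖ < r}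

/-- Volatility bounded away from zero, fractional moments, and geometrically decaying influence of
the remote past on the conditional mean and the volatility. -/
def ShortMemory : Prop :=
  (∃ γ : ℝ, 0 < γ ∧
    (∀ i : ℤ, ∀ᵐ ω ∂P, ∀ θ : M.Θ, γ ≤ M.vol i θ ω) ∧
    (∀ i : ℕ, 1 ≤ i → ∀ᵐ ω ∂P, ∀ θ : M.Θ, γ ≤ M.volBar i θ ω)) ∧
  ∃ s a κ r : ℝ, 0 < s ∧ s < 1 ∧ 0 < a ∧ a < 1 ∧ 0 < κ ∧ 0 < r ∧
    (∀ t : ℤ, ∫⁻ ω, ((⨆ θ ∈ M.nbhd r, ‖M.mean t θ ω‖ₑ ^ s) +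
        ⨆ θ ∈ M.nbhd r, ‖M.vol t θ ω‖ₑ ^ s) ∂P < ∞) ∧
    (∀ (i : ℤ) (ℓ : ℕ), 1 ≤ ℓ →
      ∫⁻ p, ((⨆ θ ∈ M.nbhd r, ‖M.mean i θ p.1 - M.meanCoupled i ℓ θ p‖ₑ ^ s) +
        ⨆ θ ∈ M.nbhd r, ‖M.vol i θ p.1 ^ 2 - M.volCoupled i ℓ θ p ^ 2‖ₑ ^ s) ∂(P.prod P)
        ≤ ENNReal.ofReal (κ * a ^ ℓ)) ∧
    (∀ i : ℕ, 1 ≤ i →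
      ∫⁻ ω, ((⨆ θ ∈ M.nbhd r, ‖M.mean i θ ω - M.meanBar i θ ω‖ₑ ^ s) +
        ⨆ θ ∈ M.nbhd r, ‖M.vol i θ ω ^ 2 - M.volBar i θ ω ^ 2‖ₑ ^ s) ∂P
        ≤ ENNReal.ofReal (κ * a ^ i))

/-- The ratio `L_{v,t} = (v - m_t(θ₀)) / σ_t(θ₀)`. -/
noncomputable def ratio (t : ℤ) (v : ℝ) (ω : Ω) : ℝ := (v - M.mean t M.θ₀ ω) / M.vol t M.θ₀ ω

/-- `gv` is a version of `x ↦ 𝔼[1 / σ_t(θ₀) | L_{v,t} = x] * h_v x`, where `h_v` is a density of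
`L_{v,t}`. By stationarity this does not depend on `t`, and `t = 0` is used. -/
def IsWeightedDensity (v : ℝ) (gv : ℝ → ℝ) : Prop :=
  ∃ h q : ℝ → ℝ, IsDensity h (P.map (M.ratio 0 v)) ∧
    Measurable q ∧ (∀ x, 0 ≤ q x) ∧
    P[fun ω => (M.vol 0 M.θ₀ ω)⁻¹ | MeasurableSpace.comap (M.ratio 0 v) inferInstance]
      =ᵐ[P] (fun ω => q (M.ratio 0 v ω)) ∧
    ∀ x, gv x = q x * h x

/-- The estimator of the marginal density at `v` when `θ₀`, `m_i` and `σ_i` are known: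
`n⁻² ∑_{i,j} σ_i⁻¹ K_b (L_{v,i} - ε_j)` with `K_b x = b⁻¹ K (x / b)`. -/
noncomputable def estimator (K : ℝ → ℝ) (b : ℕ → ℝ) (n : ℕ) (v : ℝ) (ω : Ω) : ℝ :=
  ((n : ℝ) ^ 2)⁻¹ * ∑ i ∈ Finset.Icc 1 n, ∑ j ∈ Finset.Icc 1 n,
    (M.vol i M.θ₀ ω)⁻¹ * ((b n)⁻¹ * K ((M.ratio i v ω - M.ε j ω) / b n))

/-- The leading term of the expansion of the normalized estimation error. -/
noncomputable def leadingTerm (fε fX : ℝ → ℝ) (g : ℝ → ℝ → ℝ) (n : ℕ) (v : ℝ) (ω : Ω) : ℝ :=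
  (√(n : ℝ))⁻¹ * ∑ i ∈ Finset.Icc 1 n,
    (g v (M.ε i ω) + (M.vol i M.θ₀ ω)⁻¹ * fε ((v - M.mean i M.θ₀ ω) / M.vol i M.θ₀ ω) - 2 * fX v)

/-- The remainder of the expansion of the normalized estimation error. -/
noncomputable def remainder (K : ℝ → ℝ) (b : ℕ → ℝ) (fε fX : ℝ → ℝ) (g : ℝ → ℝ → ℝ)
    (n : ℕ) (v : ℝ) (ω : Ω) : ℝ :=
  √(n : ℝ) * (M.estimator K b n v ω - fX v) - M.leadingTerm fε fX g n v ω

end LocationScaleModel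

/-- A continuously differentiable probability density supported in `[-1, 1]` with mean zero. -/
structure IsKernel (K : ℝ → ℝ) : Prop where
  contDiff : ContDiff ℝ 1 K
  nonneg : ∀ x, 0 ≤ K x
  support_subset : Function.support K ⊆ Set.Icc (-1) 1
  integral_eq_one : ∫ x, K x = 1
  integral_mul_eq_zero : ∫ x, x * K x = 0

/-- The function is bounded, twice differentiable, and its first two derivatives are bounded. -/
def IsSmoothBounded (f : ℝ → ℝ) : Prop :=
  Differentiable ℝ f ∧ Differentiable ℝ (deriv f) ∧
    ∃ C : ℝ, ∀ x, |f x| ≤ C ∧ |deriv f x| ≤ C ∧ |deriv (deriv f) x| ≤ C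

/-- The measure `dμ(x) = sup_{|s| ≤ s₀} f(x + s) dx`. -/
noncomputable def supMeasure (f : ℝ → ℝ) (s₀ : ℝ) : Measure ℝ :=
  volume.withDensity (fun x => ⨆ s ∈ Set.Icc (-s₀) s₀, ENNReal.ofReal (f (x + s)))

/-- The family `(g_v)`, `v ∈ [α, β]`, consists of the weighted densities of the model, is jointly
measurable, and each member is square integrable with respect to `supMeasure fε s₀`. -/
structure IsSquareIntegrableFamily {Ω : Type*} [MeasurableSpace Ω] {P : Measure Ω} {d : ℕ}
    (M : LocationScaleModel P d) (fε : ℝ → ℝ) (α β s₀ : ℝ) (g : ℝ → ℝ → ℝ) : Prop where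
  isWeightedDensity : ∀ v ∈ Set.Icc α β, M.IsWeightedDensity v (g v)
  measurable : Measurable (fun p : ℝ × Set.Icc α β => g p.2 p.1)
  square_integrable : ∀ v ∈ Set.Icc α β, ∫⁻ x, ‖g v x‖ₑ ^ (2 : ℕ) ∂(supMeasure fε s₀) < ∞

/-- The functions `l`, `u` (square integrable for `μ`) form a bracket of `L²(μ)`-size less
than `r`. -/
def IsBracket (μ : Measure ℝ) (r : ℝ) (l u : ℝ → ℝ) : Prop :=
  MemLp l 2 μ ∧ MemLp u 2 μ ∧ (∀ x, l x ≤ u x) ∧ eLpNorm (u - l) 2 μ < ENNReal.ofReal r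

/-- The bracketing number `N_{[]}(r, 𝓕, L²(μ))`: the least number of brackets of size less than
`r` that cover `𝓕` (infinite if there is no finite cover). -/
noncomputable def bracketingNumber (μ : Measure ℝ) (𝓕 : Set (ℝ → ℝ)) (r : ℝ) : ℕ∞ :=
  ⨅ (N : ℕ) (_ : ∃ l u : Fin N → ℝ → ℝ, (∀ k, IsBracket μ r (l k) (u k)) ∧
    ∀ f ∈ 𝓕, ∃ k, ∀ x, l k x ≤ f x ∧ f x ≤ u k x), (N : ℕ∞)

/-- The envelope `x ↦ sup_{v ∈ [α, β]} g_v(x)` of a family of nonnegative functions. -/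
noncomputable def envelope (α β : ℝ) (g : ℝ → ℝ → ℝ) (x : ℝ) : ℝ≥0∞ :=
  ⨆ v ∈ Set.Icc α β, ENNReal.ofReal (g v x)

/-- The envelope of the family has a moment of order larger than two, and the bracketing numbers
of the family grow at most polynomially. -/
def HasPolynomialBracketing (μ : Measure ℝ) (α β : ℝ) (g : ℝ → ℝ → ℝ) : Prop :=
  AEMeasurable (envelope α β g) μ ∧
  (∃ o : ℝ, 0 < o ∧ o < 1 ∧ ∫⁻ x, envelope α β g x ^ (2 + o) ∂μ < ∞) ∧
  ∃ η C : ℝ, 0 < η ∧ 0 < C ∧ ∀ r : ℝ, 0 < r → r ≤ 1 →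
    (bracketingNumber μ (g '' Set.Icc α β) r : ℝ≥0∞) ≤ ENNReal.ofReal (C * r ^ (-η))

/-! Put `Z_i = (m_i, σ_i²)`, a function of the noise before time `i`, and `κ_v(z, y) = σ⁻¹ K_b((v -
m)/σ - y)` (`pairKernel`). The estimator is the double average of `κ_v(Z_i, ε_j)`, and the proof is
a Hoeffding decomposition of it with respect to the product of the law `π` of `Z_0` and the law `ν`
of the noise, made uniform in `v`.

The projection on the noise is `∫ κ_v(z, y) dπ(z)`, which by the defining property of `g_v` is the
kernel average of `g_v` around `y` (`integral_pairKernel_eq_smoothing`). The projection on the state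
is `σ⁻¹ f_ε((v - m)/σ)` up to an error of order `b²`, because `K` has mean zero
(`abs_integral_pairKernel_sub_le`); after multiplication by `√n` the bias vanishes as `n b⁴ → 0`.
Both limits have mean `f_X(v)`, whence the centering `2 f_X(v)`. So the remainder consists of the
degenerate double sum, the bias, and the empirical process of `smoothing g_v - g_v`
(`ae_remainder_eq`).

The degenerate sum is not an ordinary U-statistic, since `Z_i` depends on every `ε_j` with `j < i`.
Short memory allows `Z_i` to be replaced by a function `W_i` of the noise in `(i - ℓ, i)` at a cost
of order `a^ℓ`. The few pairs with `j` inside this block are bounded trivially; for the others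
nearly all products are uncorrelated (`integral_sq_sum_degenerate_le`). A maximal inequality from
second moments of values and increments (`measure_iSup_gt_le`) gives the order `ℓ²/(n b²)` uniformly
in `v`, and the bandwidth conditions leave room for `ℓ` to be a small power of `n`
(`exists_block_length`).

The smoothing errors tend to zero in `L²(ν)`, which settles a fixed `v`. Uniformity comes from
bracketing and chaining: averaging over shifts of size at most `b ≤ s₀` is a contraction from
`L^p(μ)` to `L^p(ν)` (`lintegral_lsmoothing_rpow_le`), so brackets for `g_v` in `L²(μ)` also serve
the smoothed functions, and `exists_empProc_equicontinuity` applies with one net for all `n`.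

Boundedness in probability of the leading term follows from the same equicontinuity for `g_v` and
from the covariance decay of the states (`IsNoiseDriven.isBigOP_iSup_sum_scaled`). -/

set_option linter.unusedSectionVars false

/-! ### Location-scale transforms: regularity in the state and in the location -/

/-- The volatility recovered from its square, clamped from below at `γ`. -/
noncomputable def clampVol (γ q : ℝ) : ℝ := √(max q (γ ^ 2))

lemma le_clampVol (γ q : ℝ) : γ ≤ clampVol γ q :=
  Real.le_sqrt_of_sq_le (le_max_right _ _)

lemma clampVol_pos {γ : ℝ} (hγ : 0 < γ) (q : ℝ) : 0 < clampVol γ q :=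
  hγ.trans_le (le_clampVol γ q)

lemma clampVol_sq {γ σ : ℝ} (hγ : 0 < γ) (hσ : γ ≤ σ) : clampVol γ (σ ^ 2) = σ := by
  unfold clampVol
  rw [max_eq_left (pow_le_pow_left₀ hγ.le hσ 2), Real.sqrt_sq (hγ.le.trans hσ)]

lemma continuous_clampVol (γ : ℝ) : Continuous (clampVol γ) := by
  unfold clampVol; fun_prop

lemma measurable_clampVol (γ : ℝ) : Measurable (clampVol γ) := (continuous_clampVol γ).measurable

lemma inv_clampVol_le {γ : ℝ} (hγ : 0 < γ) (q : ℝ) : (clampVol γ q)⁻¹ ≤ γ⁻¹ :=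
  inv_anti₀ hγ (le_clampVol γ q)

/-- Short memory is stated for `σ²`, so the inverse volatility has to be Lipschitz in `σ²`. This
follows from `s⁻¹ - s'⁻¹ = (s'² - s²) / (s s' (s + s'))`, whose denominator is at least `γ³`. -/
lemma abs_inv_clampVol_sub_le {γ : ℝ} (hγ : 0 < γ) (q q' : ℝ) :
    |(clampVol γ q)⁻¹ - (clampVol γ q')⁻¹| ≤ γ⁻¹ ^ 3 * |q - q'| := by
  have hs := le_clampVol γ q
  have hs' := le_clampVol γ q'
  have h1 : clampVol γ q ^ 2 = max q (γ ^ 2) :=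
    Real.sq_sqrt (le_max_of_le_right (sq_nonneg γ))
  have h2 : clampVol γ q' ^ 2 = max q' (γ ^ 2) :=
    Real.sq_sqrt (le_max_of_le_right (sq_nonneg γ))
  set s := clampVol γ q
  set s' := clampVol γ q'
  have hsp : 0 < s := hγ.trans_le hs
  have hsp' : 0 < s' := hγ.trans_le hs'
  have h3 : |s' ^ 2 - s ^ 2| ≤ |q - q'| := by
    rw [h1, h2, abs_sub_comm]; exact abs_max_sub_max_le_abs _ _ _
  have h4 : s⁻¹ - s'⁻¹ = (s' ^ 2 - s ^ 2) * (s⁻¹ * s'⁻¹ * (s + s')⁻¹) := by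
    field_simp; ring
  rw [h4, abs_mul, abs_of_pos (by positivity : 0 < s⁻¹ * s'⁻¹ * (s + s')⁻¹), mul_comm]
  have h5 : s⁻¹ * s'⁻¹ * (s + s')⁻¹ ≤ γ⁻¹ * γ⁻¹ * γ⁻¹ := by
    have := inv_anti₀ hγ hs
    have := inv_anti₀ hγ hs'
    have := inv_anti₀ hγ (by linarith : γ ≤ s + s')
    gcongr
  calc _ ≤ γ⁻¹ * γ⁻¹ * γ⁻¹ * |q - q'| := by gcongr
    _ = _ := by ring

/-- A location-scale transform of `κ`, with `z = (m, σ²)`. -/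
noncomputable def scaled (γ : ℝ) (p : ℕ) (κ : ℝ → ℝ) (v : ℝ) (z : ℝ × ℝ) : ℝ :=
  (clampVol γ z.2)⁻¹ ^ p * κ ((v - z.1) * (clampVol γ z.2)⁻¹)

/-- The discrepancy of two states `(m, σ²)`, truncated at `1`. -/
noncomputable def gap (z z' : ℝ × ℝ) : ℝ :=
  min 1 (|z.1 - z'.1| + (1 + |z.1|) * |z.2 - z'.2|)

lemma gap_nonneg (z z' : ℝ × ℝ) : 0 ≤ gap z z' := le_min zero_le_one (by positivity)

lemma gap_le_one (z z' : ℝ × ℝ) : gap z z' ≤ 1 := min_le_left _ _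

lemma measurable_gap : Measurable (fun p : (ℝ × ℝ) × (ℝ × ℝ) => gap p.1 p.2) := by
  unfold gap
  exact Continuous.measurable (by fun_prop)

lemma measurable_scaled (γ : ℝ) (p : ℕ) {κ : ℝ → ℝ} (hκ : Measurable κ) (v : ℝ) :
    Measurable (scaled γ p κ v) := by
  unfold scaled
  have := measurable_clampVol γ
  fun_prop

lemma abs_scaled_le {γ : ℝ} (hγ : 0 < γ) (p : ℕ) {κ : ℝ → ℝ} {B : ℝ} (hB : ∀ x, |κ x| ≤ B)
    (v : ℝ) (z : ℝ × ℝ) : |scaled γ p κ v z| ≤ γ⁻¹ ^ p * B := by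
  unfold scaled
  have h := clampVol_pos hγ z.2
  rw [abs_mul, abs_of_pos (by positivity : 0 < (clampVol γ z.2)⁻¹ ^ p)]
  have := inv_clampVol_le hγ z.2
  have := hB ((v - z.1) * (clampVol γ z.2)⁻¹)
  gcongr

/-- A change of `σ⁻¹` moves the argument `(v - m)/σ` by an amount proportional to `|v - m|`; this is
the origin of the weight `1 + |m|` in `gap`. The constant does not depend on `κ`, whose bounds enter
linearly: later `κ` is a rescaled kernel whose bounds blow up as the bandwidth shrinks. -/
lemma exists_abs_scaled_sub_le_gap {γ : ℝ} (hγ : 0 < γ) (p : ℕ) (V : ℝ) :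
    ∃ C : ℝ, 0 ≤ C ∧ ∀ (κ : ℝ → ℝ) (B₀ B₁ : ℝ), (∀ x, |κ x| ≤ B₀) →
      (∀ x y, |κ x - κ y| ≤ B₁ * |x - y|) → ∀ v, |v| ≤ V → ∀ z z',
      |scaled γ p κ v z - scaled γ p κ v z'| ≤ C * (B₀ + B₁) * gap z z' := by
  set g := γ⁻¹ with hg
  have hgp : 0 < g := inv_pos.2 hγ
  -- The three summands pay for the truncation of `gap` at `1`, for the change of the prefactor
  -- `σ⁻ᵖ`, and for the change of the argument of `κ`.
  refine ⟨2 * g ^ p + p * g ^ (p - 1) * g ^ 3 + g ^ p * ((|V| + 1) * g ^ 3 + g), by positivity, ?_⟩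
  intro κ B₀ B₁ hB₀ hB₁ v hv z z'
  have hB₀' : 0 ≤ B₀ := (abs_nonneg _).trans (hB₀ 0)
  have hB₁' : 0 ≤ B₁ := by
    have := (abs_nonneg _).trans (hB₁ 1 0); simpa using this
  unfold gap
  rw [mul_min_of_nonneg _ _ (by positivity)]
  refine le_min ?_ ?_
  · have h1 := abs_scaled_le hγ p hB₀ v z
    have h2 := abs_scaled_le hγ p hB₀ v z'
    rw [← hg] at h1 h2
    have h3 : |scaled γ p κ v z - scaled γ p κ v z'| ≤ 2 * g ^ p * B₀ := by
      have := abs_sub (scaled γ p κ v z) (scaled γ p κ v z')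
      linarith
    refine h3.trans ?_
    rw [mul_one]
    gcongr
    · have : 0 ≤ p * g ^ (p - 1) * g ^ 3 := by positivity
      have : 0 ≤ g ^ p * ((|V| + 1) * g ^ 3 + g) := by positivity
      linarith
    · linarith
  · set D := |z.1 - z'.1| + (1 + |z.1|) * |z.2 - z'.2| with hD
    have hqD : |z.2 - z'.2| ≤ D := by
      have : 0 ≤ |z.1| * |z.2 - z'.2| := by positivity
      have := abs_nonneg (z.1 - z'.1)
      rw [hD]; linarith
    have hD0 : 0 ≤ D := (abs_nonneg _).trans hqD
    have ha := abs_inv_clampVol_sub_le hγ z.2 z'.2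
    have hap := inv_pos.2 (clampVol_pos hγ z.2)
    have hap' := inv_pos.2 (clampVol_pos hγ z'.2)
    have hal := inv_clampVol_le hγ z.2
    have hal' := inv_clampVol_le hγ z'.2
    unfold scaled
    set a := (clampVol γ z.2)⁻¹
    set a' := (clampVol γ z'.2)⁻¹
    have hx : |(v - z.1) * a - (v - z'.1) * a'| ≤ ((|V| + 1) * g ^ 3 + g) * D := by
      have e : (v - z.1) * a - (v - z'.1) * a' = (v - z.1) * (a - a') + (z'.1 - z.1) * a' := by ring
      rw [e]
      have h1 : |v - z.1| ≤ (|V| + 1) * (1 + |z.1|) := by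
        have := abs_sub v z.1
        have := le_abs_self V
        nlinarith [abs_nonneg V, abs_nonneg z.1]
      calc _ ≤ |v - z.1| * |a - a'| + |z'.1 - z.1| * |a'| := by
            rw [← abs_mul, ← abs_mul]; exact abs_add_le _ _
        _ ≤ ((|V| + 1) * (1 + |z.1|)) * (g ^ 3 * |z.2 - z'.2|) + |z.1 - z'.1| * g := by
            rw [abs_of_pos hap', abs_sub_comm z'.1]; gcongr
        _ ≤ _ := by
            rw [hD]
            have h3 : 0 ≤ (|V| + 1) * g ^ 3 * |z.1 - z'.1| := by positivity
            have h4 : 0 ≤ g * ((1 + |z.1|) * |z.2 - z'.2|) := by positivity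
            nlinarith
    have hp : |a ^ p - a' ^ p| ≤ p * g ^ (p - 1) * g ^ 3 * D := by
      have h1 := abs_pow_sub_pow_le a a' p
      have h2 : max |a| |a'| ≤ g := by
        rw [abs_of_pos hap, abs_of_pos hap']; exact max_le hal hal'
      calc _ ≤ |a - a'| * p * max |a| |a'| ^ (p - 1) := h1
        _ ≤ (g ^ 3 * D) * p * g ^ (p - 1) := by
            have := ha.trans (mul_le_mul_of_nonneg_left hqD (by positivity))
            gcongr
        _ = _ := by ring
    have e : a ^ p * κ ((v - z.1) * a) - a' ^ p * κ ((v - z'.1) * a') =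
      (a ^ p - a' ^ p) * κ ((v - z.1) * a) +
        a' ^ p * (κ ((v - z.1) * a) - κ ((v - z'.1) * a')) := by ring
    rw [e]
    calc _ ≤ |a ^ p - a' ^ p| * |κ ((v - z.1) * a)| +
          |a' ^ p| * |κ ((v - z.1) * a) - κ ((v - z'.1) * a')| := by
            rw [← abs_mul, ← abs_mul]; exact abs_add_le _ _
      _ ≤ (p * g ^ (p - 1) * g ^ 3 * D) * B₀ +
          g ^ p * (B₁ * (((|V| + 1) * g ^ 3 + g) * D)) := by
            have h1 := hB₀ ((v - z.1) * a)
            have h2 := (hB₁ ((v - z.1) * a) ((v - z'.1) * a')).trans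
              (mul_le_mul_of_nonneg_left hx hB₁')
            rw [abs_of_pos (by positivity : 0 < a' ^ p)]
            gcongr
      _ ≤ _ := by
            have t1 : 0 ≤ 2 * g ^ p * (B₀ + B₁) * D := by positivity
            have t2 : 0 ≤ p * g ^ (p - 1) * g ^ 3 * B₁ * D := by positivity
            have t3 : 0 ≤ g ^ p * ((|V| + 1) * g ^ 3 + g) * B₀ * D := by positivity
            nlinarith

lemma abs_scaled_sub_le {γ : ℝ} (hγ : 0 < γ) (p : ℕ) {κ : ℝ → ℝ} {B : ℝ}
    (hB : ∀ x y, |κ x - κ y| ≤ B * |x - y|) (v w : ℝ) (z : ℝ × ℝ) :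
    |scaled γ p κ v z - scaled γ p κ w z| ≤ γ⁻¹ ^ (p + 1) * B * |v - w| := by
  have hB' : 0 ≤ B := by
    have := (abs_nonneg _).trans (hB 1 0); simpa using this
  unfold scaled
  have h := inv_pos.2 (clampVol_pos hγ z.2)
  have hl := inv_clampVol_le hγ z.2
  set a := (clampVol γ z.2)⁻¹
  rw [← mul_sub, abs_mul, abs_of_pos (by positivity : 0 < a ^ p)]
  have h1 := hB ((v - z.1) * a) ((w - z.1) * a)
  rw [← sub_mul, sub_sub_sub_cancel_right, abs_mul, abs_of_pos h] at h1
  calc _ ≤ a ^ p * (B * (|v - w| * a)) := by gcongr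
    _ = a ^ (p + 1) * B * |v - w| := by ring
    _ ≤ _ := by gcongr

/-- Increments in `v` of a location-scale transform of a differentiable function inherit the
dependence on the state from the derivative. -/
lemma exists_abs_scaled_increment_sub_le_gap {γ : ℝ} (hγ : 0 < γ) (V : ℝ) :
    ∃ C : ℝ, 0 ≤ C ∧ ∀ (f : ℝ → ℝ) (B : ℝ), Differentiable ℝ f → (∀ x, |deriv f x| ≤ B) →
      (∀ x y, |deriv f x - deriv f y| ≤ B * |x - y|) → ∀ v w, |v| ≤ V → |w| ≤ V → ∀ z z',
      |(scaled γ 1 f v z - scaled γ 1 f w z) - (scaled γ 1 f v z' - scaled γ 1 f w z')| ≤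
        C * B * |v - w| * gap z z' := by
  obtain ⟨C, hC, h⟩ := exists_abs_scaled_sub_le_gap hγ 2 V
  refine ⟨2 * C, by positivity, ?_⟩
  intro f B hf hB hB' v w hv hw z z'
  have hd : ∀ (z : ℝ × ℝ) (x : ℝ),
      HasDerivAt (fun u => scaled γ 1 f u z) (scaled γ 2 (deriv f) x z) x := by
    intro z x
    unfold scaled
    have h1 : HasDerivAt (fun u : ℝ => (u - z.1) * (clampVol γ z.2)⁻¹)
        (1 * (clampVol γ z.2)⁻¹) x := ((hasDerivAt_id x).sub_const _).mul_const _
    have h2 := ((hf ((x - z.1) * (clampVol γ z.2)⁻¹)).hasDerivAt.comp x h1).const_mul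
      ((clampVol γ z.2)⁻¹ ^ 1)
    exact h2.congr_deriv (by ring)
  -- Differentiating in `v` brings out another factor `σ⁻¹`, so the derivative is a transform of
  -- `deriv f` with exponent `2`. The gap bound for it and the mean value inequality give the
  -- product of `|v - w|` and `gap`.
  have key := Convex.norm_image_sub_le_of_norm_hasDerivWithin_le
    (f := fun u => scaled γ 1 f u z - scaled γ 1 f u z')
    (f' := fun u => scaled γ 2 (deriv f) u z - scaled γ 2 (deriv f) u z')
    (s := Set.Icc (-V) V) (x := w) (y := v) (C := C * (B + B) * gap z z')
    (fun x _ => ((hd z x).sub (hd z' x)).hasDerivWithinAt)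
    (fun x hx => h (deriv f) B B hB hB' x (abs_le.2 hx) z z')
    (convex_Icc _ _) (abs_le.1 hw) (abs_le.1 hv)
  rw [Real.norm_eq_abs, Real.norm_eq_abs] at key
  calc _ = |scaled γ 1 f v z - scaled γ 1 f v z' - (scaled γ 1 f w z - scaled γ 1 f w z')| := by
        congr 1; ring
    _ ≤ _ := key
    _ = _ := by ring

/-- Taylor bound for a function with bounded second derivative. -/
lemma abs_taylor_le {f : ℝ → ℝ} {B : ℝ} (hf : Differentiable ℝ f)
    (hB : ∀ x y, |deriv f x - deriv f y| ≤ B * |x - y|) (x h : ℝ) :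
    |f (x + h) - f x - deriv f x * h| ≤ B * h ^ 2 := by
  have hB' : 0 ≤ B := by
    have := (abs_nonneg _).trans (hB 1 0); simpa using this
  have hd : ∀ u, HasDerivAt (fun u => f (x + u) - deriv f x * u) (deriv f (x + u) - deriv f x) u := by
    intro u
    have h1 : HasDerivAt (fun u => f (x + u)) (deriv f (x + u)) u :=
      HasDerivAt.comp_const_add x u (hf (x + u)).hasDerivAt
    exact (h1.sub ((hasDerivAt_id u).const_mul (deriv f x))).congr_deriv (by ring)
  have key := Convex.norm_image_sub_le_of_norm_hasDerivWithin_le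
    (f := fun u => f (x + u) - deriv f x * u)
    (f' := fun u => deriv f (x + u) - deriv f x)
    (s := Set.uIcc 0 h) (x := 0) (y := h) (C := B * |h|)
    (fun u _ => (hd u).hasDerivWithinAt)
    (fun u hu => by
      have h1 := hB (x + u) x
      rw [add_sub_cancel_left] at h1
      have h2 : |u| ≤ |h| := by
        have := Set.abs_sub_left_of_mem_uIcc hu; simpa using this
      exact h1.trans (by gcongr))
    (convex_uIcc _ _) (Set.left_mem_uIcc) (Set.right_mem_uIcc)
  simp only [Real.norm_eq_abs, add_zero, mul_zero, sub_zero] at key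
  calc _ = |f (x + h) - deriv f x * h - f x| := by congr 1; ring
    _ ≤ B * |h| * |h| := key
    _ = _ := by rw [mul_assoc, ← sq, sq_abs]

lemma abs_sub_le_of_abs_deriv_le {f : ℝ → ℝ} {B : ℝ} (hf : Differentiable ℝ f)
    (hB : ∀ x, |deriv f x| ≤ B) (x y : ℝ) : |f x - f y| ≤ B * |x - y| := by
  have := Convex.norm_image_sub_le_of_norm_deriv_le (f := f) (s := Set.univ) (x := y) (y := x)
    (C := B) (fun x _ => hf x) (fun x _ => hB x) convex_univ (Set.mem_univ _) (Set.mem_univ _)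
  simpa using this

/-! ### I.i.d. noise and elementary integral bounds -/

section Noise

variable {Ω : Type*} [MeasurableSpace Ω]

/-- Independent random variables with common law `ν`. -/
structure IsIIDNoise (P : Measure Ω) (ν : Measure ℝ) (ε : ℤ → Ω → ℝ) : Prop where
  measurable : ∀ t, Measurable (ε t)
  indep : iIndepFun ε P
  map_eq : ∀ t, P.map (ε t) = ν

/-- The σ-algebra generated by the noise with time index in `S`. -/
@[reducible] def noiseField (ε : ℤ → Ω → ℝ) (S : Set ℤ) : MeasurableSpace Ω :=
  ⨆ k ∈ S, MeasurableSpace.comap (ε k) inferInstance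

lemma noiseField_mono (ε : ℤ → Ω → ℝ) {S T : Set ℤ} (h : S ⊆ T) :
    noiseField ε S ≤ noiseField ε T :=
  biSup_mono h

lemma measurable_noiseField (ε : ℤ → Ω → ℝ) {S : Set ℤ} {k : ℤ} (hk : k ∈ S) :
    Measurable[noiseField ε S] (ε k) :=
  Measurable.mono (comap_measurable (ε k))
    (le_iSup₂_of_le (f := fun k _ => MeasurableSpace.comap (ε k) inferInstance) k hk le_rfl) le_rfl

namespace IsIIDNoise

variable {P : Measure Ω} {ν : Measure ℝ} {ε : ℤ → Ω → ℝ} (h : IsIIDNoise P ν ε)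
include h

lemma noiseField_le (S : Set ℤ) : noiseField ε S ≤ ‹MeasurableSpace Ω› :=
  iSup₂_le fun k _ => (h.measurable k).comap_le

lemma isProbabilityMeasure [IsProbabilityMeasure P] : IsProbabilityMeasure ν := by
  rw [← h.map_eq 0]; exact Measure.isProbabilityMeasure_map (h.measurable 0).aemeasurable

lemma indepFun {E E' : Type*} [MeasurableSpace E] [MeasurableSpace E'] {S T : Set ℤ}
    (hST : Disjoint S T) {X : Ω → E} {Y : Ω → E'} (hX : Measurable[noiseField ε S] X)
    (hY : Measurable[noiseField ε T] Y) : IndepFun X Y P := by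
  have h1 := indep_iSup_of_disjoint (fun k => (h.measurable k).comap_le) h.indep hST
  rw [IndepFun_iff_Indep]
  exact indep_of_indep_of_le_left (indep_of_indep_of_le_right h1 hY.comap_le) hX.comap_le

lemma integral_comp (t : ℤ) {φ : ℝ → ℝ} (hφ : Measurable φ) :
    ∫ ω, φ (ε t ω) ∂P = ∫ x, φ x ∂ν := by
  rw [← h.map_eq t, integral_map (h.measurable t).aemeasurable hφ.aestronglyMeasurable]

end IsIIDNoise

end Noise

lemma integrable_of_abs_le {E : Type*} [MeasurableSpace E] {μ : Measure E} [IsFiniteMeasure μ]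
    {f : E → ℝ} (hf : Measurable f) {B : ℝ} (hB : ∀ x, |f x| ≤ B) : Integrable f μ :=
  Integrable.of_bound hf.aestronglyMeasurable B (ae_of_all _ hB)

lemma memLp_of_abs_le {E : Type*} [MeasurableSpace E] {μ : Measure E} [IsFiniteMeasure μ]
    {f : E → ℝ} (hf : Measurable f) {B : ℝ} (hB : ∀ x, |f x| ≤ B) (p : ℝ≥0∞) : MemLp f p μ :=
  MemLp.of_bound hf.aestronglyMeasurable B (ae_of_all _ hB)

lemma abs_integral_le_of_abs_le {E : Type*} [MeasurableSpace E] {μ : Measure E}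
    [IsProbabilityMeasure μ] {f : E → ℝ} {B : ℝ} (hB : ∀ x, |f x| ≤ B) : |∫ x, f x ∂μ| ≤ B := by
  have hB' : ∀ x, ‖f x‖ ≤ B := hB
  simpa using norm_integral_le_of_norm_le_const (μ := μ) (ae_of_all _ hB')

lemma sq_integral_le {E : Type*} [MeasurableSpace E] {μ : Measure E} [IsProbabilityMeasure μ]
    {f : E → ℝ} (hf : MemLp f 2 μ) : (∫ x, f x ∂μ) ^ 2 ≤ ∫ x, f x ^ 2 ∂μ := by
  have h := variance_nonneg f μ
  rw [variance_eq_sub hf] at h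
  simpa using h

/-! ### Moment bounds and a maximal inequality -/

section Tools

variable {Ω : Type*} [MeasurableSpace Ω] {P : Measure Ω}

lemma integral_comp_prodMk_of_indepFun {E E' : Type*} [MeasurableSpace E] [MeasurableSpace E']
    [IsProbabilityMeasure P]
    {X : Ω → E} {Y : Ω → E'} (hXY : IndepFun X Y P) (hX : Measurable X) (hY : Measurable Y)
    {Φ : E × E' → ℝ} (hΦ : Measurable Φ) {B : ℝ} (hB : ∀ p, |Φ p| ≤ B) :
    ∫ ω, Φ (X ω, Y ω) ∂P = ∫ x, ∫ y, Φ (x, y) ∂(P.map Y) ∂(P.map X) := by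
  have := Measure.isProbabilityMeasure_map (μ := P) hX.aemeasurable
  have := Measure.isProbabilityMeasure_map (μ := P) hY.aemeasurable
  rw [← integral_prod _ (integrable_of_abs_le hΦ hB),
    ← (indepFun_iff_map_prod_eq_prod_map_map hX.aemeasurable hY.aemeasurable).1 hXY,
    integral_map (hX.prodMk hY).aemeasurable hΦ.aestronglyMeasurable]

lemma measure_ge_le_ofReal_integral_div [IsFiniteMeasure P] {Y : Ω → ℝ} (hY : ∀ ω, 0 ≤ Y ω)
    (hi : Integrable Y P) {c : ℝ} (hc : 0 < c) :
    P {ω | c ≤ Y ω} ≤ ENNReal.ofReal ((∫ ω, Y ω ∂P) / c) := by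
  have h := mul_meas_ge_le_integral_of_nonneg (ae_of_all _ hY) hi c
  rw [← ENNReal.ofReal_toReal (measure_ne_top P {ω | c ≤ Y ω})]
  refine ENNReal.ofReal_le_ofReal ?_
  rw [le_div_iff₀ hc, mul_comm]
  exact h

lemma measure_abs_gt_le [IsFiniteMeasure P] {Y : Ω → ℝ} (hY : MemLp Y 2 P) {c : ℝ} (hc : 0 < c) :
    P {ω | c < |Y ω|} ≤ ENNReal.ofReal ((∫ ω, Y ω ^ 2 ∂P) / c ^ 2) := by
  refine le_trans (measure_mono fun ω hω => ?_)
    (measure_ge_le_ofReal_integral_div (fun ω => sq_nonneg (Y ω)) hY.integrable_sq (by positivity))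
  have hω' : c < |Y ω| := hω
  show c ^ 2 ≤ Y ω ^ 2
  rw [← sq_abs (Y ω)]
  gcongr

/-- The second moment of a sum in which each term is correlated with few others only. -/
lemma integral_sq_sum_le_of_neighbors {ι : Type*} [DecidableEq ι] (s : Finset ι) (Nb : ι → Finset ι)
    (m : ℕ) (hm : ∀ p ∈ s, (Nb p).card ≤ m) {Y : ι → Ω → ℝ} (hY : ∀ p ∈ s, MemLp (Y p) 2 P) {V : ℝ}
    (hV : ∀ p ∈ s, ∫ ω, Y p ω ^ 2 ∂P ≤ V)
    (h0 : ∀ p ∈ s, ∀ p' ∈ s, p' ∉ Nb p → ∫ ω, Y p ω * Y p' ω ∂P = 0) :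
    ∫ ω, (∑ p ∈ s, Y p ω) ^ 2 ∂P ≤ s.card * m * V := by
  have hi : ∀ p ∈ s, ∀ p' ∈ s, Integrable (fun ω => Y p ω * Y p' ω) P :=
    fun p hp p' hp' => (hY p hp).integrable_mul (hY p' hp')
  have e : ∀ ω, (∑ p ∈ s, Y p ω) ^ 2 = ∑ p ∈ s, ∑ p' ∈ s, Y p ω * Y p' ω := fun ω => by
    rw [sq, Finset.sum_mul_sum]
  simp_rw [e]
  rw [integral_finsetSum _ fun p hp => integrable_finsetSum _ fun p' hp' => hi p hp p' hp']
  have h1 : ∀ p ∈ s, ∫ ω, ∑ p' ∈ s, Y p ω * Y p' ω ∂P ≤ m * V := by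
    intro p hp
    have hV0 : 0 ≤ V := (integral_nonneg fun ω => sq_nonneg _).trans (hV p hp)
    rw [integral_finsetSum _ fun p' hp' => hi p hp p' hp']
    calc ∑ p' ∈ s, ∫ ω, Y p ω * Y p' ω ∂P ≤ ∑ p' ∈ s, if p' ∈ Nb p then V else 0 := by
          refine Finset.sum_le_sum fun p' hp' => ?_
          split_ifs with hn
          · have : ∫ ω, Y p ω * Y p' ω ∂P ≤ ∫ ω, (Y p ω ^ 2 + Y p' ω ^ 2) / 2 ∂P := by
              refine integral_mono (hi p hp p' hp') (((hY p hp).integrable_sq.add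
                (hY p' hp').integrable_sq).div_const 2) fun ω => ?_
              show Y p ω * Y p' ω ≤ (Y p ω ^ 2 + Y p' ω ^ 2) / 2
              nlinarith [sq_nonneg (Y p ω - Y p' ω)]
            rw [integral_div, integral_add (hY p hp).integrable_sq (hY p' hp').integrable_sq] at this
            linarith [hV p hp, hV p' hp']
          · exact (h0 p hp p' hp' hn).le
      _ = ((s.filter (· ∈ Nb p)).card : ℝ) * V := by
          rw [← Finset.sum_filter, Finset.sum_const, nsmul_eq_mul]
      _ ≤ m * V := by
          have : (s.filter (· ∈ Nb p)).card ≤ m := by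
            refine (Finset.card_le_card fun x hx => ?_).trans (hm p hp)
            exact (Finset.mem_filter.1 hx).2
          gcongr
  calc _ ≤ ∑ p ∈ s, (m * V : ℝ) := Finset.sum_le_sum h1
    _ = _ := by rw [Finset.sum_const, nsmul_eq_mul]; ring

/-- A maximal inequality for a process whose values and difference quotients have bounded second
moments; `τ` balances the two bounds. -/
lemma measure_iSup_gt_le [IsFiniteMeasure P] {S : ℝ → Ω → ℝ} {α β A B Λ τ η : ℝ} (hαβ : α ≤ β)
    (hτ : 0 < τ) (hη : 0 < η) (hS : ∀ v ∈ Set.Icc α β, MemLp (S v) 2 P)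
    (hA : ∀ v ∈ Set.Icc α β, ∫ ω, S v ω ^ 2 ∂P ≤ A)
    (hB : ∀ v ∈ Set.Icc α β, ∀ w ∈ Set.Icc α β, ∫ ω, (S v ω - S w ω) ^ 2 ∂P ≤ B * (v - w) ^ 2)
    (hΛ : ∀ ω, ∀ v ∈ Set.Icc α β, ∀ w ∈ Set.Icc α β, |S v ω - S w ω| ≤ Λ * |v - w|) :
    P {ω | ENNReal.ofReal η < ⨆ v ∈ Set.Icc α β, ‖S v ω‖ₑ} ≤
      ENNReal.ofReal (4 / η ^ 2 * (A + τ * B * (β - α) ^ 2 / 2 + 2 * A / τ)) := by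
  -- The grid is so fine that the Lipschitz bound loses at most `η / 2` between grid points. Neither
  -- `N` nor `Λ` appears in the final bound, so `Λ` may be arbitrarily crude.
  obtain ⟨N, hN⟩ := exists_nat_gt (2 * |Λ| * (β - α) / η)
  have hN0 : (0 : ℝ) < N := lt_of_le_of_lt (by have := sub_nonneg.2 hαβ; positivity) hN
  set h := (β - α) / N with hh
  have hh0 : 0 ≤ h := div_nonneg (sub_nonneg.2 hαβ) hN0.le
  have hNh : N * h = β - α := by rw [hh]; field_simp
  have hΛh : |Λ| * h ≤ η / 2 := by
    rw [div_lt_iff₀ hη] at hN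
    rw [hh, ← mul_div_assoc, div_le_iff₀ hN0]; linarith
  set g : ℕ → ℝ := fun k => α + k * h with hg
  have hgm : ∀ k ≤ N, g k ∈ Set.Icc α β := fun k hk => by
    have hk' : (k : ℝ) ≤ N := by exact_mod_cast hk
    refine ⟨by simp only [hg]; have : 0 ≤ (k : ℝ) * h := by positivity
               linarith, ?_⟩
    simp only [hg]
    have : (k : ℝ) * h ≤ N * h := by gcongr
    linarith
  -- The initial square plus the variation of the squares along the grid dominates the square at
  -- every grid point.
  set Y : Ω → ℝ := fun ω => S (g 0) ω ^ 2 +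
    ∑ k ∈ Finset.range N, |S (g (k + 1)) ω ^ 2 - S (g k) ω ^ 2| with hY
  have hYk : ∀ ω, ∀ k ≤ N, S (g k) ω ^ 2 ≤ Y ω := by
    intro ω k hk
    have h1 : S (g k) ω ^ 2 ≤ S (g 0) ω ^ 2 +
        ∑ k ∈ Finset.range k, |S (g (k + 1)) ω ^ 2 - S (g k) ω ^ 2| := by
      clear hk
      induction k with
      | zero => simp
      | succ k ih =>
        rw [Finset.sum_range_succ]
        have := le_abs_self (S (g (k + 1)) ω ^ 2 - S (g k) ω ^ 2)
        linarith
    refine h1.trans ?_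
    simp only [hY]
    gcongr
  have hY0 : ∀ ω, 0 ≤ Y ω := fun ω => (sq_nonneg _).trans (hYk ω 0 (Nat.zero_le _))
  have hint : ∀ k ≤ N, Integrable (fun ω => S (g k) ω ^ 2) P :=
    fun k hk => (hS _ (hgm k hk)).integrable_sq
  have hdi : ∀ k ∈ Finset.range N,
      Integrable (fun ω => |S (g (k + 1)) ω ^ 2 - S (g k) ω ^ 2|) P := fun k hk => by
    have hk' := Finset.mem_range.1 hk
    exact ((hint (k + 1) hk').sub (hint k hk'.le)).abs
  have hYi : Integrable Y P := (hint 0 (Nat.zero_le _)).add (integrable_finsetSum _ hdi)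
  have hYint : ∫ ω, Y ω ∂P ≤ A + τ * B * (β - α) ^ 2 / 2 + 2 * A / τ := by
    simp only [hY]
    rw [integral_add (hint 0 (Nat.zero_le _)) (integrable_finsetSum _ hdi),
      integral_finsetSum _ hdi]
    -- `|a² - c²| = |a - c| |a + c|` is split by Young's inequality with weight `τ N`. Summed over
    -- `N` cells of length `h` with `N h = β - α`, both resulting terms are free of `N`.
    have hk : ∀ k ∈ Finset.range N, ∫ ω, |S (g (k + 1)) ω ^ 2 - S (g k) ω ^ 2| ∂P ≤
        (τ * N * (B * h ^ 2) + 4 * A / (τ * N)) / 2 := by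
      intro k hk
      have hk' := Finset.mem_range.1 hk
      set a := S (g (k + 1))
      set c := S (g k)
      have ha := hS _ (hgm (k + 1) hk')
      have hc := hS _ (hgm k hk'.le)
      have hτN : 0 < τ * N := by positivity
      have hd2 : Integrable (fun ω => (a ω - c ω) ^ 2) P := (ha.sub hc).integrable_sq
      have hp2 : Integrable (fun ω => 2 * a ω ^ 2 + 2 * c ω ^ 2) P :=
        (ha.integrable_sq.const_mul 2).add (hc.integrable_sq.const_mul 2)
      calc ∫ ω, |a ω ^ 2 - c ω ^ 2| ∂P
          ≤ ∫ ω, (τ * N * (a ω - c ω) ^ 2 + (2 * a ω ^ 2 + 2 * c ω ^ 2) / (τ * N)) / 2 ∂P := by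
            refine integral_mono ((hint (k + 1) hk').sub (hint k hk'.le)).abs
              (((hd2.const_mul _).add (hp2.div_const _)).div_const 2) fun ω => ?_
            show |a ω ^ 2 - c ω ^ 2| ≤
              (τ * N * (a ω - c ω) ^ 2 + (2 * a ω ^ 2 + 2 * c ω ^ 2) / (τ * N)) / 2
            have e : |a ω ^ 2 - c ω ^ 2| = |a ω - c ω| * |a ω + c ω| := by
              rw [← abs_mul]; congr 1; ring
            have h2 : 2 * a ω ^ 2 + 2 * c ω ^ 2 = (a ω - c ω) ^ 2 + |a ω + c ω| ^ 2 := by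
              rw [sq_abs]; ring
            rw [e, h2, ← sq_abs (a ω - c ω)]
            set x := |a ω - c ω|
            set y := |a ω + c ω|
            set t := τ * N
            have h3 : t * x ^ 2 + (x ^ 2 + y ^ 2) / t - 2 * (x * y) =
              (t * x - y) ^ 2 / t + x ^ 2 / t := by field_simp; ring
            have h4 : 0 ≤ (t * x - y) ^ 2 / t + x ^ 2 / t := by positivity
            linarith
        _ = (τ * N * ∫ ω, (a ω - c ω) ^ 2 ∂P +
              (2 * ∫ ω, a ω ^ 2 ∂P + 2 * ∫ ω, c ω ^ 2 ∂P) / (τ * N)) / 2 := by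
            rw [integral_div, integral_add (hd2.const_mul _) (hp2.div_const _),
              integral_const_mul, integral_div, integral_add (ha.integrable_sq.const_mul 2)
              (hc.integrable_sq.const_mul 2), integral_const_mul, integral_const_mul]
        _ ≤ _ := by
            have h1 := hB _ (hgm (k + 1) hk') _ (hgm k hk'.le)
            have h2 : g (k + 1) - g k = h := by simp only [hg]; push_cast; ring
            rw [h2] at h1
            have h3 := hA _ (hgm (k + 1) hk')
            have h4 := hA _ (hgm k hk'.le)
            have h5 : 2 * ∫ ω, a ω ^ 2 ∂P + 2 * ∫ ω, c ω ^ 2 ∂P ≤ 4 * A := by linarith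
            gcongr
    have h1 := Finset.sum_le_sum hk
    rw [Finset.sum_const, Finset.card_range, nsmul_eq_mul] at h1
    have h2 : (N : ℝ) * ((τ * N * (B * h ^ 2) + 4 * A / (τ * N)) / 2) =
        τ * B * (β - α) ^ 2 / 2 + 2 * A / τ := by
      rw [← hNh]; field_simp; ring
    have h3 := hA _ (hgm 0 (Nat.zero_le _))
    linarith
  refine le_trans (measure_mono (t := {ω | η ^ 2 / 4 ≤ Y ω}) fun ω hω => ?_)
    ((measure_ge_le_ofReal_integral_div hY0 hYi (by positivity)).trans
      (ENNReal.ofReal_le_ofReal ?_))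
  · simp only [Set.mem_ofPred_eq, lt_iSup_iff] at hω
    obtain ⟨v, hv, hlt⟩ := hω
    rw [Real.enorm_eq_ofReal_abs, ENNReal.ofReal_lt_ofReal_iff_of_nonneg hη.le] at hlt
    obtain ⟨k, hkN, hk⟩ : ∃ k ≤ N, |v - g k| ≤ h := by
      rcases hh0.eq_or_lt with h0 | h0
      · refine ⟨0, Nat.zero_le _, ?_⟩
        rw [← h0, mul_zero] at hNh
        have : v = α := by linarith [hv.1, hv.2]
        simp [hg, this, hh0]
      · have hva : 0 ≤ (v - α) / h := div_nonneg (by linarith [hv.1]) h0.le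
        refine ⟨⌊(v - α) / h⌋₊, ?_, ?_⟩
        · refine Nat.floor_le_of_le ?_
          rw [div_le_iff₀ h0, hNh]
          linarith [hv.2]
        · have h1 := Nat.floor_le hva
          have h2 := Nat.lt_floor_add_one ((v - α) / h)
          rw [le_div_iff₀ h0] at h1
          rw [div_lt_iff₀ h0] at h2
          simp only [hg]
          rw [abs_le]; constructor <;> linarith
    have h1 := hΛ ω v hv _ (hgm k hkN)
    have h2 : Λ * |v - g k| ≤ η / 2 :=
      (mul_le_mul (le_abs_self Λ) hk (abs_nonneg _) (abs_nonneg _)).trans hΛh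
    have h3 : η / 2 < |S (g k) ω| := by
      have := abs_sub_abs_le_abs_sub (S v ω) (S (g k) ω)
      linarith
    have h4 := hYk ω k hkN
    rw [← sq_abs] at h4
    show η ^ 2 / 4 ≤ Y ω
    nlinarith
  · rw [div_div_eq_mul_div, div_mul_eq_mul_div, mul_comm 4]
    gcongr

end Tools

/-! ### The empirical process of the noise: variance and exponential inequality -/

/-- The centered and normalized sum of `φ (ε_j)`, `1 ≤ j ≤ n`. -/
noncomputable def empProc {Ω : Type*} (ν : Measure ℝ) (ε : ℤ → Ω → ℝ) (n : ℕ) (φ : ℝ → ℝ)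
    (ω : Ω) : ℝ :=
  (√(n : ℝ))⁻¹ * ∑ j ∈ Finset.Icc 1 n, (φ (ε j ω) - ∫ x, φ x ∂ν)

section Empirical

variable {Ω : Type*} [MeasurableSpace Ω] {P : Measure Ω} [IsProbabilityMeasure P] {ν : Measure ℝ}
  {ε : ℤ → Ω → ℝ}

lemma iIndepFun_natCast (h : IsIIDNoise P ν ε) {φ : ℝ → ℝ} (hφ : Measurable φ) :
    iIndepFun (fun (j : ℕ) ω => φ (ε j ω)) P := by
  have h1 := h.indep.comp (fun _ => φ) (fun _ => hφ)
  exact h1.precomp (g := fun j : ℕ => (j : ℤ)) Nat.cast_injective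

lemma memLp_empProc (h : IsIIDNoise P ν ε) {φ : ℝ → ℝ} (hφ : Measurable φ) (hφ2 : MemLp φ 2 ν)
    (n : ℕ) : MemLp (empProc ν ε n φ) 2 P := by
  have h1 : ∀ j : ℕ, MemLp (fun ω => φ (ε j ω) - ∫ x, φ x ∂ν) 2 P := fun j => by
    have h2 := hφ2
    rw [← h.map_eq j] at h2
    exact ((memLp_map_measure_iff hφ.aestronglyMeasurable (h.measurable j).aemeasurable).1 h2).sub
      (memLp_const _)
  exact (memLp_finsetSum (Finset.Icc 1 n) fun j _ => h1 j).const_mul (√(n : ℝ))⁻¹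

lemma integral_sq_empProc_le (h : IsIIDNoise P ν ε) {φ : ℝ → ℝ} (hφ : Measurable φ)
    (hφ2 : MemLp φ 2 ν) (n : ℕ) :
    ∫ ω, empProc ν ε n φ ω ^ 2 ∂P ≤ ∫ x, φ x ^ 2 ∂ν := by
  have hν := h.isProbabilityMeasure
  rcases Nat.eq_zero_or_pos n with rfl | hn
  · simp [empProc]; exact integral_nonneg fun x => sq_nonneg _
  have hL : ∀ j : ℕ, MemLp (fun ω => φ (ε j ω)) 2 P := fun j => by
    have := hφ2; rw [← h.map_eq j] at this
    exact (memLp_map_measure_iff hφ.aestronglyMeasurable (h.measurable j).aemeasurable).1 this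
  have hvar : Var[∑ j ∈ Finset.Icc 1 n, (fun ω => φ (ε j ω)); P] =
      ∑ j ∈ Finset.Icc 1 n, Var[fun ω => φ (ε j ω); P] :=
    IndepFun.variance_sum (fun j _ => hL j)
      fun i _ j _ hij => (iIndepFun_natCast h hφ).indepFun hij
  have hv1 : ∀ j : ℕ, Var[fun ω => φ (ε j ω); P] ≤ ∫ x, φ x ^ 2 ∂ν := fun j => by
    rw [variance_eq_sub (hL j)]
    have : ∫ ω, φ (ε j ω) ^ 2 ∂P = ∫ x, φ x ^ 2 ∂ν := h.integral_comp j (hφ.pow_const 2)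
    have h2 := sq_nonneg (∫ ω, φ (ε j ω) ∂P)
    simp only [Pi.pow_apply]
    linarith
  have hint : ∀ j : ℕ, Integrable (fun ω => φ (ε j ω)) P :=
    fun j => (hL j).integrable (by norm_num)
  have hs : ∫ ω, (∑ j ∈ Finset.Icc 1 n, (φ (ε j ω) - ∫ x, φ x ∂ν)) ^ 2 ∂P =
      Var[∑ j ∈ Finset.Icc 1 n, (fun ω => φ (ε j ω)); P] := by
    rw [variance_eq_integral (Finset.aemeasurable_sum _ fun j _ => (hint j).1.aemeasurable)]
    refine integral_congr_ae (ae_of_all _ fun ω => ?_)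
    simp only [Finset.sum_apply]
    rw [integral_finsetSum _ fun j _ => hint j, ← Finset.sum_sub_distrib]
    simp_rw [h.integral_comp _ hφ]
  simp only [empProc, mul_pow]
  rw [integral_const_mul, hs, hvar, inv_pow, Real.sq_sqrt (Nat.cast_nonneg n)]
  have hn' : (0 : ℝ) < n := by exact_mod_cast hn
  rw [inv_mul_le_iff₀ hn']
  calc _ ≤ ∑ j ∈ Finset.Icc 1 n, ∫ x, φ x ^ 2 ∂ν := Finset.sum_le_sum fun j _ => hv1 j
    _ = _ := by simp

lemma empProc_neg (n : ℕ) (φ : ℝ → ℝ) (ω : Ω) :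
    empProc ν ε n (fun x => -φ x) ω = -empProc ν ε n φ ω := by
  simp only [empProc, integral_neg]
  rw [← mul_neg, ← Finset.sum_neg_distrib]
  congr 1
  exact Finset.sum_congr rfl fun j _ => by ring

lemma empProc_sub {φ ψ : ℝ → ℝ} (hφ : Integrable φ ν) (hψ : Integrable ψ ν) (n : ℕ) (ω : Ω) :
    empProc ν ε n (fun x => φ x - ψ x) ω = empProc ν ε n φ ω - empProc ν ε n ψ ω := by
  simp only [empProc]
  rw [← mul_sub, ← Finset.sum_sub_distrib, integral_sub hφ hψ]
  congr 1
  exact Finset.sum_congr rfl fun j _ => by ring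

/-- One-sided exponential inequality for the empirical process. -/
lemma measure_empProc_gt_le_exp (h : IsIIDNoise P ν ε) {φ : ℝ → ℝ} (hφ : Measurable φ) {c r l : ℝ}
    (hc : ∀ x, |φ x| ≤ c) (hr : ∫ x, φ x ^ 2 ∂ν ≤ r ^ 2) {n : ℕ} (hn : 0 < n) (hl : 0 < l)
    (hlc : l * (2 * c) ≤ √(n : ℝ)) (x : ℝ) :
    P {ω | x ≤ empProc ν ε n φ ω} ≤ ENNReal.ofReal (Real.exp (-l * x + l ^ 2 * r ^ 2)) := by
  have hν := h.isProbabilityMeasure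
  have hn' : (0 : ℝ) < n := by exact_mod_cast hn
  have hsn : 0 < √(n : ℝ) := Real.sqrt_pos.2 hn'
  set m := ∫ x, φ x ∂ν with hm
  have hmc : |m| ≤ c := abs_integral_le_of_abs_le hc
  set ψ : ℝ → ℝ := fun x => φ x - m with hψ
  have hψm : Measurable ψ := hφ.sub_const m
  have hψc : ∀ x, |ψ x| ≤ 2 * c := fun x => by
    have := abs_sub (φ x) m
    linarith [hc x]
  set t := l / √(n : ℝ) with ht
  have ht0 : 0 < t := by positivity
  have htψ : ∀ x, |t * ψ x| ≤ 1 := fun x => by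
    rw [abs_mul, abs_of_pos ht0, ht, div_mul_eq_mul_div, div_le_one hsn]
    exact (mul_le_mul_of_nonneg_left (hψc x) hl.le).trans hlc
  have hind := iIndepFun_natCast h hψm
  have hexpi : ∀ j : ℕ, mgf (fun ω => ψ (ε j ω)) P t = ∫ x, Real.exp (t * ψ x) ∂ν := fun j =>
    h.integral_comp j (φ := fun x => Real.exp (t * ψ x)) (by fun_prop)
  have hexpint : Integrable (fun x => Real.exp (t * ψ x)) ν :=
    integrable_of_abs_le (by fun_prop) (B := Real.exp 1) fun x => by
      rw [abs_of_pos (Real.exp_pos _)]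
      exact Real.exp_le_exp.2 ((le_abs_self _).trans (htψ x))
  have hφi : Integrable φ ν := integrable_of_abs_le hφ hc
  have hψi : Integrable ψ ν := hφi.sub (integrable_const m)
  have hφ2 : MemLp φ 2 ν := memLp_of_abs_le hφ hc 2
  have hψ2 : MemLp ψ 2 ν := hφ2.sub (memLp_const m)
  have hψ0 : ∫ x, ψ x ∂ν = 0 := by
    simp only [hψ]
    rw [integral_sub hφi (integrable_const m)]; simp [hm]
  have hψr : ∫ x, ψ x ^ 2 ∂ν ≤ r ^ 2 := by
    have h1 := variance_eq_integral (μ := ν) hφ.aemeasurable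
    have h2 := variance_eq_sub hφ2
    rw [h1] at h2
    simp only [Pi.pow_apply] at h2
    have : ∫ x, ψ x ^ 2 ∂ν = ∫ x, φ x ^ 2 ∂ν - (∫ x, φ x ∂ν) ^ 2 := h2
    linarith [sq_nonneg (∫ x, φ x ∂ν)]
  -- `e^u ≤ 1 + u + u²` for `|u| ≤ 1`, a range guaranteed by `hlc`; the linear term integrates to
  -- zero.
  have hmgf : ∫ x, Real.exp (t * ψ x) ∂ν ≤ Real.exp (t ^ 2 * r ^ 2) := by
    calc ∫ x, Real.exp (t * ψ x) ∂ν ≤ ∫ x, (1 + t * ψ x + t ^ 2 * ψ x ^ 2) ∂ν := by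
          refine integral_mono hexpint (((integrable_const 1).add (hψi.const_mul t)).add
            (hψ2.integrable_sq.const_mul _)) fun x => ?_
          have := (abs_le.1 (Real.abs_exp_sub_one_sub_id_le (htψ x))).2
          show Real.exp (t * ψ x) ≤ 1 + t * ψ x + t ^ 2 * ψ x ^ 2
          nlinarith
      _ = 1 + t ^ 2 * ∫ x, ψ x ^ 2 ∂ν := by
          have h1 : Integrable (fun x => 1 + t * ψ x) ν := (integrable_const 1).add (hψi.const_mul t)
          rw [integral_add h1 (hψ2.integrable_sq.const_mul _),
            integral_add (integrable_const 1) (hψi.const_mul t),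
            integral_const_mul, integral_const_mul, hψ0]
          simp
      _ ≤ 1 + t ^ 2 * r ^ 2 := by gcongr
      _ ≤ _ := by linarith [Real.add_one_le_exp (t ^ 2 * r ^ 2)]
  set Y : Ω → ℝ := ∑ j ∈ Finset.Icc 1 n, fun ω => ψ (ε j ω) with hY
  have hYmgf : mgf Y P t ≤ Real.exp (l ^ 2 * r ^ 2) := by
    rw [hY, hind.mgf_sum (fun j => hψm.comp (h.measurable j))]
    simp_rw [hexpi]
    rw [Finset.prod_const, Nat.card_Icc, Nat.add_sub_cancel]
    calc _ ≤ Real.exp (t ^ 2 * r ^ 2) ^ n :=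
          pow_le_pow_left₀ (integral_nonneg fun x => (Real.exp_pos _).le) hmgf n
      _ = _ := by
          rw [← Real.exp_nat_mul, ht, div_pow, Real.sq_sqrt hn'.le]
          congr 1; field_simp
  have hYint : Integrable (fun ω => Real.exp (t * Y ω)) P := by
    refine integrable_of_abs_le ?_ (B := Real.exp (∑ j ∈ Finset.Icc 1 n, 1)) fun ω => ?_
    · have : Measurable Y := by
        have h1 : Measurable fun ω => ∑ j ∈ Finset.Icc 1 n, ψ (ε j ω) :=
          Finset.measurable_fun_sum _ fun j _ => hψm.comp (h.measurable j)
        convert h1 using 1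
        ext ω; simp [hY]
      fun_prop
    · rw [abs_of_pos (Real.exp_pos _)]
      refine Real.exp_le_exp.2 ?_
      rw [hY, Finset.sum_apply, Finset.mul_sum]
      exact Finset.sum_le_sum fun j _ => (le_abs_self _).trans (htψ _)
  have key := measure_ge_le_exp_mul_mgf (√(n : ℝ) * x) ht0.le hYint
  have hset : {ω | x ≤ empProc ν ε n φ ω} = {ω | √(n : ℝ) * x ≤ Y ω} := by
    ext ω
    simp only [Set.mem_ofPred_eq, empProc, hY, Finset.sum_apply, hψ]
    rw [← div_eq_inv_mul, le_div_iff₀ hsn, mul_comm]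
  rw [hset, ← ENNReal.ofReal_toReal (measure_ne_top P _)]
  refine ENNReal.ofReal_le_ofReal (key.trans ?_)
  rw [Real.exp_add]
  have : -t * (√(n : ℝ) * x) = -l * x := by rw [ht]; field_simp
  rw [this]
  gcongr

lemma measure_abs_empProc_gt_le_exp (h : IsIIDNoise P ν ε) {φ : ℝ → ℝ} (hφ : Measurable φ)
    {c r l : ℝ} (hc : ∀ x, |φ x| ≤ c) (hr : ∫ x, φ x ^ 2 ∂ν ≤ r ^ 2) {n : ℕ} (hn : 0 < n)
    (hl : 0 < l) (hlc : l * (2 * c) ≤ √(n : ℝ)) (x : ℝ) :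
    P {ω | x < |empProc ν ε n φ ω|} ≤ ENNReal.ofReal (2 * Real.exp (-l * x + l ^ 2 * r ^ 2)) := by
  have h1 := measure_empProc_gt_le_exp h hφ hc hr hn hl hlc x
  have h2 := measure_empProc_gt_le_exp h hφ.neg (c := c) (r := r) (by simpa using hc)
    (by simpa using hr) hn hl hlc x
  refine (measure_mono (t := {ω | x ≤ empProc ν ε n φ ω} ∪
    {ω | x ≤ empProc ν ε n (-φ) ω}) fun ω hω => ?_).trans
    ((measure_union_le _ _).trans ((add_le_add h1 h2).trans ?_))
  · have hω' : x < |empProc ν ε n φ ω| := hω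
    rcases lt_abs.1 hω' with h3 | h3
    · exact Or.inl h3.le
    · refine Or.inr ?_
      show x ≤ empProc ν ε n (fun x => -φ x) ω
      rw [empProc_neg]; exact h3.le
  · rw [← ENNReal.ofReal_add (Real.exp_pos _).le (Real.exp_pos _).le, two_mul]

end Empirical

/-! ### States driven by the noise: covariance decay -/

/-- A stationary process of states driven by the past of an i.i.d. noise, with geometrically
decaying influence of the remote past. -/
structure IsNoiseDriven {Ω : Type*} [MeasurableSpace Ω] (P : Measure Ω) (ν : Measure ℝ)
    (ε : ℤ → Ω → ℝ) (Z : ℤ → Ω → ℝ × ℝ) (C a : ℝ) : Prop where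
  noise : IsIIDNoise P ν ε
  measurable_state : ∀ t, Measurable[noiseField ε (Set.Iio t)] (Z t)
  map_state : ∀ t, P.map (Z t) = P.map (Z 0)
  nonneg : 0 ≤ C
  rate_pos : 0 < a
  rate_lt_one : a < 1
  coupling : ∀ (i : ℤ) (ℓ : ℕ), 1 ≤ ℓ → ∃ W : Ω → ℝ × ℝ,
    Measurable[noiseField ε (Set.Ioo (i - ℓ) i)] W ∧ ∫ ω, gap (Z i ω) (W ω) ∂P ≤ C * a ^ ℓ

namespace IsNoiseDriven

variable {Ω : Type*} [MeasurableSpace Ω] {P : Measure Ω} [IsProbabilityMeasure P] {ν : Measure ℝ}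
  {ε : ℤ → Ω → ℝ} {Z : ℤ → Ω → ℝ × ℝ} {C a : ℝ} (h : IsNoiseDriven P ν ε Z C a)
include h

lemma measurable (t : ℤ) : Measurable (Z t) :=
  (h.measurable_state t).mono (h.noise.noiseField_le _) le_rfl

lemma isProbabilityMeasure_map (t : ℤ) : IsProbabilityMeasure (P.map (Z t)) :=
  Measure.isProbabilityMeasure_map (h.measurable t).aemeasurable

lemma integral_comp (t : ℤ) {φ : ℝ × ℝ → ℝ} (hφ : Measurable φ) :
    ∫ ω, φ (Z t ω) ∂P = ∫ z, φ z ∂(P.map (Z 0)) := by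
  rw [← h.map_state t, integral_map (h.measurable t).aemeasurable hφ.aestronglyMeasurable]

omit h in
lemma integrable_gap {X Y : Ω → ℝ × ℝ} (hX : Measurable X) (hY : Measurable Y) :
    Integrable (fun ω => gap (X ω) (Y ω)) P :=
  integrable_of_abs_le (measurable_gap.comp (hX.prodMk hY)) (B := 1) fun ω => by
    show |gap (X ω) (Y ω)| ≤ 1
    rw [abs_of_nonneg (gap_nonneg _ _)]; exact gap_le_one _ _

/-- Geometric decay of the covariances of functions of the state. -/
lemma abs_integral_mul_le {φ : ℝ × ℝ → ℝ} (hφ : Measurable φ) {B : ℝ} (hB : ∀ z, |φ z| ≤ B)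
    (hgap : ∀ z z', |φ z - φ z'| ≤ B * gap z z') {i j : ℤ} {ℓ : ℕ} (hℓ : 1 ≤ ℓ)
    (hij : i - ℓ = j) :
    ∫ ω, (φ (Z i ω) - ∫ z, φ z ∂(P.map (Z 0))) * (φ (Z j ω) - ∫ z, φ z ∂(P.map (Z 0))) ∂P ≤
      2 * B ^ 2 * C * a ^ ℓ := by
  have hπ := h.isProbabilityMeasure_map 0
  set m := ∫ z, φ z ∂(P.map (Z 0)) with hm
  obtain ⟨W, hW, hWg⟩ := h.coupling i ℓ hℓ
  have hWm : Measurable W := hW.mono (h.noise.noiseField_le _) le_rfl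
  have hB0 : 0 ≤ B := (abs_nonneg _).trans (hB 0)
  have hmB : |m| ≤ B := abs_integral_le_of_abs_le hB
  have hψ : ∀ z, |φ z - m| ≤ 2 * B := fun z => by
    have := abs_sub (φ z) m
    linarith [hB z]
  have hi := h.measurable i
  have hj := h.measurable j
  -- `W` uses noise with index strictly between `j = i - ℓ` and `i`, while `Z j` uses noise strictly
  -- before `j`.
  have hind : IndepFun W (Z j) P := by
    refine h.noise.indepFun (Set.disjoint_left.2 fun k hk hk' => ?_) hW (h.measurable_state j)
    rw [← hij] at hk'
    exact absurd hk.1 (not_lt.2 (le_of_lt hk'))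
  -- It is enough that the factor with `Z j` is centered; the law of `W` may differ from that of the
  -- states.
  have h1 : ∫ ω, (φ (W ω) - m) * (φ (Z j ω) - m) ∂P = 0 := by
    have := (hind.comp (hφ.sub_const m) (hφ.sub_const m)).integral_fun_mul_eq_mul_integral
      ((hφ.sub_const m).comp hWm).aestronglyMeasurable
      ((hφ.sub_const m).comp hj).aestronglyMeasurable
    simp only [Function.comp_apply] at this
    rw [this]
    have h2 : ∫ ω, (φ (Z j ω) - m) ∂P = 0 := by
      rw [integral_sub (f := fun ω => φ (Z j ω)) (integrable_of_abs_le (hφ.comp hj) fun ω => hB _)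
        (integrable_const _),
        h.integral_comp j hφ]
      simp [hm]
    rw [h2, mul_zero]
  have e : ∀ ω, (φ (Z i ω) - m) * (φ (Z j ω) - m) =
      (φ (Z i ω) - φ (W ω)) * (φ (Z j ω) - m) + (φ (W ω) - m) * (φ (Z j ω) - m) := fun ω => by ring
  have hbd : ∀ ω, |(φ (Z i ω) - φ (W ω)) * (φ (Z j ω) - m)| ≤ 2 * B ^ 2 * gap (Z i ω) (W ω) := by
    intro ω
    rw [abs_mul]
    calc _ ≤ (B * gap (Z i ω) (W ω)) * (2 * B) := by
          have := hgap (Z i ω) (W ω)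
          have := hψ (Z j ω)
          have := gap_nonneg (Z i ω) (W ω)
          gcongr
      _ = _ := by ring
  have hint1 : Integrable (fun ω => (φ (Z i ω) - φ (W ω)) * (φ (Z j ω) - m)) P := by
    refine integrable_of_abs_le (B := 2 * B ^ 2) (by fun_prop) fun ω => (hbd ω).trans ?_
    exact mul_le_of_le_one_right (by positivity) (gap_le_one _ _)
  have hint2 : Integrable (fun ω => (φ (W ω) - m) * (φ (Z j ω) - m)) P := by
    refine integrable_of_abs_le (B := (2 * B) * (2 * B)) (by fun_prop) fun ω => ?_
    rw [abs_mul]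
    have := hψ (W ω)
    have := hψ (Z j ω)
    gcongr
  simp_rw [e]
  rw [integral_add hint1 hint2, h1, add_zero]
  calc _ ≤ ∫ ω, 2 * B ^ 2 * gap (Z i ω) (W ω) ∂P :=
        integral_mono hint1 ((integrable_gap hi hWm).const_mul _)
          fun ω => (le_abs_self _).trans (hbd ω)
    _ ≤ 2 * B ^ 2 * (C * a ^ ℓ) := by
        rw [integral_const_mul]
        gcongr
    _ = _ := by ring

omit h in
lemma sum_pow_sub_le (ha : 0 < a) (ha1 : a < 1) (n : ℕ) :
    ∑ j ∈ Finset.Icc 1 n, a ^ (n + 1 - j) ≤ a / (1 - a) := by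
  induction n with
  | zero => simp; exact div_nonneg ha.le (by linarith)
  | succ n ih =>
    rw [Finset.sum_Icc_succ_top (by omega)]
    have e : ∑ j ∈ Finset.Icc 1 n, a ^ (n + 1 + 1 - j) =
        a * ∑ j ∈ Finset.Icc 1 n, a ^ (n + 1 - j) := by
      rw [Finset.mul_sum]
      refine Finset.sum_congr rfl fun j hj => ?_
      rw [← pow_succ']
      congr 1
      have := (Finset.mem_Icc.1 hj).2
      omega
    rw [e]
    have h1 : a * ∑ j ∈ Finset.Icc 1 n, a ^ (n + 1 - j) ≤ a * (a / (1 - a)) := by gcongr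
    have h2 : n + 1 + 1 - (n + 1) = 1 := by omega
    have h3 : a / (1 - a) = a * (a / (1 - a)) + a := by
      have : 1 - a ≠ 0 := by linarith
      field_simp; ring
    rw [h2, pow_one]
    linarith

/-- The variance of partial sums of functions of the state grows linearly. -/
lemma integral_sq_sum_le {φ : ℝ × ℝ → ℝ} (hφ : Measurable φ) {B : ℝ} (hB : ∀ z, |φ z| ≤ B)
    (hgap : ∀ z z', |φ z - φ z'| ≤ B * gap z z') (n : ℕ) :
    ∫ ω, (∑ i ∈ Finset.Icc 1 n, (φ (Z i ω) - ∫ z, φ z ∂(P.map (Z 0)))) ^ 2 ∂P ≤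
      n * (B ^ 2 * (4 + 4 * C * (a / (1 - a)))) := by
  have hπ := h.isProbabilityMeasure_map 0
  set m := ∫ z, φ z ∂(P.map (Z 0)) with hm
  have hB0 : 0 ≤ B := (abs_nonneg _).trans (hB 0)
  have hmB : |m| ≤ B := abs_integral_le_of_abs_le hB
  have hψ : ∀ z, |φ z - m| ≤ 2 * B := fun z => by
    have := abs_sub (φ z) m
    linarith [hB z]
  have hY : ∀ i : ℤ, MemLp (fun ω => φ (Z i ω) - m) 2 P := fun i =>
    memLp_of_abs_le ((hφ.comp (h.measurable i)).sub_const m) (fun ω => hψ _) 2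
  -- A new term contributes its own variance and its covariances with the earlier terms. The latter
  -- are bounded by a geometric series, so the increment is bounded independently of `n`.
  induction n with
  | zero => simp
  | succ n ih =>
    simp_rw [Finset.sum_Icc_succ_top (by omega : 1 ≤ n + 1)]
    set Y : ℤ → Ω → ℝ := fun i ω => φ (Z i ω) - m with hYdef
    have hS : MemLp (fun ω => ∑ i ∈ Finset.Icc 1 n, Y (i : ℕ) ω) 2 P :=
      memLp_finsetSum _ fun i _ => hY i
    have hY1 := hY ((n + 1 : ℕ) : ℤ)
    have hprod : ∀ j : ℕ, Integrable (fun ω => Y ((n + 1 : ℕ) : ℤ) ω * Y j ω) P :=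
      fun j => hY1.integrable_mul (hY j)
    have e : ∀ ω, ((∑ i ∈ Finset.Icc 1 n, Y (i : ℕ) ω) + Y ((n + 1 : ℕ) : ℤ) ω) ^ 2 =
        (∑ i ∈ Finset.Icc 1 n, Y (i : ℕ) ω) ^ 2 + Y ((n + 1 : ℕ) : ℤ) ω ^ 2 +
        2 * ∑ j ∈ Finset.Icc 1 n, Y ((n + 1 : ℕ) : ℤ) ω * Y (j : ℕ) ω := fun ω => by
      rw [← Finset.mul_sum]; ring
    have hsq1 : Integrable (fun ω => (∑ i ∈ Finset.Icc 1 n, Y (i : ℕ) ω) ^ 2) P := hS.integrable_sq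
    have hsq2 : Integrable (fun ω => Y ((n + 1 : ℕ) : ℤ) ω ^ 2) P := hY1.integrable_sq
    have hsum : Integrable (fun ω => 2 * ∑ j ∈ Finset.Icc 1 n,
        Y ((n + 1 : ℕ) : ℤ) ω * Y (j : ℕ) ω) P :=
      (integrable_finsetSum _ fun j _ => hprod j).const_mul 2
    have hsq12 : Integrable (fun ω => (∑ i ∈ Finset.Icc 1 n, Y (i : ℕ) ω) ^ 2 +
      Y ((n + 1 : ℕ) : ℤ) ω ^ 2) P := hsq1.add hsq2
    show ∫ ω, ((∑ i ∈ Finset.Icc 1 n, Y (i : ℕ) ω) + Y ((n + 1 : ℕ) : ℤ) ω) ^ 2 ∂P ≤ _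
    simp_rw [e]
    rw [integral_add hsq12 hsum, integral_add hsq1 hsq2, integral_const_mul,
      integral_finsetSum _ fun j _ => hprod j]
    have h2 : ∫ ω, Y ((n + 1 : ℕ) : ℤ) ω ^ 2 ∂P ≤ 4 * B ^ 2 := by
      have : ∀ ω, |Y ((n + 1 : ℕ) : ℤ) ω ^ 2| ≤ 4 * B ^ 2 := fun ω => by
        rw [abs_pow]
        calc _ ≤ (2 * B) ^ 2 := pow_le_pow_left₀ (abs_nonneg _) (hψ _) 2
          _ = _ := by ring
      exact (le_abs_self _).trans (abs_integral_le_of_abs_le this)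
    have h3 : ∑ j ∈ Finset.Icc 1 n, ∫ ω, Y ((n + 1 : ℕ) : ℤ) ω * Y (j : ℕ) ω ∂P ≤
        2 * B ^ 2 * C * (a / (1 - a)) := by
      calc _ ≤ ∑ j ∈ Finset.Icc 1 n, 2 * B ^ 2 * C * a ^ (n + 1 - j) := by
            refine Finset.sum_le_sum fun j hj => ?_
            have hj' := Finset.mem_Icc.1 hj
            exact h.abs_integral_mul_le hφ hB hgap (by omega) (by push_cast [Nat.cast_sub (by omega : j ≤ n + 1)]; ring)
        _ ≤ _ := by
            rw [← Finset.mul_sum]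
            have := sum_pow_sub_le h.rate_pos h.rate_lt_one n
            have := h.nonneg
            gcongr
    rw [show ((n + 1 : ℕ) : ℝ) * (B ^ 2 * (4 + 4 * C * (a / (1 - a)))) =
      n * (B ^ 2 * (4 + 4 * C * (a / (1 - a)))) + B ^ 2 * (4 + 4 * C * (a / (1 - a))) by
        push_cast; ring]
    have ih' : ∫ ω, (∑ i ∈ Finset.Icc 1 n, Y (i : ℕ) ω) ^ 2 ∂P ≤
      n * (B ^ 2 * (4 + 4 * C * (a / (1 - a)))) := ih
    nlinarith

end IsNoiseDriven

/-! ### Degenerate kernels and the second moment of a blocked U-statistic -/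

section UStatistic

/-- The completely degenerate part of the kernel `κ` with respect to the product of `π` and `ν`. -/
noncomputable def degenerate {E : Type*} [MeasurableSpace E] (π : Measure E) (ν : Measure ℝ)
    (κ : E → ℝ → ℝ) (z : E) (y : ℝ) : ℝ :=
  κ z y - ∫ y', κ z y' ∂ν - ∫ z', κ z' y ∂π + ∫ z', ∫ y', κ z' y' ∂ν ∂π

variable {E : Type*} [MeasurableSpace E] {π : Measure E} [IsProbabilityMeasure π]
  {ν : Measure ℝ} [IsProbabilityMeasure ν] {κ : E → ℝ → ℝ}

lemma measurable_integral_right (hκ : Measurable (Function.uncurry κ)) :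
    Measurable fun z => ∫ y, κ z y ∂ν :=
  (hκ.stronglyMeasurable.integral_prod_right (ν := ν)).measurable

lemma measurable_integral_left (hκ : Measurable (Function.uncurry κ)) :
    Measurable fun y => ∫ z, κ z y ∂π :=
  (hκ.stronglyMeasurable.integral_prod_left (μ := π)).measurable

lemma measurable_degenerate (hκ : Measurable (Function.uncurry κ)) :
    Measurable (Function.uncurry (degenerate π ν κ)) := by
  have h1 : Measurable fun p : E × ℝ => κ p.1 p.2 := hκ
  have h2 := (measurable_integral_right (ν := ν) hκ).comp (measurable_fst : Measurable (Prod.fst : E × ℝ → E))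
  have h3 := (measurable_integral_left (π := π) hκ).comp (measurable_snd : Measurable (Prod.snd : E × ℝ → ℝ))
  exact ((h1.sub h2).sub h3).add_const _

lemma abs_degenerate_le {B : ℝ} (hB : ∀ z y, |κ z y| ≤ B) (z : E) (y : ℝ) :
    |degenerate π ν κ z y| ≤ 4 * B := by
  unfold degenerate
  have h1 := hB z y
  have h2 : |∫ y', κ z y' ∂ν| ≤ B := abs_integral_le_of_abs_le (hB z)
  have h3 : |∫ z', κ z' y ∂π| ≤ B := abs_integral_le_of_abs_le fun z => hB z y
  have h4 : |∫ z', ∫ y', κ z' y' ∂ν ∂π| ≤ B :=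
    abs_integral_le_of_abs_le fun z => abs_integral_le_of_abs_le (hB z)
  rw [abs_le] at *
  constructor <;> linarith

lemma integral_degenerate_right (hκ : Measurable (Function.uncurry κ)) {B : ℝ}
    (hB : ∀ z y, |κ z y| ≤ B) (z : E) : ∫ y, degenerate π ν κ z y ∂ν = 0 := by
  unfold degenerate
  have h1 : Integrable (fun y => κ z y) ν :=
    integrable_of_abs_le (hκ.comp measurable_prodMk_left) (hB z)
  have h3 : Integrable (fun y => ∫ z', κ z' y ∂π) ν :=
    integrable_of_abs_le (measurable_integral_left hκ)
      fun y => abs_integral_le_of_abs_le fun z => hB z y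
  have h12 : Integrable (fun y => κ z y - ∫ y', κ z y' ∂ν) ν := h1.sub (integrable_const _)
  have h123 : Integrable (fun y => κ z y - ∫ y', κ z y' ∂ν - ∫ z', κ z' y ∂π) ν := h12.sub h3
  rw [integral_add h123 (integrable_const _), integral_sub h12 h3,
    integral_sub h1 (integrable_const _), integral_integral_swap
      (integrable_of_abs_le hκ fun p => hB p.1 p.2)]
  simp

lemma integral_degenerate_left (hκ : Measurable (Function.uncurry κ)) {B : ℝ}
    (hB : ∀ z y, |κ z y| ≤ B) (y : ℝ) : ∫ z, degenerate π ν κ z y ∂π = 0 := by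
  unfold degenerate
  have h1 : Integrable (fun z => κ z y) π :=
    integrable_of_abs_le (hκ.comp measurable_prodMk_right) fun z => hB z y
  have h2 : Integrable (fun z => ∫ y', κ z y' ∂ν) π :=
    integrable_of_abs_le (measurable_integral_right hκ) fun z => abs_integral_le_of_abs_le (hB z)
  have h12 : Integrable (fun z => κ z y - ∫ y', κ z y' ∂ν) π := h1.sub h2
  have h123 : Integrable (fun z => κ z y - ∫ y', κ z y' ∂ν - ∫ z', κ z' y ∂π) π :=
    h12.sub (integrable_const _)
  rw [integral_add h123 (integrable_const _), integral_sub h12 (integrable_const _),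
    integral_sub h1 h2]
  simp

lemma degenerate_sub {κ' : E → ℝ → ℝ} (hκ : Measurable (Function.uncurry κ))
    (hκ' : Measurable (Function.uncurry κ')) {B : ℝ} (hB : ∀ z y, |κ z y| ≤ B)
    (hB' : ∀ z y, |κ' z y| ≤ B) (z : E) (y : ℝ) :
    degenerate π ν (fun z y => κ z y - κ' z y) z y =
      degenerate π ν κ z y - degenerate π ν κ' z y := by
  unfold degenerate
  have hr : ∀ {κ : E → ℝ → ℝ}, Measurable (Function.uncurry κ) → (∀ z y, |κ z y| ≤ B) →
      ∀ z, Integrable (fun y => κ z y) ν := fun hκ hB z =>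
    integrable_of_abs_le (hκ.comp measurable_prodMk_left) (hB z)
  have hl : ∀ {κ : E → ℝ → ℝ}, Measurable (Function.uncurry κ) → (∀ z y, |κ z y| ≤ B) →
      ∀ y, Integrable (fun z => κ z y) π := fun hκ hB y =>
    integrable_of_abs_le (hκ.comp measurable_prodMk_right) fun z => hB z y
  have hrr : ∀ {κ : E → ℝ → ℝ}, Measurable (Function.uncurry κ) → (∀ z y, |κ z y| ≤ B) →
      Integrable (fun z => ∫ y', κ z y' ∂ν) π := fun hκ hB =>
    integrable_of_abs_le (measurable_integral_right hκ) fun z => abs_integral_le_of_abs_le (hB z)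
  rw [integral_sub (hr hκ hB z) (hr hκ' hB' z), integral_sub (hl hκ hB y) (hl hκ' hB' y)]
  have : ∀ z', ∫ y', (κ z' y' - κ' z' y') ∂ν = ∫ y', κ z' y' ∂ν - ∫ y', κ' z' y' ∂ν :=
    fun z' => integral_sub (hr hκ hB z') (hr hκ' hB' z')
  simp_rw [this]
  rw [integral_sub (hrr hκ hB) (hrr hκ' hB')]
  ring

variable {Ω : Type*} [MeasurableSpace Ω] {P : Measure Ω} [IsProbabilityMeasure P]

lemma integral_mul_eq_zero_of_indepFun {E E' : Type*} [MeasurableSpace E] [MeasurableSpace E']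
    {X : Ω → E} {Y : Ω → E'} (hXY : IndepFun X Y P) (hX : Measurable X) (hY : Measurable Y)
    {Φ : E' → E → ℝ} (hΦ : Measurable (Function.uncurry Φ)) {B : ℝ} (hB : ∀ y x, |Φ y x| ≤ B)
    (h0 : ∀ y, ∫ x, Φ y x ∂(P.map X) = 0) {Ψ : E' → ℝ} (hΨ : Measurable Ψ)
    {B' : ℝ} (hB' : ∀ y, |Ψ y| ≤ B') :
    ∫ ω, Φ (Y ω) (X ω) * Ψ (Y ω) ∂P = 0 := by
  have hm : Measurable fun p : E' × E => Φ p.1 p.2 * Ψ p.1 :=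
    Measurable.mul hΦ (hΨ.comp measurable_fst)
  have hbd : ∀ p : E' × E, |Φ p.1 p.2 * Ψ p.1| ≤ B * B' := fun p => by
    rw [abs_mul]
    exact mul_le_mul (hB _ _) (hB' _) (abs_nonneg _) ((abs_nonneg _).trans (hB p.1 p.2))
  have := integral_comp_prodMk_of_indepFun hXY.symm hY hX hm hbd
  rw [this]
  simp [integral_mul_const, h0]

variable {ε : ℤ → Ω → ℝ}

/-- Only the second moment in `y` is charged, not the squared supremum: for the density kernel this
is the difference between order `1/b` and order `1/b²`. The factor `16` is `4` from squaring a sum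
of four terms, times four terms of mean square at most `V`. -/
lemma integral_sq_degenerate_le {W : Ω → E} {e : Ω → ℝ} (hW : Measurable W) (he : Measurable e)
    (hind : IndepFun W e P) (heν : P.map e = ν)
    (hκ : Measurable (Function.uncurry κ)) {B V : ℝ} (hB : ∀ z y, |κ z y| ≤ B)
    (hV : ∀ z, ∫ y, κ z y ^ 2 ∂ν ≤ V) :
    ∫ ω, degenerate (P.map W) ν κ (W ω) (e ω) ^ 2 ∂P ≤ 16 * V := by
  have hπ := Measure.isProbabilityMeasure_map (μ := P) hW.aemeasurable
  have hV0 : ∀ z : E, 0 ≤ V := fun z => (integral_nonneg fun y => sq_nonneg (κ z y)).trans (hV z)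
  have hdm := measurable_degenerate (π := P.map W) (ν := ν) hκ
  have hd := abs_degenerate_le (π := P.map W) (ν := ν) hB
  rw [integral_comp_prodMk_of_indepFun (Φ := fun p => degenerate (P.map W) ν κ p.1 p.2 ^ 2)
    hind hW he (hdm.pow_const 2) (B := (4 * B) ^ 2) (fun p => by
      rw [abs_pow]; exact pow_le_pow_left₀ (abs_nonneg _) (hd p.1 p.2) 2), heν]
  set π := P.map W
  have hB2 : ∀ z y, |κ z y ^ 2| ≤ B ^ 2 := fun z y => by
    rw [abs_pow]; exact pow_le_pow_left₀ (abs_nonneg _) (hB z y) 2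
  have hκ2 : Measurable (Function.uncurry fun z y => κ z y ^ 2) := hκ.pow_const 2
  have hcol : Integrable (fun y => ∫ z, κ z y ^ 2 ∂π) ν :=
    integrable_of_abs_le (measurable_integral_left hκ2)
      fun y => abs_integral_le_of_abs_le fun z => hB2 z y
  have hswap : ∫ y, ∫ z, κ z y ^ 2 ∂π ∂ν ≤ V := by
    rw [← integral_integral_swap (integrable_of_abs_le hκ2 fun p => hB2 p.1 p.2)]
    calc _ ≤ ∫ z, V ∂π := integral_mono (integrable_of_abs_le (measurable_integral_right hκ2)
            fun z => abs_integral_le_of_abs_le (hB2 z)) (integrable_const _) hV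
      _ = V := by simp
  have hmean : (∫ z', ∫ y', κ z' y' ∂ν ∂π) ^ 2 ≤ V := by
    refine (sq_integral_le (memLp_of_abs_le (measurable_integral_right hκ)
      (fun z => abs_integral_le_of_abs_le (hB z)) 2)).trans ?_
    calc _ ≤ ∫ z, V ∂π := by
          refine integral_mono (integrable_of_abs_le ((measurable_integral_right hκ).pow_const 2)
            (B := B ^ 2) fun z => ?_) (integrable_const _) fun z => ?_
          · rw [abs_pow]
            exact pow_le_pow_left₀ (abs_nonneg _) (abs_integral_le_of_abs_le (hB z)) 2
          · exact (sq_integral_le (memLp_of_abs_le (hκ.comp measurable_prodMk_left)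
              (hB z) 2)).trans (hV z)
      _ = V := by simp
  have hz : ∀ z, ∫ y, degenerate π ν κ z y ^ 2 ∂ν ≤
      4 * V + 4 * V + 4 * ∫ y, ∫ z, κ z y ^ 2 ∂π ∂ν + 4 * V := by
    intro z
    have hi1 : Integrable (fun y => κ z y ^ 2) ν :=
      integrable_of_abs_le (hκ2.comp measurable_prodMk_left) (hB2 z)
    have hrow : (∫ y', κ z y' ∂ν) ^ 2 ≤ V :=
      (sq_integral_le (memLp_of_abs_le (hκ.comp measurable_prodMk_left) (hB z) 2)).trans (hV z)
    have hbound : ∀ y, degenerate π ν κ z y ^ 2 ≤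
        4 * κ z y ^ 2 + 4 * ∫ z', κ z' y ^ 2 ∂π + (4 * V + 4 * V) := by
      intro y
      have hc : (∫ z', κ z' y ∂π) ^ 2 ≤ ∫ z', κ z' y ^ 2 ∂π :=
        sq_integral_le (memLp_of_abs_le (hκ.comp measurable_prodMk_right) (fun z => hB z y) 2)
      unfold degenerate
      nlinarith [sq_nonneg (κ z y + ∫ y', κ z y' ∂ν), sq_nonneg (κ z y + ∫ z', κ z' y ∂π),
        sq_nonneg (κ z y - ∫ z', ∫ y', κ z' y' ∂ν ∂π),
        sq_nonneg (∫ y', κ z y' ∂ν - ∫ z', κ z' y ∂π),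
        sq_nonneg (∫ y', κ z y' ∂ν + ∫ z', ∫ y', κ z' y' ∂ν ∂π),
        sq_nonneg (∫ z', κ z' y ∂π + ∫ z', ∫ y', κ z' y' ∂ν ∂π)]
    have hi12 : Integrable (fun y => 4 * κ z y ^ 2 + 4 * ∫ z', κ z' y ^ 2 ∂π) ν :=
      (hi1.const_mul 4).add (hcol.const_mul 4)
    calc _ ≤ ∫ y, (4 * κ z y ^ 2 + 4 * ∫ z', κ z' y ^ 2 ∂π + (4 * V + 4 * V)) ∂ν := by
          refine integral_mono (integrable_of_abs_le
            ((hdm.comp measurable_prodMk_left).pow_const 2) (B := (4 * B) ^ 2) fun y => ?_)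
            (hi12.add (integrable_const _)) hbound
          rw [abs_pow]; exact pow_le_pow_left₀ (abs_nonneg _) (hd z y) 2
      _ = 4 * ∫ y, κ z y ^ 2 ∂ν + 4 * ∫ y, ∫ z, κ z y ^ 2 ∂π ∂ν + (4 * V + 4 * V) := by
          rw [integral_add hi12 (integrable_const _), integral_add (hi1.const_mul 4)
            (hcol.const_mul 4), integral_const_mul, integral_const_mul]
          simp
      _ ≤ _ := by linarith [hV z]
  calc _ ≤ ∫ z, (16 * V) ∂π := by
        have hdm2 : Measurable (Function.uncurry fun z y => degenerate π ν κ z y ^ 2) :=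
          hdm.pow_const 2
        refine integral_mono (integrable_of_abs_le (measurable_integral_right hdm2)
          (B := (4 * B) ^ 2) fun z => abs_integral_le_of_abs_le fun y => ?_)
          (integrable_const _) fun z => ?_
        · rw [abs_pow]; exact pow_le_pow_left₀ (abs_nonneg _) (hd z y) 2
        · linarith [hz z]
    _ = _ := by simp

/-- The pairs `(i, j)` for which `j` is not among the `ℓ` indices that precede `i`. -/
def farPairs (n ℓ : ℕ) : Finset (ℕ × ℕ) :=
  (Finset.Icc 1 n ×ˢ Finset.Icc 1 n).filter fun p => ¬ (p.1 < p.2 + ℓ ∧ p.2 < p.1)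

lemma card_farPairs_le (n ℓ : ℕ) : (farPairs n ℓ).card ≤ n ^ 2 := by
  refine (Finset.card_filter_le _ _).trans ?_
  simp [sq]

/-- Second moment of a degenerate `U`-statistic of finite blocks of the noise. -/
lemma integral_sq_sum_degenerate_le (h : IsIIDNoise P ν ε) {n ℓ : ℕ} (hℓ : 1 ≤ ℓ)
    {W : ℕ → Ω → E}
    (hW : ∀ i : ℕ, Measurable[noiseField ε (Set.Ioo ((i : ℤ) - ℓ) i)] (W i))
    (hκ : Measurable (Function.uncurry κ)) {B V : ℝ} (hB : ∀ z y, |κ z y| ≤ B)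
    (hV0 : 0 ≤ V) (hV : ∀ z, ∫ y, κ z y ^ 2 ∂ν ≤ V) :
    ∫ ω, (∑ p ∈ farPairs n ℓ, degenerate (P.map (W p.1)) ν κ (W p.1 ω) (ε p.2 ω)) ^ 2 ∂P ≤
      n ^ 2 * (3 * ℓ ^ 2) * (16 * V) := by
  have hWm : ∀ i, Measurable (W i) := fun i => (hW i).mono (h.noiseField_le _) le_rfl
  have hπ : ∀ i, IsProbabilityMeasure (P.map (W i)) :=
    fun i => Measure.isProbabilityMeasure_map (hWm i).aemeasurable
  have hdm : ∀ i, Measurable (Function.uncurry (degenerate (P.map (W i)) ν κ)) :=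
    fun i => measurable_degenerate hκ
  have hd : ∀ i z y, |degenerate (P.map (W i)) ν κ z y| ≤ 4 * B := fun i => abs_degenerate_le hB
  have hfar : ∀ p ∈ farPairs n ℓ, (p.2 : ℤ) ∉ Set.Ioo ((p.1 : ℤ) - ℓ) p.1 := by
    rintro p hp ⟨h1, h2⟩
    exact (Finset.mem_filter.1 hp).2 ⟨by omega, by omega⟩
  -- Two pairs `(i, j)`, `(i', j')` can be correlated only if `j = j'` and the blocks of `i` and
  -- `i'` overlap, or if each noise index lies in the block of the other pair. This leaves at most
  -- `2ℓ + ℓ²` neighbors. Truncated subtraction does no harm since all indices are at least `1`.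
  set Nb : ℕ × ℕ → Finset (ℕ × ℕ) := fun p =>
    Finset.Ioo (p.1 - ℓ) (p.1 + ℓ) ×ˢ {p.2} ∪
      Finset.Ioo p.2 (p.2 + ℓ) ×ˢ Finset.Ioo (p.1 - ℓ) p.1 with hNb
  have hcard : ∀ p ∈ farPairs n ℓ, (Nb p).card ≤ 3 * ℓ ^ 2 := by
    intro p _
    refine (Finset.card_union_le _ _).trans ?_
    rw [Finset.card_product, Finset.card_product, Finset.card_singleton, Nat.card_Ioo,
      Nat.card_Ioo, Nat.card_Ioo]
    have h1 : p.1 + ℓ - (p.1 - ℓ) - 1 ≤ 2 * ℓ := by omega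
    have h2 : p.2 + ℓ - p.2 - 1 ≤ ℓ := by omega
    have h3 : p.1 - (p.1 - ℓ) - 1 ≤ ℓ := by omega
    have h4 := Nat.mul_le_mul h2 h3
    nlinarith
  have hindep : ∀ p ∈ farPairs n ℓ, IndepFun (W p.1) (ε p.2) P := fun p hp =>
    h.indepFun (T := {(p.2 : ℤ)}) (Set.disjoint_singleton_right.2 (hfar p hp)) (hW p.1)
      (measurable_noiseField ε rfl)
  have hLp : ∀ p : ℕ × ℕ, MemLp (fun ω => degenerate (P.map (W p.1)) ν κ (W p.1 ω) (ε p.2 ω)) 2 P :=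
    fun p => memLp_of_abs_le ((hdm p.1).comp ((hWm p.1).prodMk (h.measurable p.2)))
      (fun ω => hd _ _ _) 2
  -- the case in which the noise variable of `p` is isolated
  have hiso : ∀ p ∈ farPairs n ℓ, ∀ p' ∈ farPairs n ℓ, p.2 ≠ p'.2 →
      (p.2 : ℤ) ∉ Set.Ioo ((p'.1 : ℤ) - ℓ) p'.1 →
      ∫ ω, degenerate (P.map (W p.1)) ν κ (W p.1 ω) (ε p.2 ω) *
        degenerate (P.map (W p'.1)) ν κ (W p'.1 ω) (ε p'.2 ω) ∂P = 0 := by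
    intro p hp p' hp' hne hnot
    set T : Set ℤ := Set.Ioo ((p.1 : ℤ) - ℓ) p.1 ∪ (Set.Ioo ((p'.1 : ℤ) - ℓ) p'.1 ∪ {(p'.2 : ℤ)})
    have hdisj : Disjoint {(p.2 : ℤ)} T := by
      rw [Set.disjoint_singleton_left]
      rintro (h1 | h1 | h1)
      · exact hfar p hp h1
      · exact hnot h1
      · exact hne (Nat.cast_injective (Set.mem_singleton_iff.1 h1))
    have hT : Measurable[noiseField ε T] fun ω => (W p.1 ω, W p'.1 ω, ε p'.2 ω) := by
      refine Measurable.prodMk ?_ (Measurable.prodMk ?_ ?_)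
      · exact (hW p.1).mono (noiseField_mono ε Set.subset_union_left) le_rfl
      · exact (hW p'.1).mono (noiseField_mono ε
          (Set.subset_union_left.trans Set.subset_union_right)) le_rfl
      · exact measurable_noiseField ε (Or.inr (Or.inr rfl))
    have hXY := h.indepFun hdisj (measurable_noiseField ε (k := (p.2 : ℤ)) rfl) hT
    have := integral_mul_eq_zero_of_indepFun hXY (h.measurable _)
      ((hWm p.1).prodMk ((hWm p'.1).prodMk (h.measurable _)))
      (Φ := fun q x => degenerate (P.map (W p.1)) ν κ q.1 x) (B := 4 * B)
      (by have := (hdm p.1).comp ((measurable_fst.comp measurable_fst).prodMk measurable_snd :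
            Measurable fun q : (E × E × ℝ) × ℝ => (q.1.1, q.2))
          exact this)
      (fun q x => hd _ _ _)
      (fun q => by rw [h.map_eq]; exact integral_degenerate_right hκ hB _)
      (Ψ := fun q => degenerate (P.map (W p'.1)) ν κ q.2.1 q.2.2) (B' := 4 * B)
      ((hdm p'.1).comp measurable_snd) (fun q => hd _ _ _)
    exact this
  have key := integral_sq_sum_le_of_neighbors (P := P) (farPairs n ℓ) Nb (3 * ℓ ^ 2) hcard
    (Y := fun p ω => degenerate (P.map (W p.1)) ν κ (W p.1 ω) (ε p.2 ω)) (fun p _ => hLp p)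
    (V := 16 * V)
    (fun p hp => integral_sq_degenerate_le (hWm p.1) (h.measurable _) (hindep p hp) (h.map_eq _)
      hκ hB hV) ?_
  · refine key.trans ?_
    have h1 : ((farPairs n ℓ).card : ℝ) ≤ n ^ 2 := by exact_mod_cast card_farPairs_le n ℓ
    push_cast
    gcongr
  · intro p hp p' hp' hnb
    have hp1 := Finset.mem_product.1 (Finset.mem_filter.1 hp).1
    have hp1' := Finset.mem_product.1 (Finset.mem_filter.1 hp').1
    simp only [Finset.mem_Icc] at hp1 hp1'
    simp only [hNb, Finset.mem_union, Finset.mem_product, Finset.mem_Ioo, Finset.mem_singleton,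
      not_or, not_and_or] at hnb
    by_cases hj : p.2 = p'.2
    -- With a common noise variable the blocks are disjoint, so `W p.1` is independent of everything
    -- else and is integrated out. For this the degenerate part has to be formed with the law of `W
    -- p.1` itself rather than with that of the state.
    · have hdisj : Disjoint (Set.Ioo ((p.1 : ℤ) - ℓ) p.1)
          (Set.Ioo ((p'.1 : ℤ) - ℓ) p'.1 ∪ {(p.2 : ℤ)}) := by
        rw [Set.disjoint_union_right]
        refine ⟨Set.disjoint_left.2 fun k hk hk' => ?_,
          Set.disjoint_singleton_right.2 (hfar p hp)⟩
        obtain ⟨h1, h2⟩ := hk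
        obtain ⟨h3, h4⟩ := hk'
        omega
      have hT : Measurable[noiseField ε (Set.Ioo ((p'.1 : ℤ) - ℓ) p'.1 ∪ {(p.2 : ℤ)})]
          fun ω => (W p'.1 ω, ε p.2 ω) := by
        refine Measurable.prodMk ?_ ?_
        · exact (hW p'.1).mono (noiseField_mono ε Set.subset_union_left) le_rfl
        · exact measurable_noiseField ε (Or.inr rfl)
      have hXY := h.indepFun hdisj (hW p.1) hT
      have := integral_mul_eq_zero_of_indepFun hXY (hWm p.1)
        ((hWm p'.1).prodMk (h.measurable _))
        (Φ := fun q x => degenerate (P.map (W p.1)) ν κ x q.2) (B := 4 * B)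
        (by have := (hdm p.1).comp (measurable_snd.prodMk (measurable_snd.comp measurable_fst) :
              Measurable fun q : (E × ℝ) × E => (q.2, q.1.2))
            exact this)
        (fun q x => hd _ _ _)
        (fun q => integral_degenerate_left hκ hB _)
        (Ψ := fun q => degenerate (P.map (W p'.1)) ν κ q.1 q.2) (B' := 4 * B)
        (hdm p'.1) (fun q => hd _ _ _)
      rw [← hj]
      exact this
    -- With different noise variables, one of them lies outside the block of the other pair, since
    -- otherwise the pairs would be neighbors; that variable is then isolated.
    · by_cases hb : (p.2 : ℤ) ∈ Set.Ioo ((p'.1 : ℤ) - ℓ) p'.1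
      · have hb' : (p'.2 : ℤ) ∉ Set.Ioo ((p.1 : ℤ) - ℓ) p.1 := by
          rintro ⟨h1, h2⟩
          obtain ⟨h3, h4⟩ := hb
          omega
        have := hiso p' hp' p hp (Ne.symm hj) hb'
        rw [← this]
        exact integral_congr_ae (ae_of_all _ fun ω => mul_comm _ _)
      · exact hiso p hp p' hp' hj hb

end UStatistic

/-! ### The kernel and the summands of the estimator -/

namespace IsKernel

variable {K : ℝ → ℝ} (hK : IsKernel K)
include hK

lemma eq_zero_of_one_lt_abs {x : ℝ} (hx : 1 < |x|) : K x = 0 := by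
  by_contra h
  have := hK.support_subset h
  exact absurd (abs_le.2 this) (not_le.2 hx)

lemma hasCompactSupport : HasCompactSupport K :=
  HasCompactSupport.of_support_subset_isCompact isCompact_Icc hK.support_subset

lemma continuous : Continuous K := hK.contDiff.continuous

lemma exists_bound : ∃ M : ℝ, 0 ≤ M ∧ ∀ x, |K x| ≤ M := by
  obtain ⟨M, hM⟩ := hK.hasCompactSupport.exists_bound_of_continuous hK.continuous
  exact ⟨M, (norm_nonneg _).trans (hM 0), hM⟩

lemma exists_lipschitz : ∃ L : ℝ, 0 ≤ L ∧ ∀ x y, |K x - K y| ≤ L * |x - y| := by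
  obtain ⟨L, hL⟩ := hK.contDiff.lipschitzWith_of_hasCompactSupport hK.hasCompactSupport one_ne_zero
  exact ⟨L, L.2, fun x y => by simpa [Real.dist_eq] using hL.dist_le_mul x y⟩

lemma integrable : Integrable K := hK.continuous.integrable_of_hasCompactSupport hK.hasCompactSupport

end IsKernel

/-- The rescaled kernel centered at `y`. -/
noncomputable def bump (K : ℝ → ℝ) (b y x : ℝ) : ℝ := b⁻¹ * K ((x - y) / b)

/-- The summands of the density estimator as functions of state and noise. -/
noncomputable def pairKernel (γ : ℝ) (K : ℝ → ℝ) (b v : ℝ) (z : ℝ × ℝ) (y : ℝ) : ℝ :=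
  scaled γ 1 (bump K b y) v z

section PairKernel

variable {K : ℝ → ℝ} {M L b γ : ℝ}

lemma abs_bump_le (hM : ∀ x, |K x| ≤ M) (hb : 0 < b) (y x : ℝ) : |bump K b y x| ≤ M / b := by
  unfold bump
  rw [abs_mul, abs_of_pos (inv_pos.2 hb), div_eq_inv_mul M]
  have := hM ((x - y) / b)
  gcongr

lemma abs_bump_sub_le (hL : ∀ x y, |K x - K y| ≤ L * |x - y|) (hb : 0 < b) (y x x' : ℝ) :
    |bump K b y x - bump K b y x'| ≤ L / b ^ 2 * |x - x'| := by
  unfold bump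
  rw [← mul_sub, abs_mul, abs_of_pos (inv_pos.2 hb)]
  have := hL ((x - y) / b) ((x' - y) / b)
  rw [← sub_div, sub_sub_sub_cancel_right, abs_div, abs_of_pos hb] at this
  calc _ ≤ b⁻¹ * (L * (|x - x'| / b)) := by gcongr
    _ = _ := by field_simp

lemma measurable_pairKernel (hK : Continuous K) (v : ℝ) :
    Measurable (Function.uncurry (pairKernel γ K b v)) := by
  have h1 := measurable_clampVol γ
  have h2 := hK.measurable
  unfold pairKernel scaled bump Function.uncurry
  fun_prop

lemma abs_pairKernel_le (hγ : 0 < γ) (hM : ∀ x, |K x| ≤ M) (hb : 0 < b) (v : ℝ) (z : ℝ × ℝ)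
    (y : ℝ) : |pairKernel γ K b v z y| ≤ γ⁻¹ * (M / b) := by
  simpa [pairKernel] using abs_scaled_le hγ 1 (abs_bump_le hM hb y) v z

lemma abs_pairKernel_sub_le (hγ : 0 < γ) (hL : ∀ x y, |K x - K y| ≤ L * |x - y|) (hb : 0 < b)
    (v w : ℝ) (z : ℝ × ℝ) (y : ℝ) :
    |pairKernel γ K b v z y - pairKernel γ K b w z y| ≤ γ⁻¹ ^ 2 * (L / b ^ 2) * |v - w| :=
  abs_scaled_sub_le hγ 1 (abs_bump_sub_le hL hb y) v w z

variable {ν : Measure ℝ} [IsProbabilityMeasure ν] {D : ℝ}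

/-- The smallness of the support gains a factor `τ`, here of order `b`, over the squared supremum. A
summand of size `1/b` thus has second moment of order `1/b`, and an increment of size `|v - w| / b²`
has second moment of order `|v - w|² / b³`. -/
lemma integral_sq_le_of_support {f : ℝ → ℝ} {A τ : ℝ}
    (hD : 0 ≤ D) (hν : ∀ S, ν S ≤ ENNReal.ofReal D * volume S) (hf : Measurable f)
    (hA : ∀ y, |f y| ≤ A) {S : Set ℝ} (hS : MeasurableSet S) (hτ : 0 ≤ τ)
    (hSτ : volume S ≤ ENNReal.ofReal τ) (h0 : ∀ y, y ∉ S → f y = 0) :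
    ∫ y, f y ^ 2 ∂ν ≤ A ^ 2 * (D * τ) := by
  have hνS : ν.real S ≤ D * τ := by
    refine ENNReal.toReal_le_of_le_ofReal (by positivity) ((hν S).trans ?_)
    rw [ENNReal.ofReal_mul hD]
    gcongr
  calc ∫ y, f y ^ 2 ∂ν ≤ ∫ y, S.indicator (fun _ => A ^ 2) y ∂ν := by
        refine integral_mono (integrable_of_abs_le (hf.pow_const 2) (B := A ^ 2) fun y => ?_)
          ((integrable_const _).indicator hS) fun y => ?_
        · rw [abs_pow]; exact pow_le_pow_left₀ (abs_nonneg _) (hA y) 2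
        · by_cases hy : y ∈ S
          · simp only [Set.indicator_of_mem hy]
            rw [← sq_abs]; exact pow_le_pow_left₀ (abs_nonneg _) (hA y) 2
          · simp [Set.indicator_of_notMem hy, h0 y hy]
    _ = ν.real S * A ^ 2 := by rw [integral_indicator_const _ hS, smul_eq_mul]
    _ ≤ _ := by rw [mul_comm]; gcongr

lemma bump_eq_zero (hK : IsKernel K) (hb : 0 < b) {x y : ℝ} (hy : y ∉ Set.Icc (x - b) (x + b)) :
    bump K b y x = 0 := by
  unfold bump
  rw [hK.eq_zero_of_one_lt_abs, mul_zero]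
  rw [abs_div, abs_of_pos hb, one_lt_div hb]
  by_contra h
  rw [not_lt, abs_le] at h
  exact hy ⟨by linarith [h.2], by linarith [h.1]⟩

lemma integral_sq_pairKernel_le (hK : IsKernel K) (hγ : 0 < γ) (hM : ∀ x, |K x| ≤ M) (hb : 0 < b)
    (hD : 0 ≤ D) (hν : ∀ S, ν S ≤ ENNReal.ofReal D * volume S) (v : ℝ) (z : ℝ × ℝ) :
    ∫ y, pairKernel γ K b v z y ^ 2 ∂ν ≤ 2 * γ⁻¹ ^ 2 * M ^ 2 * D / b := by
  set x := (v - z.1) * (clampVol γ z.2)⁻¹ with hx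
  refine (integral_sq_le_of_support hD hν
    ((measurable_pairKernel hK.continuous v).comp measurable_prodMk_left)
    (abs_pairKernel_le hγ hM hb v z) (S := Set.Icc (x - b) (x + b)) measurableSet_Icc
    (τ := 2 * b) (by positivity) ?_ fun y hy => ?_).trans (le_of_eq ?_)
  · rw [Real.volume_Icc]; exact ENNReal.ofReal_le_ofReal (by linarith)
  · show (clampVol γ z.2)⁻¹ ^ 1 * bump K b y x = 0
    rw [bump_eq_zero hK hb hy, mul_zero]
  · field_simp

lemma integral_sq_pairKernel_sub_le (hK : IsKernel K) (hγ : 0 < γ)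
    (hL : ∀ x y, |K x - K y| ≤ L * |x - y|) (hb : 0 < b)
    (hD : 0 ≤ D) (hν : ∀ S, ν S ≤ ENNReal.ofReal D * volume S) (v w : ℝ) (z : ℝ × ℝ) :
    ∫ y, (pairKernel γ K b v z y - pairKernel γ K b w z y) ^ 2 ∂ν ≤
      4 * γ⁻¹ ^ 4 * L ^ 2 * D / b ^ 3 * (v - w) ^ 2 := by
  set x := (v - z.1) * (clampVol γ z.2)⁻¹ with hx
  set x' := (w - z.1) * (clampVol γ z.2)⁻¹ with hx'
  refine (integral_sq_le_of_support hD hν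
    (((measurable_pairKernel hK.continuous v).comp measurable_prodMk_left).sub
      ((measurable_pairKernel hK.continuous w).comp measurable_prodMk_left))
    (abs_pairKernel_sub_le hγ hL hb v w z)
    (S := Set.Icc (x - b) (x + b) ∪ Set.Icc (x' - b) (x' + b))
    (measurableSet_Icc.union measurableSet_Icc)
    (τ := 4 * b) (by positivity) ?_ fun y hy => ?_).trans (le_of_eq ?_)
  · refine (measure_union_le _ _).trans ?_
    rw [Real.volume_Icc, Real.volume_Icc, ← ENNReal.ofReal_add (by linarith) (by linarith)]
    exact ENNReal.ofReal_le_ofReal (by linarith)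
  · rw [Set.mem_union, not_or] at hy
    show (clampVol γ z.2)⁻¹ ^ 1 * bump K b y x - (clampVol γ z.2)⁻¹ ^ 1 * bump K b y x' = 0
    rw [bump_eq_zero hK hb hy.1, bump_eq_zero hK hb hy.2, mul_zero, sub_self]
  · rw [mul_pow, sq_abs]
    field_simp

end PairKernel

/-! ### Uniform negligibility of the degenerate double sum -/

section Transfer

variable {Ω : Type*} [MeasurableSpace Ω] {P : Measure Ω} [IsProbabilityMeasure P]
  {ν : Measure ℝ} [IsProbabilityMeasure ν]

/-- Two of the four terms of the degenerate part depend on the state and change by at most `A *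
gap`. The other two depend on the law of the state and change by at most `A` times the mean
discrepancy under the coupling. -/
lemma abs_degenerate_sub_le {κ : ℝ × ℝ → ℝ → ℝ} (hκ : Measurable (Function.uncurry κ)) {A B : ℝ}
    (hB : ∀ z y, |κ z y| ≤ B) (hA : ∀ z z' y, |κ z y - κ z' y| ≤ A * gap z z')
    {X W : Ω → ℝ × ℝ} (hX : Measurable X) (hW : Measurable W) (z z' : ℝ × ℝ) (y : ℝ) :
    |degenerate (P.map X) ν κ z y - degenerate (P.map W) ν κ z' y| ≤
      2 * A * (gap z z' + ∫ ω, gap (X ω) (W ω) ∂P) := by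
  have hrow : ∀ z z', |∫ y, κ z y ∂ν - ∫ y, κ z' y ∂ν| ≤ A * gap z z' := fun z z' => by
    rw [← integral_sub (f := κ z) (g := κ z') (integrable_of_abs_le (hκ.comp measurable_prodMk_left) (hB z))
      (integrable_of_abs_le (hκ.comp measurable_prodMk_left) (hB z'))]
    exact abs_integral_le_of_abs_le fun y => hA z z' y
  have hg := IsNoiseDriven.integrable_gap (P := P) hX hW
  have hcol : ∀ {f : ℝ × ℝ → ℝ}, Measurable f → (∀ z, |f z| ≤ B) →
      (∀ z z', |f z - f z'| ≤ A * gap z z') →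
      |∫ z, f z ∂(P.map X) - ∫ z, f z ∂(P.map W)| ≤ A * ∫ ω, gap (X ω) (W ω) ∂P := by
    intro f hf hfB hfA
    rw [integral_map hX.aemeasurable hf.aestronglyMeasurable,
      integral_map hW.aemeasurable hf.aestronglyMeasurable,
      ← integral_sub (f := fun ω => f (X ω)) (g := fun ω => f (W ω))
        (integrable_of_abs_le (hf.comp hX) fun ω => hfB _)
        (integrable_of_abs_le (hf.comp hW) fun ω => hfB _), ← integral_const_mul]
    refine abs_integral_le_integral_abs.trans ?_
    exact integral_mono ((integrable_of_abs_le (hf.comp hX) fun ω => hfB _).sub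
        (integrable_of_abs_le (hf.comp hW) fun ω => hfB _)).abs (hg.const_mul A)
        fun ω => hfA _ _
  have h1 := hA z z' y
  have h2 := hrow z z'
  have h3 := hcol (f := fun z => κ z y) (hκ.comp measurable_prodMk_right) (fun z => hB z y)
    fun z z' => hA z z' y
  have h4 := hcol (measurable_integral_right (ν := ν) hκ)
    (fun z => abs_integral_le_of_abs_le (hB z)) hrow
  unfold degenerate
  rw [abs_le] at *
  constructor <;> linarith

end Transfer

section Uniform

variable {Ω : Type*} [MeasurableSpace Ω] {P : Measure Ω} [IsProbabilityMeasure P] {ν : Measure ℝ}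
  {ε : ℤ → Ω → ℝ} {Z : ℤ → Ω → ℝ × ℝ} {C a : ℝ}

lemma card_near_le (n ℓ : ℕ) : ((Finset.Icc 1 n ×ˢ Finset.Icc 1 n).filter
    fun p : ℕ × ℕ => p.1 < p.2 + ℓ ∧ p.2 < p.1).card ≤ n * ℓ := by
  have hsub : ((Finset.Icc 1 n ×ˢ Finset.Icc 1 n).filter
      fun p : ℕ × ℕ => p.1 < p.2 + ℓ ∧ p.2 < p.1) ⊆
      (Finset.Icc 1 n ×ˢ Finset.range ℓ).image fun q : ℕ × ℕ => (q.1, q.1 - q.2) := by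
    intro p hp
    simp only [Finset.mem_filter, Finset.mem_product, Finset.mem_Icc] at hp
    refine Finset.mem_image.2 ⟨(p.1, p.1 - p.2), ?_, ?_⟩
    · simp only [Finset.mem_product, Finset.mem_Icc, Finset.mem_range]; omega
    · ext <;> simp; omega
  refine (Finset.card_le_card hsub).trans (Finset.card_image_le.trans ?_)
  simp

set_option maxHeartbeats 1000000 in
/-- The degenerate part of the density estimator is uniformly negligible. -/
lemma exists_measure_iSup_degenerate_gt_le (h : IsNoiseDriven P ν ε Z C a) {K : ℝ → ℝ}
    (hK : IsKernel K) {γ : ℝ} (hγ : 0 < γ) {D : ℝ} (hD : 0 ≤ D)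
    (hν : ∀ S, ν S ≤ ENNReal.ofReal D * volume S) {α β : ℝ} (hαβ : α ≤ β) :
    ∃ Q : ℝ, 0 ≤ Q ∧ ∀ (n ℓ : ℕ) (b η : ℝ), 1 ≤ n → 1 ≤ ℓ → 0 < b → b ≤ 1 → 0 < η →
      Q * (ℓ / (√(n : ℝ) * b)) ≤ η →
      P {ω | ENNReal.ofReal η < ⨆ v ∈ Set.Icc α β, ‖(√(n : ℝ))⁻¹ * (n : ℝ)⁻¹ *
        ∑ i ∈ Finset.Icc 1 n, ∑ j ∈ Finset.Icc 1 n,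
          degenerate (P.map (Z 0)) ν (pairKernel γ K b v) (Z i ω) (ε j ω)‖ₑ} ≤
      ENNReal.ofReal (Q * (√(n : ℝ) * (b ^ 2)⁻¹ * a ^ ℓ / η + ℓ ^ 2 / (n * b ^ 2) / η ^ 2)) := by
  obtain ⟨M, hM0, hM⟩ := hK.exists_bound
  obtain ⟨L, hL0, hL⟩ := hK.exists_lipschitz
  have hprobν := h.noise.isProbabilityMeasure
  obtain ⟨C₁, hC₁, hgap⟩ := exists_abs_scaled_sub_le_gap hγ 1 (max |α| |β|)
  have hγi : 0 < γ⁻¹ := inv_pos.2 hγ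
  set V₁ := 2 * γ⁻¹ ^ 2 * M ^ 2 * D with hV₁
  set V₂ := 4 * γ⁻¹ ^ 4 * L ^ 2 * D with hV₂
  have hV₁0 : 0 ≤ V₁ := by positivity
  have hV₂0 : 0 ≤ V₂ := by positivity
  set Q₁ := 12 * γ⁻¹ * M
  set Q₂ := 12 * C₁ * (M + L) * C
  set Q₃ := 36 * 48 * (3 * V₁ + V₂ * (β - α) ^ 2 / 2)
  have hQ₁ : 0 ≤ Q₁ := by positivity
  have hC0 := h.nonneg
  have hQ₂ : 0 ≤ Q₂ := by positivity
  have hQ₃ : 0 ≤ Q₃ := by positivity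
  -- `Q₁` pays for the pairs with `j` in the block of `i`, `Q₂` for the coupling error, `Q₃` for the
  -- blocked U-statistic.
  refine ⟨Q₁ + Q₂ + Q₃, by positivity, ?_⟩
  intro n ℓ b η hn hℓ hb hb1 hη hnear
  have hn0 : (0 : ℝ) < n := by exact_mod_cast hn
  have hsn : 0 < √(n : ℝ) := Real.sqrt_pos.2 hn0
  have hsn2 : √(n : ℝ) ^ 2 = n := Real.sq_sqrt hn0.le
  have ha0 := h.rate_pos
  choose! W hW hWg using fun i : ℕ => h.coupling i ℓ hℓ
  have hWm : ∀ i, Measurable (W i) := fun i => (hW i).mono (h.noise.noiseField_le _) le_rfl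
  have hWp : ∀ i, IsProbabilityMeasure (P.map (W i)) :=
    fun i => Measure.isProbabilityMeasure_map (hWm i).aemeasurable
  have hπ := h.isProbabilityMeasure_map 0
  set κ : ℝ → ℝ × ℝ → ℝ → ℝ := fun v => pairKernel γ K b v with hκ
  have hκm : ∀ v, Measurable (Function.uncurry (κ v)) := measurable_pairKernel hK.continuous
  have hκB : ∀ v z y, |κ v z y| ≤ γ⁻¹ * (M / b) := fun v z y => abs_pairKernel_le hγ hM hb v z y
  set A := C₁ * (M / b + L / b ^ 2) with hA
  have hA0 : 0 ≤ A := by positivity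
  -- For `b ≤ 1` the Lipschitz constant of the summands in the state is of order `b⁻²`; the decay `a
  -- ^ ℓ` has to beat this factor.
  have hAle : A ≤ C₁ * (M + L) * (b ^ 2)⁻¹ := by
    rw [hA, mul_assoc]
    have : M / b ≤ M * (b ^ 2)⁻¹ := by
      rw [div_eq_mul_inv]
      have : b⁻¹ ≤ (b ^ 2)⁻¹ := inv_anti₀ (by positivity) (by nlinarith)
      gcongr
    have e : (M + L) * (b ^ 2)⁻¹ = M * (b ^ 2)⁻¹ + L / b ^ 2 := by rw [div_eq_mul_inv]; ring
    rw [e]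
    gcongr
  have hvV : ∀ v ∈ Set.Icc α β, |v| ≤ max |α| |β| := fun v hv => abs_le_max_abs_abs hv.1 hv.2
  have hκA : ∀ v ∈ Set.Icc α β, ∀ z z' y, |κ v z y - κ v z' y| ≤ A * gap z z' :=
    fun v hv z z' y => hgap _ _ _ (abs_bump_le hM hb y) (abs_bump_sub_le hL hb y) v (hvV v hv) z z'
  set c := (√(n : ℝ))⁻¹ * (n : ℝ)⁻¹ with hc
  have hc0 : 0 < c := by positivity
  have hcn : c * n = (√(n : ℝ))⁻¹ := by rw [hc]; field_simp
  have hc2 : c ^ 2 * n ^ 2 = (n : ℝ)⁻¹ := by rw [← mul_pow, hcn, inv_pow, hsn2]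
  clear_value c V₁ V₂
  -- the contribution of independent pairs
  set S : ℝ → Ω → ℝ := fun v ω => c * ∑ p ∈ farPairs n ℓ,
    degenerate (P.map (W p.1)) ν (κ v) (W p.1 ω) (ε p.2 ω) with hS
  have hdiff : ∀ v w, ∀ ω, S v ω - S w ω = c * ∑ p ∈ farPairs n ℓ,
      degenerate (P.map (W p.1)) ν (fun z y => κ v z y - κ w z y) (W p.1 ω) (ε p.2 ω) := by
    intro v w ω
    simp only [hS]
    rw [← mul_sub, ← Finset.sum_sub_distrib]
    congr 1
    exact Finset.sum_congr rfl fun p _ =>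
      (degenerate_sub (hκm v) (hκm w) (hκB v) (hκB w) _ _).symm
  have hdm : ∀ i, ∀ v, Measurable (Function.uncurry (degenerate (P.map (W i)) ν (κ v))) :=
    fun i v => measurable_degenerate (hκm v)
  have hSL : ∀ v, MemLp (S v) 2 P := fun v => by
    have : ∀ p ∈ farPairs n ℓ, MemLp
        (fun ω => degenerate (P.map (W p.1)) ν (κ v) (W p.1 ω) (ε p.2 ω)) 2 P := fun p _ =>
      memLp_of_abs_le ((hdm p.1 v).comp ((hWm p.1).prodMk (h.noise.measurable p.2)))
        (fun ω => abs_degenerate_le (hκB v) _ _) 2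
    exact (memLp_finsetSum _ this).const_mul c
  have hSA : ∀ v, ∫ ω, S v ω ^ 2 ∂P ≤ 48 * ℓ ^ 2 * (n : ℝ)⁻¹ * (V₁ / b) := fun v => by
    simp only [hS, mul_pow]
    rw [integral_const_mul]
    calc _ ≤ c ^ 2 * (n ^ 2 * (3 * ℓ ^ 2) * (16 * (V₁ / b))) := by
          have := integral_sq_sum_degenerate_le (n := n) h.noise hℓ hW (hκm v) (hκB v)
            (V := V₁ / b) (by positivity)
            (fun z => by rw [hV₁]; exact integral_sq_pairKernel_le hK hγ hM hb hD hν v z)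
          gcongr
      _ = (c ^ 2 * n ^ 2) * (48 * ℓ ^ 2 * (V₁ / b)) := by ring
      _ = _ := by rw [hc2]; ring
  have hκd : ∀ v w, Measurable (Function.uncurry fun z y => κ v z y - κ w z y) :=
    fun v w => (hκm v).sub (hκm w)
  have hSB : ∀ v w, ∫ ω, (S v ω - S w ω) ^ 2 ∂P ≤
      48 * ℓ ^ 2 * (n : ℝ)⁻¹ * (V₂ / b ^ 3) * (v - w) ^ 2 := fun v w => by
    simp only [hdiff, mul_pow]
    rw [integral_const_mul]
    calc _ ≤ c ^ 2 * (n ^ 2 * (3 * ℓ ^ 2) * (16 * (V₂ / b ^ 3 * (v - w) ^ 2))) := by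
          have := integral_sq_sum_degenerate_le (n := n) h.noise hℓ hW (hκd v w)
            (abs_pairKernel_sub_le hγ hL hb v w) (V := V₂ / b ^ 3 * (v - w) ^ 2) (by positivity)
            (fun z => by rw [hV₂]; exact integral_sq_pairKernel_sub_le hK hγ hL hb hD hν v w z)
          gcongr
      _ = (c ^ 2 * n ^ 2) * (48 * ℓ ^ 2 * (V₂ / b ^ 3) * (v - w) ^ 2) := by ring
      _ = _ := by rw [hc2]; ring
  have hSΛ : ∀ ω, ∀ v w, |S v ω - S w ω| ≤
      c * ((farPairs n ℓ).card * (4 * (γ⁻¹ ^ 2 * (L / b ^ 2)))) * |v - w| := fun ω v w => by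
    rw [hdiff, abs_mul, abs_of_pos hc0, mul_assoc]
    refine mul_le_mul_of_nonneg_left ?_ hc0.le
    calc _ ≤ ∑ p ∈ farPairs n ℓ, 4 * (γ⁻¹ ^ 2 * (L / b ^ 2) * |v - w|) :=
          (Finset.abs_sum_le_sum_abs _ _).trans (Finset.sum_le_sum fun p _ =>
            abs_degenerate_le (abs_pairKernel_sub_le hγ hL hb v w) _ _)
      _ = _ := by rw [Finset.sum_const, nsmul_eq_mul]; ring
  -- The values have second moment of order `ℓ²/(n b)` and the difference quotients of order `ℓ²/(n
  -- b³)`. The choice `τ = b` brings both contributions to the order `ℓ²/(n b²)`.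
  have hSsup := measure_iSup_gt_le (P := P) (S := S) hαβ hb (by positivity : 0 < η / 3)
    (fun v _ => hSL v) (fun v _ => hSA v) (fun v _ w _ => hSB v w) (fun ω v _ w _ => hSΛ ω v w)
  -- the error of the coupling
  set T : Ω → ℝ := fun ω => (√(n : ℝ))⁻¹ * ∑ i ∈ Finset.Icc 1 n,
    2 * A * (gap (Z i ω) (W i ω) + ∫ ω, gap (Z i ω) (W i ω) ∂P) with hT
  have hgi : ∀ i : ℕ, Integrable (fun ω => gap (Z i ω) (W i ω)) P :=
    fun i => IsNoiseDriven.integrable_gap (h.measurable i) (hWm i)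
  have hTnn : ∀ ω, 0 ≤ T ω := fun ω => by
    refine mul_nonneg (by positivity) (Finset.sum_nonneg fun i _ => mul_nonneg (by positivity) ?_)
    exact add_nonneg (gap_nonneg _ _) (integral_nonneg fun ω => gap_nonneg _ _)
  have hTi' : ∀ i ∈ Finset.Icc 1 n, Integrable (fun ω =>
      2 * A * (gap (Z i ω) (W i ω) + ∫ ω, gap (Z i ω) (W i ω) ∂P)) P :=
    fun i _ => ((hgi i).add (integrable_const _)).const_mul _
  have hTi : Integrable T P := (integrable_finsetSum _ hTi').const_mul _
  have hTE : ∫ ω, T ω ∂P ≤ 4 * A * C * √(n : ℝ) * a ^ ℓ := by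
    simp only [hT]
    rw [integral_const_mul, integral_finsetSum _ hTi']
    calc _ ≤ (√(n : ℝ))⁻¹ * ∑ i ∈ Finset.Icc 1 n, 2 * A * (2 * (C * a ^ ℓ)) := by
          gcongr with i hi
          rw [integral_const_mul, integral_add (hgi i) (integrable_const _)]
          simp only [integral_const, probReal_univ, one_smul]
          have := hWg i
          gcongr
          linarith
      _ = (√(n : ℝ))⁻¹ * √(n : ℝ) ^ 2 * (4 * A * C * a ^ ℓ) := by
          rw [hsn2]; simp; ring
      _ = _ := by field_simp
  have hTP := measure_ge_le_ofReal_integral_div hTnn hTi (by positivity : 0 < η / 3)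
  -- the decomposition
  have hdec : ∀ ω, ∀ v ∈ Set.Icc α β, |c * ∑ i ∈ Finset.Icc 1 n, ∑ j ∈ Finset.Icc 1 n,
      degenerate (P.map (Z 0)) ν (κ v) (Z i ω) (ε j ω)| ≤ |S v ω| + η / 3 + T ω := by
    intro ω v hv
    set d : ℕ × ℕ → ℝ := fun p => degenerate (P.map (Z 0)) ν (κ v) (Z p.1 ω) (ε p.2 ω) with hd
    set d' : ℕ × ℕ → ℝ := fun p => degenerate (P.map (W p.1)) ν (κ v) (W p.1 ω) (ε p.2 ω) with hd'
    have e1 : ∑ i ∈ Finset.Icc 1 n, ∑ j ∈ Finset.Icc 1 n,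
        degenerate (P.map (Z 0)) ν (κ v) (Z i ω) (ε j ω) =
        ∑ p ∈ Finset.Icc 1 n ×ˢ Finset.Icc 1 n, d p := (Finset.sum_product' _ _ _).symm
    rw [e1, ← Finset.sum_filter_add_sum_filter_not _ (fun p : ℕ × ℕ => p.1 < p.2 + ℓ ∧ p.2 < p.1)]
    change |c * (_ + ∑ p ∈ farPairs n ℓ, d p)| ≤ _
    -- At most `n ℓ` pairs of size `1/b`: after normalization by `n^{3/2}` they amount to `ℓ / (√n
    -- b)`, which needs no cancellation.
    have hdn : |∑ p ∈ (Finset.Icc 1 n ×ˢ Finset.Icc 1 n).filter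
        (fun p : ℕ × ℕ => p.1 < p.2 + ℓ ∧ p.2 < p.1), d p| ≤ (n * ℓ : ℝ) * (4 * (γ⁻¹ * (M / b))) := by
      calc _ ≤ ∑ p ∈ (Finset.Icc 1 n ×ˢ Finset.Icc 1 n).filter
            (fun p : ℕ × ℕ => p.1 < p.2 + ℓ ∧ p.2 < p.1), (4 * (γ⁻¹ * (M / b))) :=
            (Finset.abs_sum_le_sum_abs _ _).trans (Finset.sum_le_sum fun p _ =>
              abs_degenerate_le (hκB v) _ _)
        _ ≤ _ := by
            rw [Finset.sum_const, nsmul_eq_mul]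
            have : (((Finset.Icc 1 n ×ˢ Finset.Icc 1 n).filter
              fun p : ℕ × ℕ => p.1 < p.2 + ℓ ∧ p.2 < p.1).card : ℝ) ≤ n * ℓ := by
              exact_mod_cast card_near_le n ℓ
            gcongr
    have hdf : |∑ p ∈ farPairs n ℓ, (d p - d' p)| ≤ n * ∑ i ∈ Finset.Icc 1 n,
        2 * A * (gap (Z i ω) (W i ω) + ∫ ω, gap (Z i ω) (W i ω) ∂P) := by
      have hnn : ∀ i : ℕ, 0 ≤ 2 * A * (gap (Z i ω) (W i ω) + ∫ ω, gap (Z i ω) (W i ω) ∂P) :=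
        fun i => mul_nonneg (by positivity)
          (add_nonneg (gap_nonneg _ _) (integral_nonneg fun ω => gap_nonneg _ _))
      calc _ ≤ ∑ p ∈ farPairs n ℓ, 2 * A * (gap (Z p.1 ω) (W p.1 ω) +
            ∫ ω, gap (Z p.1 ω) (W p.1 ω) ∂P) := by
            refine (Finset.abs_sum_le_sum_abs _ _).trans (Finset.sum_le_sum fun p _ => ?_)
            simp only [hd, hd']
            rw [← h.map_state p.1]
            exact abs_degenerate_sub_le (hκm v) (hκB v) (hκA v hv) (h.measurable _) (hWm _) _ _ _
        _ ≤ ∑ p ∈ Finset.Icc 1 n ×ˢ Finset.Icc 1 n, 2 * A * (gap (Z p.1 ω) (W p.1 ω) +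
            ∫ ω, gap (Z p.1 ω) (W p.1 ω) ∂P) :=
            Finset.sum_le_sum_of_subset_of_nonneg (Finset.filter_subset _ _) fun p _ _ => hnn p.1
        _ = _ := by
            rw [Finset.sum_product]
            simp [Finset.mul_sum]
    have e2 : ∀ x : ℝ, c * (x + ∑ p ∈ farPairs n ℓ, d p) =
        S v ω + c * x + c * ∑ p ∈ farPairs n ℓ, (d p - d' p) := fun x => by
      simp only [hS]
      rw [Finset.sum_sub_distrib]; ring
    rw [e2]
    have hn1 : c * ((n * ℓ : ℝ) * (4 * (γ⁻¹ * (M / b)))) ≤ η / 3 := by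
      have e3 : c * ((n * ℓ : ℝ) * (4 * (γ⁻¹ * (M / b)))) = Q₁ * (ℓ / (√(n : ℝ) * b)) / 3 := by
        rw [show c * ((n * ℓ : ℝ) * (4 * (γ⁻¹ * (M / b)))) =
          (c * n) * (ℓ * (4 * (γ⁻¹ * (M / b)))) by ring, hcn]
        simp only [Q₁]
        field_simp
        ring
      rw [e3]
      have h1 : 0 ≤ (ℓ / (√(n : ℝ) * b)) := by positivity
      have h2 : 0 ≤ (Q₂ + Q₃) * (ℓ / (√(n : ℝ) * b)) := by positivity
      linarith
    have hn2 : c * (n * ∑ i ∈ Finset.Icc 1 n,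
        2 * A * (gap (Z i ω) (W i ω) + ∫ ω, gap (Z i ω) (W i ω) ∂P)) = T ω := by
      rw [← mul_assoc, hcn]
    calc _ ≤ |S v ω| + |c * _| + |c * ∑ p ∈ farPairs n ℓ, (d p - d' p)| :=
          (abs_add_le _ _).trans (add_le_add (abs_add_le _ _) le_rfl)
      _ ≤ |S v ω| + c * ((n * ℓ : ℝ) * (4 * (γ⁻¹ * (M / b)))) + c * (n * ∑ i ∈ Finset.Icc 1 n,
          2 * A * (gap (Z i ω) (W i ω) + ∫ ω, gap (Z i ω) (W i ω) ∂P)) := by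
          have h1 : ∀ {x y : ℝ}, |x| ≤ y → |c * x| ≤ c * y := fun hxy => by
            rw [abs_mul, abs_of_pos hc0]
            exact mul_le_mul_of_nonneg_left hxy hc0.le
          exact add_le_add (add_le_add le_rfl (h1 hdn)) (h1 hdf)
      _ ≤ _ := by rw [hn2]; linarith
  refine (measure_mono (t := {ω | ENNReal.ofReal (η / 3) < ⨆ v ∈ Set.Icc α β, ‖S v ω‖ₑ} ∪
    {ω | η / 3 ≤ T ω}) fun ω hω => ?_).trans ((measure_union_le _ _).trans
    ((add_le_add hSsup hTP).trans ?_))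
  · simp only [Set.mem_ofPred_eq, lt_iSup_iff] at hω
    obtain ⟨v, hv, hlt⟩ := hω
    rw [Real.enorm_eq_ofReal_abs, ENNReal.ofReal_lt_ofReal_iff_of_nonneg hη.le] at hlt
    by_cases hTω : η / 3 ≤ T ω
    · exact Or.inr hTω
    · left
      simp only [Set.mem_ofPred_eq, lt_iSup_iff]
      refine ⟨v, hv, ?_⟩
      rw [Real.enorm_eq_ofReal_abs, ENNReal.ofReal_lt_ofReal_iff_of_nonneg (by positivity)]
      have := hdec ω v hv
      push Not at hTω
      linarith
  · have hp1 : 0 ≤ (∫ ω, T ω ∂P) / (η / 3) :=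
      div_nonneg (integral_nonneg hTnn) (by positivity)
    rw [← ENNReal.ofReal_add (by positivity) hp1]
    refine ENNReal.ofReal_le_ofReal ?_
    have hX : 0 ≤ √(n : ℝ) * (b ^ 2)⁻¹ * a ^ ℓ / η := by positivity
    have hY : 0 ≤ (ℓ : ℝ) ^ 2 / (n * b ^ 2) / η ^ 2 := by positivity
    have t1 : (∫ ω, T ω ∂P) / (η / 3) ≤ Q₂ * (√(n : ℝ) * (b ^ 2)⁻¹ * a ^ ℓ / η) := by
      calc _ ≤ 4 * (C₁ * (M + L) * (b ^ 2)⁻¹) * C * √(n : ℝ) * a ^ ℓ / (η / 3) := by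
            have := hTE.trans (by gcongr :
              4 * A * C * √(n : ℝ) * a ^ ℓ ≤ 4 * (C₁ * (M + L) * (b ^ 2)⁻¹) * C * √(n : ℝ) * a ^ ℓ)
            gcongr
        _ = _ := by simp only [Q₂]; field_simp; ring
    have t2 : 4 / (η / 3) ^ 2 * (48 * ℓ ^ 2 * (n : ℝ)⁻¹ * (V₁ / b) +
        b * (48 * ℓ ^ 2 * (n : ℝ)⁻¹ * (V₂ / b ^ 3)) * (β - α) ^ 2 / 2 +
        2 * (48 * ℓ ^ 2 * (n : ℝ)⁻¹ * (V₁ / b)) / b) ≤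
        Q₃ * (ℓ ^ 2 / (n * b ^ 2) / η ^ 2) := by
      have t3 : V₁ / b ≤ V₁ / b ^ 2 := by
        gcongr
        nlinarith
      calc _ ≤ 4 / (η / 3) ^ 2 * (48 * ℓ ^ 2 * (n : ℝ)⁻¹ * (V₁ / b ^ 2) +
        b * (48 * ℓ ^ 2 * (n : ℝ)⁻¹ * (V₂ / b ^ 3)) * (β - α) ^ 2 / 2 +
        2 * (48 * ℓ ^ 2 * (n : ℝ)⁻¹ * (V₁ / b)) / b) := by gcongr
        _ = _ := by simp only [Q₃]; field_simp; ring
    have t4 : 0 ≤ Q₂ * (ℓ ^ 2 / (n * b ^ 2) / η ^ 2) := by positivity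
    have t5 : 0 ≤ Q₃ * (√(n : ℝ) * (b ^ 2)⁻¹ * a ^ ℓ / η) := by positivity
    have t6 : 0 ≤ Q₁ * (√(n : ℝ) * (b ^ 2)⁻¹ * a ^ ℓ / η) := by positivity
    have t7 : 0 ≤ Q₁ * (ℓ ^ 2 / (n * b ^ 2) / η ^ 2) := by positivity
    linarith

end Uniform

/-! ### Chaining with bracketing for bounded functions -/

section Chaining

variable {Ω : Type*} [MeasurableSpace Ω] {P : Measure Ω} [IsProbabilityMeasure P] {ν : Measure ℝ}
  {ε : ℤ → Ω → ℝ}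

/-- Union bound for the empirical process over finitely many functions. -/
lemma measure_exists_empProc_gt_le (h : IsIIDNoise P ν ε) {J : Type*} (s : Finset J) {φ : J → ℝ → ℝ}
    (hφ : ∀ j ∈ s, Measurable (φ j)) {c r : ℝ} (hc0 : 0 ≤ c) (hr0 : 0 < r)
    (hc : ∀ j ∈ s, ∀ x, |φ j x| ≤ c)
    (hr : ∀ j ∈ s, ∫ x, φ j x ^ 2 ∂ν ≤ r ^ 2) {n : ℕ} (hn : 0 < n) (u : ℝ) :
    P {ω | ∃ j ∈ s, u * (r + 2 * c / √(n : ℝ)) < |empProc ν ε n (φ j) ω|} ≤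
      ENNReal.ofReal (s.card * (2 * Real.exp (1 - u))) := by
  have hsn : 0 < √(n : ℝ) := Real.sqrt_pos.2 (by exact_mod_cast hn)
  set t := r + 2 * c / √(n : ℝ) with ht
  have hrt : r ≤ t := by have : 0 ≤ 2 * c / √(n : ℝ) := by positivity
                         linarith
  have ht0 : 0 < t := hr0.trans_le hrt
  -- The exponential parameter `t⁻¹` is small enough for the exponential inequality to apply, and
  -- small enough that the variance term `t⁻² r²` is at most `1`.
  have hl : t⁻¹ * (2 * c) ≤ √(n : ℝ) := by
    rw [inv_mul_le_iff₀ ht0, ← div_le_iff₀ hsn]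
    linarith
  have hset : {ω | ∃ j ∈ s, u * t < |empProc ν ε n (φ j) ω|} =
      ⋃ j ∈ s, {ω | u * t < |empProc ν ε n (φ j) ω|} := by
    ext ω; simp
  rw [hset]
  refine (measure_biUnion_finset_le _ _).trans ?_
  calc _ ≤ ∑ j ∈ s, ENNReal.ofReal (2 * Real.exp (1 - u)) := by
        refine Finset.sum_le_sum fun j hj => ?_
        refine (measure_abs_empProc_gt_le_exp h (hφ j hj) (hc j hj) (hr j hj) hn
          (inv_pos.2 ht0) hl _).trans (ENNReal.ofReal_le_ofReal ?_)
        have h1 : -t⁻¹ * (u * t) = -u := by field_simp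
        have h2 : t⁻¹ ^ 2 * r ^ 2 ≤ 1 := by
          rw [← mul_pow]
          refine pow_le_one₀ (by positivity) ?_
          rw [inv_mul_le_iff₀ ht0]; linarith
        rw [h1]
        gcongr
        linarith
    _ = _ := by
        rw [Finset.sum_const, nsmul_eq_mul, ENNReal.ofReal_mul (p := (s.card : ℝ)) (by positivity),
          ENNReal.ofReal_natCast]

/-- This is how finitely many brackets control an infinite class: the single variable `empProc w`
bounds the difference for all pairs dominated by `w`, at the price of the mean of `w` multiplied by
`2√n`. That price is affordable only at the finest level of the chain. -/
lemma abs_empProc_sub_le {φ ψ w : ℝ → ℝ} (hφ : Integrable φ ν) (hψ : Integrable ψ ν)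
    (hw : Integrable w ν) (hdom : ∀ x, |φ x - ψ x| ≤ w x) (n : ℕ) (ω : Ω) :
    |empProc ν ε n φ ω - empProc ν ε n ψ ω| ≤
      empProc ν ε n w ω + 2 * √(n : ℝ) * ∫ x, w x ∂ν := by
  rcases Nat.eq_zero_or_pos n with rfl | hn
  · simp [empProc]
  have hsn : 0 < √(n : ℝ) := Real.sqrt_pos.2 (by exact_mod_cast hn)
  rw [← empProc_sub hφ hψ]
  have hm : |∫ x, (φ x - ψ x) ∂ν| ≤ ∫ x, w x ∂ν :=
    abs_integral_le_integral_abs.trans (integral_mono (hφ.sub hψ).abs hw hdom)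
  simp only [empProc]
  rw [abs_mul, abs_of_pos (inv_pos.2 hsn)]
  have h1 : |∑ j ∈ Finset.Icc 1 n, (φ (ε j ω) - ψ (ε j ω) - ∫ x, (φ x - ψ x) ∂ν)| ≤
      ∑ j ∈ Finset.Icc 1 n, (w (ε j ω) - ∫ x, w x ∂ν) + 2 * n * ∫ x, w x ∂ν := by
    calc _ ≤ ∑ j ∈ Finset.Icc 1 n, ((w (ε j ω) - ∫ x, w x ∂ν) + 2 * ∫ x, w x ∂ν) := by
          refine (Finset.abs_sum_le_sum_abs _ _).trans (Finset.sum_le_sum fun j _ => ?_)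
          have := abs_sub (φ (ε j ω) - ψ (ε j ω)) (∫ x, (φ x - ψ x) ∂ν)
          linarith [hdom (ε j ω)]
      _ = _ := by rw [Finset.sum_add_distrib]; simp; ring
  have h2 := mul_le_mul_of_nonneg_left h1 (inv_pos.2 hsn).le
  refine h2.trans (le_of_eq ?_)
  rw [mul_add]
  have e : (√(n : ℝ))⁻¹ * n = √(n : ℝ) := by rw [inv_mul_eq_div, Real.div_sqrt]
  linear_combination (2 * ∫ x, w x ∂ν) * e

lemma sum_Ico_mul_two_inv_pow_le (k₀ k₁ : ℕ) :
    ∑ k ∈ Finset.Ico k₀ k₁, (k : ℝ) * (2⁻¹ : ℝ) ^ k ≤ 2 * (k₀ + 1) * (2⁻¹ : ℝ) ^ k₀ := by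
  rcases le_total k₁ k₀ with hle | hle
  · rw [Finset.Ico_eq_empty_of_le hle, Finset.sum_empty]; positivity
  have : ∑ k ∈ Finset.Ico k₀ k₁, (k : ℝ) * (2⁻¹ : ℝ) ^ k =
      2 * (k₀ + 1) * (2⁻¹ : ℝ) ^ k₀ - 2 * (k₁ + 1) * (2⁻¹ : ℝ) ^ k₁ := by
    induction k₁, hle using Nat.le_induction with
    | base => simp
    | succ k hk ih =>
      rw [Finset.sum_Ico_succ_top hk, ih, pow_succ]
      push_cast; ring
  rw [this]
  have : 0 ≤ 2 * ((k₁ : ℝ) + 1) * (2⁻¹ : ℝ) ^ k₁ := by positivity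
  linarith

lemma sum_Ico_two_inv_pow_le (k₀ k₁ : ℕ) :
    ∑ k ∈ Finset.Ico k₀ k₁, (2⁻¹ : ℝ) ^ k ≤ 2 * (2⁻¹ : ℝ) ^ k₀ := by
  rcases le_total k₁ k₀ with hle | hle
  · rw [Finset.Ico_eq_empty_of_le hle, Finset.sum_empty]; positivity
  have : ∑ k ∈ Finset.Ico k₀ k₁, (2⁻¹ : ℝ) ^ k =
      2 * (2⁻¹ : ℝ) ^ k₀ - 2 * (2⁻¹ : ℝ) ^ k₁ := by
    induction k₁, hle using Nat.le_induction with
    | base => simp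
    | succ k hk ih =>
      rw [Finset.sum_Ico_succ_top hk, ih, pow_succ]
      ring
  rw [this]
  have : 0 ≤ 2 * (2⁻¹ : ℝ) ^ k₁ := by positivity
  linarith

lemma integral_le_of_integral_sq_le [IsProbabilityMeasure ν] {w : ℝ → ℝ} (hw : MemLp w 2 ν) {r : ℝ}
    (hr : 0 ≤ r) (h : ∫ x, w x ^ 2 ∂ν ≤ r ^ 2) : ∫ x, w x ∂ν ≤ r :=
  le_of_sq_le_sq ((sq_integral_le hw).trans h) hr

/-- Chaining with bracketing for uniformly bounded functions at a fixed sample size. -/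
lemma measure_iSup_empProc_sub_gt_le (h : IsIIDNoise P ν ε) {ι : Type*} {f : ι → ℝ → ℝ}
    {w : ℕ → ι → ℝ → ℝ} {π : ℕ → ι → ι} {c A D : ℝ} (hc0 : 0 ≤ c) (hA : 1 ≤ A) (hD : 1 ≤ D)
    (hf : ∀ v, Measurable (f v)) (hfc : ∀ v x, |f v x| ≤ c)
    (hw : ∀ k v, Measurable (w k v)) (hwc : ∀ k v x, |w k v x| ≤ 2 * c)
    (hdom : ∀ k v x, |f v x - f (π k v) x| ≤ w k (π k v) x)
    (hw2 : ∀ k v, ∫ x, w k (π k v) x ^ 2 ∂ν ≤ ((2⁻¹ : ℝ) ^ k) ^ 2)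
    (hfin : ∀ k, (Set.range (π k)).Finite) (hcard : ∀ k, ((hfin k).toFinset.card : ℝ) ≤ A * D ^ k)
    {n : ℕ} (hn : 0 < n) {k₀ k₁ : ℕ} (hk : k₀ ≤ k₁) {x : ℝ}
    (hx : 4 * Real.log (2 * D ^ 2) * (k₀ + 1) * (2⁻¹ : ℝ) ^ k₀ +
      4 * Real.log (2 * D ^ 2) * (k₁ + 1) ^ 2 * (c / √(n : ℝ)) +
      2 * √(n : ℝ) * (2⁻¹ : ℝ) ^ k₁ ≤ x) :
    P {ω | ∃ v, x < |empProc ν ε n (f v) ω - empProc ν ε n (f (π k₀ v)) ω|} ≤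
      ENNReal.ofReal (4 * Real.exp 1 * A ^ 2 * D * (2⁻¹ : ℝ) ^ k₀) := by
  classical
  have hν := h.isProbabilityMeasure
  have hsn : 0 < √(n : ℝ) := Real.sqrt_pos.2 (by exact_mod_cast hn)
  set B := Real.log (2 * D ^ 2) with hBdef
  have hD2 : 1 ≤ D ^ 2 := one_le_pow₀ hD
  have hB0 : 0 ≤ B := Real.log_nonneg (by linarith)
  -- At level `k` deviations are measured in multiples `B k` with `B = log (2 D²)`. The exponential
  -- bound then cancels the `D^{2k}` links of that level and leaves the summable factor `2⁻ᵏ`.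
  have hexpB : ∀ k : ℕ, Real.exp (1 - B * k) = Real.exp 1 * ((2⁻¹ : ℝ) ^ k * (D ^ (2 * k))⁻¹) := by
    intro k
    rw [sub_eq_add_neg, Real.exp_add, Real.exp_neg, mul_comm B, Real.exp_nat_mul, hBdef,
      Real.exp_log (by positivity), mul_pow, mul_inv, inv_pow, pow_mul]
  set s : ℕ → ℝ := fun k => 2 * (2⁻¹ : ℝ) ^ k + 2 * (2 * c) / √(n : ℝ) with hs
  have hfi : ∀ v, Integrable (f v) ν := fun v => integrable_of_abs_le (hf v) (hfc v)
  have hwi : ∀ k v, Integrable (w k v) ν := fun k v => integrable_of_abs_le (hw k v) (hwc k v)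
  have hwL : ∀ k v, MemLp (w k v) 2 ν := fun k v => memLp_of_abs_le (hw k v) (hwc k v) 2
  have hw0 : ∀ k v x, 0 ≤ w k (π k v) x := fun k v x => (abs_nonneg _).trans (hdom k v x)
  -- links of the chain
  set pr : ℕ → Finset (ι × ι) := fun k =>
    ((hfin (k + 1)).toFinset ×ˢ (hfin k).toFinset).filter
      fun p => ∃ v, p = (π (k + 1) v, π k v) with hpr
  have hprcard : ∀ k, ((pr k).card : ℝ) ≤ A ^ 2 * D * D ^ (2 * k) := by
    intro k
    have h1 : ((pr k).card : ℝ) ≤ (hfin (k + 1)).toFinset.card * (hfin k).toFinset.card := by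
      exact_mod_cast (Finset.card_filter_le _ _).trans (Finset.card_product _ _).le
    calc _ ≤ (A * D ^ (k + 1)) * (A * D ^ k) := by
          refine h1.trans ?_
          have := hcard (k + 1)
          have := hcard k
          gcongr
      _ = _ := by ring
  have hbad1 : ∀ k, P {ω | ∃ p ∈ pr k, B * k * s k <
      |empProc ν ε n (fun x => f p.1 x - f p.2 x) ω|} ≤
      ENNReal.ofReal (2 * Real.exp 1 * A ^ 2 * D * (2⁻¹ : ℝ) ^ k) := by
    intro k
    refine (measure_exists_empProc_gt_le h (pr k) (φ := fun p x => f p.1 x - f p.2 x)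
      (fun p _ => (hf p.1).sub (hf p.2)) (c := 2 * c) (r := 2 * (2⁻¹ : ℝ) ^ k) (by positivity)
      (by positivity) (fun p _ x => ?_) (fun p hp => ?_) hn (B * k)).trans
      (ENNReal.ofReal_le_ofReal ?_)
    · have := abs_sub (f p.1 x) (f p.2 x)
      linarith [hfc p.1 x, hfc p.2 x]
    · obtain ⟨v, rfl⟩ := (Finset.mem_filter.1 hp).2
      have h1 := hw2 (k + 1) v
      have h2 := hw2 k v
      have hi1 := (hwL (k + 1) (π (k + 1) v)).integrable_sq
      have hi2 := (hwL k (π k v)).integrable_sq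
      calc _ ≤ ∫ x, (2 * w (k + 1) (π (k + 1) v) x ^ 2 + 2 * w k (π k v) x ^ 2) ∂ν := by
            refine integral_mono
              ((memLp_of_abs_le (hf _) (hfc _) 2).sub (memLp_of_abs_le (hf _) (hfc _) 2)).integrable_sq
              ((hi1.const_mul 2).add (hi2.const_mul 2)) fun x => ?_
            show (f (π (k + 1) v) x - f (π k v) x) ^ 2 ≤
              2 * w (k + 1) (π (k + 1) v) x ^ 2 + 2 * w k (π k v) x ^ 2
            have h3 := hdom (k + 1) v x
            have h4 := hdom k v x
            have h5 : |f (π (k + 1) v) x - f (π k v) x| ≤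
                w (k + 1) (π (k + 1) v) x + w k (π k v) x := by
              rw [abs_le] at *
              constructor <;> linarith
            rw [← sq_abs]
            calc _ ≤ (w (k + 1) (π (k + 1) v) x + w k (π k v) x) ^ 2 :=
                  pow_le_pow_left₀ (abs_nonneg _) h5 2
              _ ≤ _ := by
                  nlinarith [sq_nonneg (w (k + 1) (π (k + 1) v) x - w k (π k v) x)]
        _ = 2 * ∫ x, w (k + 1) (π (k + 1) v) x ^ 2 ∂ν + 2 * ∫ x, w k (π k v) x ^ 2 ∂ν := by
            rw [integral_add (hi1.const_mul 2) (hi2.const_mul 2), integral_const_mul,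
              integral_const_mul]
        _ ≤ _ := by
            have e1 : ((2⁻¹ : ℝ) ^ (k + 1)) ^ 2 = ((2⁻¹ : ℝ) ^ k) ^ 2 / 4 := by ring
            have e2 : (2 * (2⁻¹ : ℝ) ^ k) ^ 2 = 4 * ((2⁻¹ : ℝ) ^ k) ^ 2 := by ring
            have e3 : 0 ≤ ((2⁻¹ : ℝ) ^ k) ^ 2 := by positivity
            rw [e1] at h1
            rw [e2]
            linarith
    · rw [hexpB]
      calc _ ≤ (A ^ 2 * D * D ^ (2 * k)) *
            (2 * (Real.exp 1 * ((2⁻¹ : ℝ) ^ k * (D ^ (2 * k))⁻¹))) := by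
            have := hprcard k
            gcongr
        _ = _ := by field_simp
  -- At the finest level no further link is taken; the bracket widths have to be controlled instead.
  have hbad2 : P {ω | ∃ i ∈ (hfin k₁).toFinset, B * k₁ * s k₁ < |empProc ν ε n (w k₁ i) ω|} ≤
      ENNReal.ofReal (2 * Real.exp 1 * A ^ 2 * D * (2⁻¹ : ℝ) ^ k₁) := by
    refine (measure_exists_empProc_gt_le h (hfin k₁).toFinset (φ := fun i => w k₁ i)
      (fun i _ => hw k₁ i) (c := 2 * c) (r := 2 * (2⁻¹ : ℝ) ^ k₁) (by positivity)
      (by positivity) (fun i _ x => hwc k₁ i x) (fun i hi => ?_) hn (B * k₁)).trans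
      (ENNReal.ofReal_le_ofReal ?_)
    · obtain ⟨v, rfl⟩ := (hfin k₁).mem_toFinset.1 hi
      refine (hw2 k₁ v).trans ?_
      have : 0 ≤ (2⁻¹ : ℝ) ^ k₁ := by positivity
      gcongr
      linarith
    · rw [hexpB]
      have h1 : A * D ^ k₁ ≤ A ^ 2 * D * D ^ (2 * k₁) := by
        have e1 : A ≤ A ^ 2 := by nlinarith
        have e2 : D ^ k₁ ≤ D * D ^ (2 * k₁) := by
          rw [← pow_succ']; exact pow_le_pow_right₀ hD (by omega)
        rw [mul_assoc]
        gcongr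
      calc _ ≤ (A ^ 2 * D * D ^ (2 * k₁)) *
            (2 * (Real.exp 1 * ((2⁻¹ : ℝ) ^ k₁ * (D ^ (2 * k₁))⁻¹))) := by
            have := (hcard k₁).trans h1
            gcongr
        _ = _ := by field_simp
  have htel : ∀ v ω, ∀ k, k₀ ≤ k → empProc ν ε n (f (π k v)) ω - empProc ν ε n (f (π k₀ v)) ω =
      ∑ k ∈ Finset.Ico k₀ k, (empProc ν ε n (f (π (k + 1) v)) ω - empProc ν ε n (f (π k v)) ω) := by
    intro v ω k hk
    induction k, hk using Nat.le_induction with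
    | base => simp
    | succ k hk ih => rw [Finset.sum_Ico_succ_top hk, ← ih]; ring
  -- The index `k₁` is included although the links stop at `k₁ - 1`: its term belongs to the bracket
  -- widths.
  have hsum : ∑ k ∈ Finset.Ico k₀ (k₁ + 1), B * k * s k + 2 * √(n : ℝ) * (2⁻¹ : ℝ) ^ k₁ ≤ x := by
    refine le_trans ?_ hx
    have h1 : ∑ k ∈ Finset.Ico k₀ (k₁ + 1), B * k * s k =
        2 * B * ∑ k ∈ Finset.Ico k₀ (k₁ + 1), (k : ℝ) * (2⁻¹ : ℝ) ^ k +
        4 * B * (c / √(n : ℝ)) * ∑ k ∈ Finset.Ico k₀ (k₁ + 1), (k : ℝ) := by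
      rw [Finset.mul_sum, Finset.mul_sum, ← Finset.sum_add_distrib]
      refine Finset.sum_congr rfl fun k _ => ?_
      simp only [hs]; ring
    have h2 : ∑ k ∈ Finset.Ico k₀ (k₁ + 1), (k : ℝ) ≤ (k₁ + 1) ^ 2 := by
      calc _ ≤ ∑ k ∈ Finset.Ico k₀ (k₁ + 1), ((k₁ : ℝ) + 1) := by
            refine Finset.sum_le_sum fun k hk => ?_
            have := (Finset.mem_Ico.1 hk).2
            have : (k : ℝ) ≤ k₁ := by exact_mod_cast Nat.lt_succ_iff.1 this
            linarith
        _ ≤ _ := by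
            rw [Finset.sum_const, nsmul_eq_mul, Nat.card_Ico, sq]
            have : ((k₁ + 1 - k₀ : ℕ) : ℝ) ≤ k₁ + 1 := by exact_mod_cast Nat.sub_le _ _
            gcongr
    have h3 := sum_Ico_mul_two_inv_pow_le k₀ (k₁ + 1)
    rw [h1]
    have h4 := mul_le_mul_of_nonneg_left h3 (by positivity : 0 ≤ 2 * B)
    have h5 := mul_le_mul_of_nonneg_left h2 (by positivity : 0 ≤ 4 * B * (c / √(n : ℝ)))
    linarith
  refine (measure_mono (t := (⋃ k ∈ Finset.Ico k₀ k₁, {ω | ∃ p ∈ pr k, B * k * s k <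
      |empProc ν ε n (fun x => f p.1 x - f p.2 x) ω|}) ∪
      {ω | ∃ i ∈ (hfin k₁).toFinset, B * k₁ * s k₁ < |empProc ν ε n (w k₁ i) ω|})
      fun ω hω => ?_).trans ((measure_union_le _ _).trans ((add_le_add
        ((measure_biUnion_finset_le _ _).trans (Finset.sum_le_sum fun k _ => hbad1 k))
        hbad2).trans ?_))
  · obtain ⟨v, hv⟩ := hω
    by_contra hgood
    simp only [Set.mem_union, Set.mem_iUnion, Set.mem_ofPred_eq, not_or, not_exists, not_and,
      not_lt] at hgood
    obtain ⟨hg1, hg2⟩ := hgood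
    have h1 : |empProc ν ε n (f (π k₁ v)) ω - empProc ν ε n (f (π k₀ v)) ω| ≤
        ∑ k ∈ Finset.Ico k₀ k₁, B * k * s k := by
      rw [htel v ω k₁ hk]
      refine (Finset.abs_sum_le_sum_abs _ _).trans (Finset.sum_le_sum fun k hk => ?_)
      rw [← empProc_sub (hfi _) (hfi _)]
      refine hg1 k hk (π (k + 1) v, π k v) (Finset.mem_filter.2 ⟨?_, v, rfl⟩)
      simp
    have h2 := abs_empProc_sub_le (ε := ε) (hfi v) (hfi (π k₁ v)) (hwi k₁ (π k₁ v)) (hdom k₁ v) n ω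
    have h3 := (le_abs_self _).trans (hg2 (π k₁ v) (by simp))
    have h4 := integral_le_of_integral_sq_le (hwL k₁ (π k₁ v)) (by positivity) (hw2 k₁ v)
    have h5 := mul_le_mul_of_nonneg_left h4 (by positivity : 0 ≤ 2 * √(n : ℝ))
    rw [Finset.sum_Ico_succ_top hk] at hsum
    have h6 := abs_add_le (empProc ν ε n (f v) ω - empProc ν ε n (f (π k₁ v)) ω)
      (empProc ν ε n (f (π k₁ v)) ω - empProc ν ε n (f (π k₀ v)) ω)
    rw [sub_add_sub_cancel] at h6
    linarith
  · rw [← ENNReal.ofReal_sum_of_nonneg fun k _ => by positivity, ← ENNReal.ofReal_add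
      (Finset.sum_nonneg fun k _ => by positivity) (by positivity)]
    refine ENNReal.ofReal_le_ofReal ?_
    rw [← Finset.sum_Ico_succ_top (f := fun k => 2 * Real.exp 1 * A ^ 2 * D * (2⁻¹ : ℝ) ^ k) hk,
      ← Finset.mul_sum]
    have := mul_le_mul_of_nonneg_left (sum_Ico_two_inv_pow_le k₀ (k₁ + 1))
      (by positivity : 0 ≤ 2 * Real.exp 1 * A ^ 2 * D)
    linarith

end Chaining

/-! ### Truncation by an envelope and asymptotic equicontinuity -/

section Truncation

lemma setLIntegral_compl_le_of_moment {ν : Measure ℝ} {E : ℝ → ℝ≥0∞} (hE : Measurable E) {o c Q : ℝ}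
    (ho : 0 < o) (hc : 0 < c) (hQ : ∫⁻ x, E x ^ (2 + o) ∂ν ≤ ENNReal.ofReal Q) :
    ∫⁻ x in {x | E x ≤ ENNReal.ofReal c}ᶜ, E x ∂ν ≤ ENNReal.ofReal (Q / c ^ (1 + o)) := by
  have hT : MeasurableSet {x | E x ≤ ENNReal.ofReal c}ᶜ :=
    (measurableSet_le hE measurable_const).compl
  have hcp : 0 < c ^ (1 + o) := Real.rpow_pos_of_pos hc _
  calc _ ≤ ∫⁻ x in {x | E x ≤ ENNReal.ofReal c}ᶜ, E x ^ (2 + o) / ENNReal.ofReal (c ^ (1 + o)) ∂ν := by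
        refine setLIntegral_mono' hT fun x hx => ?_
        have hx' : ENNReal.ofReal c < E x := not_le.1 hx
        rw [ENNReal.le_div_iff_mul_le (Or.inl (by simpa using hcp)) (Or.inl ENNReal.ofReal_ne_top),
          show (2 + o) = 1 + (1 + o) by ring, ENNReal.rpow_add_of_nonneg _ _ (by norm_num)
            (by linarith), ENNReal.rpow_one, ← ENNReal.ofReal_rpow_of_pos hc]
        gcongr
    _ ≤ ∫⁻ x, E x ^ (2 + o) / ENNReal.ofReal (c ^ (1 + o)) ∂ν := setLIntegral_le_lintegral _ _
    _ ≤ ENNReal.ofReal Q / ENNReal.ofReal (c ^ (1 + o)) := by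
        simp_rw [div_eq_mul_inv]
        rw [lintegral_mul_const _ (hE.pow_const _)]
        gcongr
    _ = _ := (ENNReal.ofReal_div_of_pos hcp).symm

lemma measure_compl_le_of_moment {ν : Measure ℝ} {E : ℝ → ℝ≥0∞} (hE : Measurable E) {o c Q : ℝ}
    (ho : 0 < o) (hc : 0 < c) (hQ : ∫⁻ x, E x ^ (2 + o) ∂ν ≤ ENNReal.ofReal Q) :
    ν {x | E x ≤ ENNReal.ofReal c}ᶜ ≤ ENNReal.ofReal (Q / c ^ (2 + o)) := by
  have hcp : 0 < c ^ (2 + o) := Real.rpow_pos_of_pos hc _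
  refine (measure_mono (t := {x | ENNReal.ofReal (c ^ (2 + o)) ≤ E x ^ (2 + o)}) fun x hx => ?_).trans
    ((meas_ge_le_lintegral_div (hE.pow_const _).aemeasurable (by simpa using hcp)
      ENNReal.ofReal_ne_top).trans ?_)
  · have hx' : ENNReal.ofReal c < E x := not_le.1 hx
    show ENNReal.ofReal (c ^ (2 + o)) ≤ E x ^ (2 + o)
    rw [← ENNReal.ofReal_rpow_of_pos hc]
    exact ENNReal.rpow_le_rpow hx'.le (by linarith)
  · rw [ENNReal.ofReal_div_of_pos hcp]
    gcongr

variable {Ω : Type*} [MeasurableSpace Ω] {P : Measure Ω} [IsProbabilityMeasure P] {ν : Measure ℝ}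
  {ε : ℤ → Ω → ℝ}

/-- Chaining with bracketing at a fixed sample size, for functions with an envelope. -/
lemma measure_iSup_empProc_sub_gt_le_of_envelope (h : IsIIDNoise P ν ε) {ι : Type*} {f : ι → ℝ → ℝ}
    {w : ℕ → ι → ℝ → ℝ≥0∞} {E : ℝ → ℝ≥0∞} {π : ℕ → ι → ι} {c A D o Q : ℝ} (hc : 0 < c)
    (hA : 1 ≤ A) (hD : 1 ≤ D) (ho : 0 < o) (hQ0 : 0 ≤ Q)
    (hf : ∀ v, Measurable (f v)) (hw : ∀ k v, Measurable (w k v)) (hE : Measurable E)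
    (hfE : ∀ v x, ‖f v x‖ₑ ≤ E x)
    (hdom : ∀ k v x, E x ≠ ∞ → ‖f v x - f (π k v) x‖ₑ ≤ w k (π k v) x)
    (hw2 : ∀ k v, ∫⁻ x, w k (π k v) x ^ 2 ∂ν ≤ ENNReal.ofReal (((2⁻¹ : ℝ) ^ k) ^ 2))
    (hQ : ∫⁻ x, E x ^ (2 + o) ∂ν ≤ ENNReal.ofReal Q)
    (hfin : ∀ k, (Set.range (π k)).Finite) (hcard : ∀ k, ((hfin k).toFinset.card : ℝ) ≤ A * D ^ k)
    {n : ℕ} (hn : 0 < n) {k₀ k₁ : ℕ} (hk : k₀ ≤ k₁) {x : ℝ}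
    (hx : 4 * Real.log (2 * D ^ 2) * (k₀ + 1) * (2⁻¹ : ℝ) ^ k₀ +
      4 * Real.log (2 * D ^ 2) * (k₁ + 1) ^ 2 * (c / √(n : ℝ)) +
      2 * √(n : ℝ) * (2⁻¹ : ℝ) ^ k₁ + 2 * (√(n : ℝ) * (Q / c ^ (1 + o))) ≤ x) :
    P {ω | ∃ v, x < |empProc ν ε n (f v) ω - empProc ν ε n (f (π k₀ v)) ω|} ≤
      ENNReal.ofReal (4 * Real.exp 1 * A ^ 2 * D * (2⁻¹ : ℝ) ^ k₀) +
      ENNReal.ofReal (n * (Q / c ^ (2 + o))) := by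
  classical
  have hν := h.isProbabilityMeasure
  have hsn : 0 < √(n : ℝ) := Real.sqrt_pos.2 (by exact_mod_cast hn)
  -- With high probability no `ε_j` leaves `T`. On that event the truncated and the original
  -- functions take the same values at the sample, so their empirical processes differ only through
  -- the means, that is by at most `√n` times the tail of the envelope.
  set T : Set ℝ := {x | E x ≤ ENNReal.ofReal c} with hTdef
  have hT : MeasurableSet T := measurableSet_le hE measurable_const
  set f' : ι → ℝ → ℝ := fun v => T.indicator (f v) with hf'
  -- Two truncated functions differ by at most `2 c`, so capping the majorant there loses nothing
  -- and makes it bounded and real valued.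
  set w' : ℕ → ι → ℝ → ℝ := fun k v =>
    T.indicator fun x => (min (w k v x) (ENNReal.ofReal (2 * c))).toReal with hw'
  have hfc : ∀ v x, x ∈ T → |f v x| ≤ c := fun v x hx => by
    have h1 : ‖f v x‖ₑ ≤ ENNReal.ofReal c := (hfE v x).trans hx
    rw [Real.enorm_eq_ofReal_abs] at h1
    exact (ENNReal.ofReal_le_ofReal_iff hc.le).1 h1
  have hf'c : ∀ v x, |f' v x| ≤ c := fun v x => by
    by_cases hx : x ∈ T
    · simp only [hf', Set.indicator_of_mem hx]; exact hfc v x hx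
    · simp only [hf', Set.indicator_of_notMem hx, abs_zero]; exact hc.le
  have hf'm : ∀ v, Measurable (f' v) := fun v => (hf v).indicator hT
  have hmin : ∀ k v x, min (w k v x) (ENNReal.ofReal (2 * c)) ≠ ∞ := fun k v x =>
    ne_top_of_le_ne_top ENNReal.ofReal_ne_top (min_le_right _ _)
  have hw'0 : ∀ k v x, 0 ≤ w' k v x := fun k v x =>
    Set.indicator_nonneg (fun _ _ => ENNReal.toReal_nonneg) x
  have hw'c : ∀ k v x, |w' k v x| ≤ 2 * c := fun k v x => by
    rw [abs_of_nonneg (hw'0 k v x)]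
    by_cases hx : x ∈ T
    · simp only [hw', Set.indicator_of_mem hx]
      exact ENNReal.toReal_le_of_le_ofReal (by positivity) (min_le_right _ _)
    · simp only [hw', Set.indicator_of_notMem hx]
      positivity
  have hw'm : ∀ k v, Measurable (w' k v) := fun k v =>
    ((hw k v).min measurable_const).ennreal_toReal.indicator hT
  have hdom' : ∀ k v x, |f' v x - f' (π k v) x| ≤ w' k (π k v) x := fun k v x => by
    by_cases hx : x ∈ T
    · simp only [hf', hw', Set.indicator_of_mem hx]
      have h1 := hdom k v x (ne_top_of_le_ne_top ENNReal.ofReal_ne_top hx)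
      rw [Real.enorm_eq_ofReal_abs] at h1
      rw [← ENNReal.ofReal_le_iff_le_toReal (hmin _ _ _)]
      refine le_min h1 (ENNReal.ofReal_le_ofReal ?_)
      have := abs_sub (f v x) (f (π k v) x)
      linarith [hfc v x hx, hfc (π k v) x hx]
    · simp [hf', hw', Set.indicator_of_notMem hx]
  have hw'2 : ∀ k v, ∫ x, w' k (π k v) x ^ 2 ∂ν ≤ ((2⁻¹ : ℝ) ^ k) ^ 2 := fun k v => by
    rw [integral_eq_lintegral_of_nonneg_ae (ae_of_all _ fun x => sq_nonneg _)
      ((hw'm k _).pow_const 2).aestronglyMeasurable]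
    refine ENNReal.toReal_le_of_le_ofReal (by positivity) (le_trans ?_ (hw2 k v))
    refine lintegral_mono fun x => ?_
    rw [ENNReal.ofReal_pow (hw'0 _ _ _)]
    gcongr
    by_cases hx : x ∈ T
    · simp only [hw', Set.indicator_of_mem hx]
      rw [ENNReal.ofReal_toReal (hmin _ _ _)]
      exact min_le_left _ _
    · simp [hw', Set.indicator_of_notMem hx]
  set y := x - 2 * (√(n : ℝ) * (Q / c ^ (1 + o))) with hy
  have key := measure_iSup_empProc_sub_gt_le h hc.le hA hD hf'm hf'c hw'm hw'c hdom' hw'2 hfin hcard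
    hn hk (x := y) (by linarith)
  have htail : ∀ v, Integrable (Tᶜ.indicator (f v)) ν ∧
      |∫ x, Tᶜ.indicator (f v) x ∂ν| ≤ Q / c ^ (1 + o) := by
    intro v
    have hb : ∫⁻ x, ‖Tᶜ.indicator (f v) x‖ₑ ∂ν ≤ ENNReal.ofReal (Q / c ^ (1 + o)) := by
      refine le_trans ?_ (setLIntegral_compl_le_of_moment hE ho hc hQ)
      rw [← lintegral_indicator hT.compl]
      refine lintegral_mono fun x => ?_
      by_cases hx : x ∈ Tᶜ
      · simp only [Set.indicator_of_mem hx]; exact hfE v x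
      · simp only [Set.indicator_of_notMem hx, enorm_zero]; exact zero_le
    refine ⟨⟨((hf v).indicator hT.compl).aestronglyMeasurable,
      lt_of_le_of_lt hb ENNReal.ofReal_lt_top⟩, ?_⟩
    have h1 := (enorm_integral_le_lintegral_enorm (μ := ν) (Tᶜ.indicator (f v))).trans hb
    rw [Real.enorm_eq_ofReal_abs] at h1
    exact (ENNReal.ofReal_le_ofReal_iff (by positivity)).1 h1
  have hf'i : ∀ v, Integrable (f' v) ν := fun v => integrable_of_abs_le (hf'm v) (hf'c v)
  have hsplit : ∀ v, ∫ x, f v x ∂ν = ∫ x, f' v x ∂ν + ∫ x, Tᶜ.indicator (f v) x ∂ν := fun v => by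
    rw [← integral_add (hf'i v) (htail v).1]
    refine integral_congr_ae (ae_of_all _ fun x => ?_)
    exact (congrFun (Set.indicator_self_add_compl T (f v)) x).symm
  have hgood : ∀ ω, (∀ j ∈ Finset.Icc 1 n, ε (j : ℕ) ω ∈ T) → ∀ v,
      |empProc ν ε n (f v) ω - empProc ν ε n (f' v) ω| ≤ √(n : ℝ) * (Q / c ^ (1 + o)) := by
    intro ω hω v
    have e : empProc ν ε n (f v) ω - empProc ν ε n (f' v) ω =
        -(√(n : ℝ) * ∫ x, Tᶜ.indicator (f v) x ∂ν) := by
      simp only [empProc]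
      rw [← mul_sub, ← Finset.sum_sub_distrib]
      have : ∀ j ∈ Finset.Icc 1 n, (f v (ε (j : ℕ) ω) - ∫ x, f v x ∂ν) -
          (f' v (ε (j : ℕ) ω) - ∫ x, f' v x ∂ν) = -∫ x, Tᶜ.indicator (f v) x ∂ν := fun j hj => by
        rw [hsplit]
        simp only [hf', Set.indicator_of_mem (hω j hj)]
        ring
      rw [Finset.sum_congr rfl this, Finset.sum_const, Nat.card_Icc, Nat.add_sub_cancel,
        nsmul_eq_mul, mul_neg, mul_neg, ← mul_assoc, inv_mul_eq_div, Real.div_sqrt]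
    rw [e, abs_neg, abs_mul, abs_of_pos hsn]
    have := (htail v).2
    gcongr
  have hbad : P {ω | ∃ j ∈ Finset.Icc 1 n, ε (j : ℕ) ω ∈ Tᶜ} ≤
      ENNReal.ofReal (n * (Q / c ^ (2 + o))) := by
    have hset : {ω | ∃ j ∈ Finset.Icc 1 n, ε (j : ℕ) ω ∈ Tᶜ} =
        ⋃ j ∈ Finset.Icc 1 n, {ω | ε (j : ℕ) ω ∈ Tᶜ} := by ext ω; simp
    rw [hset]
    refine (measure_biUnion_finset_le _ _).trans ?_
    calc _ = ∑ j ∈ Finset.Icc 1 n, ν Tᶜ := by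
          refine Finset.sum_congr rfl fun j _ => ?_
          rw [← h.map_eq j, Measure.map_apply (h.measurable j) hT.compl]
          rfl
      _ = n * ν Tᶜ := by simp
      _ ≤ n * ENNReal.ofReal (Q / c ^ (2 + o)) := by
          gcongr; exact measure_compl_le_of_moment hE ho hc hQ
      _ = _ := by rw [ENNReal.ofReal_mul (Nat.cast_nonneg n), ENNReal.ofReal_natCast]
  refine (measure_mono fun ω hω => ?_).trans ((measure_union_le _ _).trans (add_le_add key hbad))
  obtain ⟨v, hv⟩ := hω
  by_cases hb : ∃ j ∈ Finset.Icc 1 n, ε (j : ℕ) ω ∈ Tᶜ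
  · exact Or.inr hb
  · left
    refine ⟨v, ?_⟩
    have hω' : ∀ j ∈ Finset.Icc 1 n, ε (j : ℕ) ω ∈ T := fun j hj => by
      by_contra hcon; exact hb ⟨j, hj, hcon⟩
    have h1 := hgood ω hω' v
    have h2 := hgood ω hω' (π k₀ v)
    rw [hy]
    by_contra hcon
    rw [not_lt] at hcon
    have h3 : |empProc ν ε n (f v) ω - empProc ν ε n (f (π k₀ v)) ω| ≤
        |empProc ν ε n (f v) ω - empProc ν ε n (f' v) ω| +
        |empProc ν ε n (f' v) ω - empProc ν ε n (f' (π k₀ v)) ω| +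
        |empProc ν ε n (f (π k₀ v)) ω - empProc ν ε n (f' (π k₀ v)) ω| := by
      have e : empProc ν ε n (f v) ω - empProc ν ε n (f (π k₀ v)) ω =
        (empProc ν ε n (f v) ω - empProc ν ε n (f' v) ω) +
        (empProc ν ε n (f' v) ω - empProc ν ε n (f' (π k₀ v)) ω) -
        (empProc ν ε n (f (π k₀ v)) ω - empProc ν ε n (f' (π k₀ v)) ω) := by ring
      rw [e]
      exact (abs_sub _ _).trans (add_le_add (abs_add_le _ _) le_rfl)
    have hv' : x < |empProc ν ε n (f v) ω - empProc ν ε n (f (π k₀ v)) ω| := hv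
    linarith

lemma tendsto_natCast_rpow_neg {s : ℝ} (hs : s < 0) :
    Tendsto (fun n : ℕ => (n : ℝ) ^ s) atTop (𝓝 0) := by
  have := (tendsto_rpow_neg_atTop (neg_pos.2 hs)).comp (tendsto_natCast_atTop_atTop (R := ℝ))
  simpa [Function.comp_def] using this

lemma tendsto_clog_sq_mul_rpow {s : ℝ} (hs : s < 0) (k : ℕ) :
    Tendsto (fun n : ℕ => ((k + Nat.clog 2 n : ℕ) + 1 : ℝ) ^ 2 * (n : ℝ) ^ s) atTop (𝓝 0) := by
  set t := -s / 4 with ht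
  have ht0 : 0 < t := by linarith
  have hl2 : 0 < Real.log 2 := Real.log_pos (by norm_num)
  set K : ℝ := k + 2 + 1 / (t * Real.log 2) with hK
  have hK0 : 0 ≤ K := by positivity
  have hlim : Tendsto (fun n : ℕ => K ^ 2 * (n : ℝ) ^ (s / 2)) atTop (𝓝 0) := by
    simpa using (tendsto_natCast_rpow_neg (by linarith : s / 2 < 0)).const_mul (K ^ 2)
  refine squeeze_zero' (Eventually.of_forall fun n => by positivity) ?_ hlim
  filter_upwards [eventually_ge_atTop 2] with n hn
  have hn0 : (0 : ℝ) < n := by exact_mod_cast (by omega : 0 < n)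
  have hn1 : (1 : ℝ) ≤ n := by exact_mod_cast (by omega : 1 ≤ n)
  have h1 : (1 : ℝ) ≤ (n : ℝ) ^ t := Real.one_le_rpow hn1 ht0.le
  have hclog : (Nat.clog 2 n : ℝ) ≤ Real.log n / Real.log 2 + 1 := by
    have h2 : 2 ^ (Nat.clog 2 n - 1) < n := by
      exact Nat.pow_pred_clog_lt_self (by norm_num) (by omega)
    have h3 : ((Nat.clog 2 n - 1 : ℕ) : ℝ) * Real.log 2 ≤ Real.log n := by
      rw [← Real.log_pow]
      refine Real.log_le_log (by positivity) ?_
      exact_mod_cast h2.le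
    have h4 : (Nat.clog 2 n : ℝ) ≤ ((Nat.clog 2 n - 1 : ℕ) : ℝ) + 1 := by
      exact_mod_cast (by omega : Nat.clog 2 n ≤ Nat.clog 2 n - 1 + 1)
    rw [← le_div_iff₀ hl2] at h3
    linarith
  have hlog := Real.log_le_rpow_div hn0.le ht0
  have h5 : ((k + Nat.clog 2 n : ℕ) + 1 : ℝ) ≤ K * (n : ℝ) ^ t := by
    push_cast
    calc _ ≤ (k + 2 : ℝ) + (n : ℝ) ^ t / t / Real.log 2 := by
          have : Real.log n / Real.log 2 ≤ (n : ℝ) ^ t / t / Real.log 2 := by gcongr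
          linarith
      _ ≤ (k + 2 : ℝ) * (n : ℝ) ^ t + (n : ℝ) ^ t / t / Real.log 2 := by
          have : (k + 2 : ℝ) * 1 ≤ (k + 2 : ℝ) * (n : ℝ) ^ t := by gcongr
          linarith
      _ = _ := by rw [hK]; field_simp
  calc _ ≤ (K * (n : ℝ) ^ t) ^ 2 * (n : ℝ) ^ s := by gcongr
    _ = K ^ 2 * (((n : ℝ) ^ t) ^ 2 * (n : ℝ) ^ s) := by ring
    _ = _ := by
        rw [← Real.rpow_natCast ((n : ℝ) ^ t), ← Real.rpow_mul hn0.le, ← Real.rpow_add hn0]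
        congr 2
        rw [ht]; push_cast; ring

/-- Asymptotic equicontinuity of the empirical process over classes (which may depend on the sample
size) with polynomial bracketing and an envelope with a moment of order larger than two. -/
lemma exists_empProc_equicontinuity (h : IsIIDNoise P ν ε) {ι : Type*} {f : ℕ → ι → ℝ → ℝ}
    {w : ℕ → ℕ → ι → ℝ → ℝ≥0∞} {E : ℕ → ℝ → ℝ≥0∞} {π : ℕ → ι → ι} {A D o Q : ℝ}
    (hA : 1 ≤ A) (hD : 1 ≤ D) (ho : 0 < o) (hQ0 : 0 ≤ Q)
    (hf : ∀ n v, Measurable (f n v)) (hw : ∀ n k v, Measurable (w n k v))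
    (hE : ∀ n, Measurable (E n)) (hfE : ∀ n v x, ‖f n v x‖ₑ ≤ E n x)
    (hdom : ∀ n k v x, E n x ≠ ∞ → ‖f n v x - f n (π k v) x‖ₑ ≤ w n k (π k v) x)
    (hw2 : ∀ᶠ n in atTop, ∀ k v,
      ∫⁻ x, w n k (π k v) x ^ 2 ∂ν ≤ ENNReal.ofReal (((2⁻¹ : ℝ) ^ k) ^ 2))
    (hQ : ∀ᶠ n in atTop, ∫⁻ x, E n x ^ (2 + o) ∂ν ≤ ENNReal.ofReal Q)
    (hfin : ∀ k, (Set.range (π k)).Finite) (hcard : ∀ k, ((hfin k).toFinset.card : ℝ) ≤ A * D ^ k)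
    {η : ℝ} (hη : 0 < η) :
    ∃ k₀, ∀ᶠ n in atTop,
      P {ω | ∃ v, η < |empProc ν ε n (f n v) ω - empProc ν ε n (f n (π k₀ v)) ω|} ≤
        ENNReal.ofReal η := by
  set B := Real.log (2 * D ^ 2)
  have hlim1 : Tendsto (fun k : ℕ => 4 * B * (k + 1) * (2⁻¹ : ℝ) ^ k) atTop (𝓝 0) := by
    have h1 := tendsto_self_mul_const_pow_of_lt_one (r := (2⁻¹ : ℝ)) (by norm_num) (by norm_num)
    have h2 := tendsto_pow_atTop_nhds_zero_of_lt_one (r := (2⁻¹ : ℝ)) (by norm_num) (by norm_num)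
    have h3 := (h1.add h2).const_mul (4 * B)
    simp only [add_zero, mul_zero] at h3
    refine h3.congr fun k => ?_
    ring
  have hlim2 : Tendsto (fun k : ℕ => 4 * Real.exp 1 * A ^ 2 * D * (2⁻¹ : ℝ) ^ k) atTop (𝓝 0) := by
    simpa using (tendsto_pow_atTop_nhds_zero_of_lt_one (r := (2⁻¹ : ℝ)) (by norm_num)
      (by norm_num)).const_mul (4 * Real.exp 1 * A ^ 2 * D)
  obtain ⟨k₀, hk1, hk2⟩ := ((hlim1.eventually_lt_const (by positivity : 0 < η / 2)).and
    (hlim2.eventually_lt_const (by positivity : 0 < η / 2))).exists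
  refine ⟨k₀, ?_⟩
  -- Truncation at `n^θ`. With `θ < 1/2` the term `c / √n` vanishes even after multiplication by the
  -- squared number of levels. With `θ (2 + o) > 1` the probability of leaving the truncation set
  -- vanishes. Together these give `θ (1 + o) > 1/2`, so the bias in the means vanishes too.
  set θ := (1 / (2 + o) + 1 / 2) / 2 with hθ
  have ho2 : 0 < 2 + o := by linarith
  have hθ1 : 1 / (2 + o) < θ := by
    have : 1 / (2 + o) < 1 / 2 := one_div_lt_one_div_of_lt (by norm_num) (by linarith)
    linarith
  have hθ2 : θ < 1 / 2 := by
    have : 1 / (2 + o) < 1 / 2 := one_div_lt_one_div_of_lt (by norm_num) (by linarith)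
    linarith
  have hθo : 1 < θ * (2 + o) := by rwa [div_lt_iff₀ ho2] at hθ1
  have hθo' : 1 / 2 < θ * (1 + o) := by nlinarith
  have l1 : Tendsto (fun n : ℕ => 4 * B * (((k₀ + Nat.clog 2 n : ℕ) + 1 : ℝ) ^ 2 *
      (n : ℝ) ^ (θ - 1 / 2))) atTop (𝓝 0) := by
    simpa using (tendsto_clog_sq_mul_rpow (by linarith : θ - 1 / 2 < 0) k₀).const_mul (4 * B)
  have l2 : Tendsto (fun n : ℕ => 2 * (n : ℝ) ^ (-(1 / 2) : ℝ)) atTop (𝓝 0) := by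
    simpa using (tendsto_natCast_rpow_neg (by norm_num : (-(1 / 2) : ℝ) < 0)).const_mul 2
  have l3 : Tendsto (fun n : ℕ => 2 * Q * (n : ℝ) ^ (1 / 2 - θ * (1 + o))) atTop (𝓝 0) := by
    simpa using (tendsto_natCast_rpow_neg (by linarith : 1 / 2 - θ * (1 + o) < 0)).const_mul (2 * Q)
  have l4 : Tendsto (fun n : ℕ => Q * (n : ℝ) ^ (1 - θ * (2 + o))) atTop (𝓝 0) := by
    simpa using (tendsto_natCast_rpow_neg (by linarith : 1 - θ * (2 + o) < 0)).const_mul Q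
  have l123 := (l1.add l2).add l3
  simp only [add_zero] at l123
  filter_upwards [hw2, hQ, eventually_gt_atTop 0, l123.eventually_lt_const
    (by positivity : 0 < η / 2), l4.eventually_lt_const (by positivity : 0 < η / 2)]
    with n hw2n hQn hn hn1 hn2
  have hn0 : (0 : ℝ) < n := by exact_mod_cast hn
  have hsn : 0 < √(n : ℝ) := Real.sqrt_pos.2 hn0
  have hc : 0 < (n : ℝ) ^ θ := Real.rpow_pos_of_pos hn0 _
  have hsq : √(n : ℝ) = (n : ℝ) ^ (1 / 2 : ℝ) := Real.sqrt_eq_rpow _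
  -- About `log₂ n` further levels give `2^{-k₁} ≤ 1/n`, so that the bias `√n 2^{-k₁}` of the finest
  -- brackets is at most `n^{-1/2}`.
  have key := measure_iSup_empProc_sub_gt_le_of_envelope h hc hA hD ho hQ0 (hf n) (hw n) (hE n)
    (hfE n) (hdom n) hw2n hQn hfin hcard hn (k₀ := k₀) (k₁ := k₀ + Nat.clog 2 n)
    (Nat.le_add_right _ _) (x := η) ?_
  · refine key.trans ?_
    rw [← ENNReal.ofReal_add (by positivity) (by positivity)]
    refine ENNReal.ofReal_le_ofReal ?_
    have e : (n : ℝ) * (Q / ((n : ℝ) ^ θ) ^ (2 + o)) = Q * (n : ℝ) ^ (1 - θ * (2 + o)) := by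
      rw [← Real.rpow_mul hn0.le, Real.rpow_sub hn0, Real.rpow_one]; ring
    rw [e]
    linarith
  · have e1 : (n : ℝ) ^ θ / √(n : ℝ) = (n : ℝ) ^ (θ - 1 / 2) := by
      rw [hsq, ← Real.rpow_sub hn0]
    have e2 : √(n : ℝ) * (Q / ((n : ℝ) ^ θ) ^ (1 + o)) = Q * (n : ℝ) ^ (1 / 2 - θ * (1 + o)) := by
      rw [← Real.rpow_mul hn0.le, hsq, Real.rpow_sub hn0]; ring
    have e3 : √(n : ℝ) * (2⁻¹ : ℝ) ^ (k₀ + Nat.clog 2 n) ≤ (n : ℝ) ^ (-(1 / 2) : ℝ) := by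
      have h1 : (n : ℝ) ≤ 2 ^ (k₀ + Nat.clog 2 n) := by
        have h2 : n ≤ 2 ^ Nat.clog 2 n := Nat.le_pow_clog (by norm_num) n
        have h3 : 2 ^ Nat.clog 2 n ≤ 2 ^ (k₀ + Nat.clog 2 n) :=
          Nat.pow_le_pow_right (by norm_num) (Nat.le_add_left _ _)
        exact_mod_cast h2.trans h3
      have h4 : (2⁻¹ : ℝ) ^ (k₀ + Nat.clog 2 n) ≤ (n : ℝ)⁻¹ := by
        rw [inv_pow]; exact inv_anti₀ hn0 h1
      calc _ ≤ √(n : ℝ) * (n : ℝ)⁻¹ := by gcongr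
        _ = _ := by
          rw [hsq, ← Real.rpow_neg_one, ← Real.rpow_add hn0]; norm_num
    rw [e1, e2]
    push_cast at hn1 ⊢
    linarith

end Truncation

/-- Jensen's inequality, read off from the monotonicity of `L^p` norms on a probability space. -/
lemma lintegral_rpow_le_lintegral_rpow {E : Type*} [MeasurableSpace E] {ρ : Measure E}
    [IsProbabilityMeasure ρ] {u : E → ℝ≥0∞} (hu : Measurable u) {p : ℝ} (hp : 1 ≤ p) :
    (∫⁻ s, u s ∂ρ) ^ p ≤ ∫⁻ s, u s ^ p ∂ρ := by
  have h0 : 0 < p := by linarith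
  have := eLpNorm_le_eLpNorm_of_exponent_le (μ := ρ) (p := 1) (q := ENNReal.ofReal p)
    (by simpa using hp) hu.aestronglyMeasurable
  rw [eLpNorm_one_eq_lintegral_enorm, eLpNorm_eq_lintegral_rpow_enorm_toReal (by simpa using h0)
    (by simp), ENNReal.toReal_ofReal h0.le] at this
  simp only [enorm_eq_self] at this
  rw [one_div] at this
  exact (ENNReal.le_rpow_inv_iff h0).1 this

lemma ennreal_add_sq_le (a b : ℝ≥0∞) : (a + b) ^ 2 ≤ 2 * (a ^ 2 + b ^ 2) := by
  have := ENNReal.rpow_add_le_mul_rpow_add_rpow a b (p := 2) (by norm_num)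
  norm_num at this
  exact_mod_cast this

/-! ### Densities, kernel averages and smoothing -/

section Density

variable {fε : ℝ → ℝ} {ν : Measure ℝ}

/-- A shift by at most `s₀` maps the law with density `fε` below `supMeasure fε s₀`. -/
lemma lintegral_comp_add_le_supMeasure (hf : IsDensity fε ν) {s₀ t : ℝ} (ht : |t| ≤ s₀)
    {u : ℝ → ℝ≥0∞} (hu : Measurable u) :
    ∫⁻ y, u (y + t) ∂ν ≤ ∫⁻ x, u x ∂(supMeasure fε s₀) := by
  have hm : Measurable fun x => ENNReal.ofReal (fε x) := hf.measurable.ennreal_ofReal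
  have hm' : Measurable fun x => ENNReal.ofReal (fε (x - t)) := hm.comp (measurable_id.sub_const t)
  have e : ∫⁻ y, u (y + t) ∂ν =
      ∫⁻ x, u x ∂(volume.withDensity fun x => ENNReal.ofReal (fε (x - t))) := by
    have hut : Measurable fun y => u (y + t) := hu.comp (measurable_id.add_const t)
    rw [hf.eq_withDensity, lintegral_withDensity_eq_lintegral_mul _ hm hut,
      lintegral_withDensity_eq_lintegral_mul _ hm' hu,
      ← lintegral_add_right_eq_self (fun x => (((fun x => ENNReal.ofReal (fε (x - t))) * u) x)) t]
    simp
  rw [e]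
  refine lintegral_mono' (withDensity_mono (ae_of_all _ fun x => ?_)) le_rfl
  refine le_iSup₂_of_le (-t) ?_ (by rw [sub_eq_add_neg])
  rw [abs_le] at ht
  exact ⟨by linarith [ht.2], by linarith [ht.1]⟩

lemma le_supMeasure (hf : IsDensity fε ν) {s₀ : ℝ} (hs : 0 ≤ s₀) : ν ≤ supMeasure fε s₀ := by
  rw [hf.eq_withDensity]
  refine withDensity_mono (ae_of_all _ fun x => ?_)
  exact le_iSup₂_of_le 0 ⟨by linarith, hs⟩ (by simp)

lemma supMeasure_le {C : ℝ} (hC : ∀ x, fε x ≤ C) (s₀ : ℝ) :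
    supMeasure fε s₀ ≤ ENNReal.ofReal C • volume := by
  rw [← withDensity_const]
  exact withDensity_mono (ae_of_all _ fun x => iSup₂_le fun s _ =>
    ENNReal.ofReal_le_ofReal (hC _))

lemma measure_le_of_density_le (hf : IsDensity fε ν) {C : ℝ} (hC : ∀ x, fε x ≤ C) (S : Set ℝ) :
    ν S ≤ ENNReal.ofReal C * volume S := by
  have h : ν ≤ ENNReal.ofReal C • volume := by
    rw [← withDensity_const, hf.eq_withDensity]
    exact withDensity_mono (ae_of_all _ fun x => ENNReal.ofReal_le_ofReal (hC _))
  exact h S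

lemma integral_eq_integral_density_mul (hf : IsDensity fε ν) (φ : ℝ → ℝ) :
    ∫ y, φ y ∂ν = ∫ y, fε y * φ y := by
  rw [hf.eq_withDensity, integral_withDensity_eq_integral_toReal_smul
    hf.measurable.ennreal_ofReal (ae_of_all _ fun x => ENNReal.ofReal_lt_top)]
  refine integral_congr_ae (ae_of_all _ fun x => ?_)
  simp [ENNReal.toReal_ofReal (hf.nonneg x)]

end Density

/-- The probability measure with density `K`. -/
noncomputable def kernelMeasure (K : ℝ → ℝ) : Measure ℝ :=
  volume.withDensity fun x => ENNReal.ofReal (K x)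

section Kernel

variable {K : ℝ → ℝ} (hK : IsKernel K)
include hK

lemma isDensity_kernelMeasure : IsDensity K (kernelMeasure K) :=
  ⟨hK.continuous.measurable, hK.nonneg, rfl⟩

lemma isProbabilityMeasure_kernelMeasure : IsProbabilityMeasure (kernelMeasure K) := by
  refine ⟨?_⟩
  rw [kernelMeasure, withDensity_apply _ MeasurableSet.univ, Measure.restrict_univ,
    ← ofReal_integral_eq_lintegral_ofReal hK.integrable (ae_of_all _ hK.nonneg), hK.integral_eq_one,
    ENNReal.ofReal_one]

lemma ae_kernelMeasure_abs_le : ∀ᵐ s ∂(kernelMeasure K), |s| ≤ 1 := by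
  rw [kernelMeasure, ae_withDensity_iff hK.continuous.measurable.ennreal_ofReal]
  refine ae_of_all _ fun x hx => ?_
  by_contra h
  exact hx (by rw [hK.eq_zero_of_one_lt_abs (not_le.1 h), ENNReal.ofReal_zero])

lemma integral_kernelMeasure_id : ∫ s, s ∂(kernelMeasure K) = 0 := by
  rw [integral_eq_integral_density_mul (isDensity_kernelMeasure hK), ← hK.integral_mul_eq_zero]
  exact integral_congr_ae (ae_of_all _ fun x => mul_comm _ _)

lemma integral_kernel_mul_comp {b : ℝ} (hb : 0 < b) (y : ℝ) (g : ℝ → ℝ) :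
    ∫ x, bump K b y x * g x = ∫ s, g (y + b * s) ∂(kernelMeasure K) := by
  rw [integral_eq_integral_density_mul (isDensity_kernelMeasure hK)]
  have h1 := Measure.integral_comp_mul_left (fun u => b⁻¹ * K (u / b) * g (y + u)) b
  have h2 := integral_add_left_eq_self (μ := volume) (fun x => bump K b y x * g x) y
  rw [← h2]
  have h3 : ∀ x, bump K b y (y + x) * g (y + x) = b⁻¹ * K (x / b) * g (y + x) := fun x => by
    simp [bump]
  simp_rw [h3]
  have h4 : ∫ u, b⁻¹ * K (u / b) * g (y + u) =
      b * ∫ x, b⁻¹ * K (b * x / b) * g (y + b * x) := by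
    rw [h1, abs_of_pos (inv_pos.2 hb), smul_eq_mul, ← mul_assoc, mul_inv_cancel₀ hb.ne', one_mul]
  rw [h4, ← integral_const_mul]
  refine integral_congr_ae (ae_of_all _ fun x => ?_)
  simp only
  rw [mul_div_cancel_left₀ _ hb.ne']
  field_simp

lemma integral_kernel_mul_comp_sub {b : ℝ} (hb : 0 < b) (x : ℝ) (f : ℝ → ℝ) :
    ∫ y, bump K b y x * f y = ∫ s, f (x - b * s) ∂(kernelMeasure K) := by
  have h1 := integral_kernel_mul_comp hK hb (-x) (fun u => f (-u))
  have h2 := integral_neg_eq_self (fun y => bump K b y x * f y) volume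
  rw [← h2]
  have h3 : ∀ y, bump K b (-y) x = bump K b (-x) y := fun y => by
    simp only [bump]; congr 3; ring
  simp_rw [h3, h1]
  refine integral_congr_ae (ae_of_all _ fun s => ?_)
  simp only
  congr 1; ring

end Kernel

/-- The average of `g` over `y + b s`, `s` distributed according to `ρ`. -/
noncomputable def smoothing (ρ : Measure ℝ) (b : ℝ) (g : ℝ → ℝ) (y : ℝ) : ℝ :=
  ∫ s, g (y + b * s) ∂ρ

/-- The version of `smoothing` for functions with values in `[0, ∞]`. -/
noncomputable def lsmoothing (ρ : Measure ℝ) (b : ℝ) (u : ℝ → ℝ≥0∞) (y : ℝ) : ℝ≥0∞ :=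
  ∫⁻ s, u (y + b * s) ∂ρ

section Smoothing

variable {ρ : Measure ℝ} [IsProbabilityMeasure ρ] {b : ℝ}

lemma measurable_smoothing {g : ℝ → ℝ} (hg : Measurable g) : Measurable (smoothing ρ b g) := by
  have : Measurable (Function.uncurry fun y s : ℝ => g (y + b * s)) :=
    hg.comp (by fun_prop : Measurable fun p : ℝ × ℝ => p.1 + b * p.2)
  exact (this.stronglyMeasurable.integral_prod_right (ν := ρ)).measurable

lemma measurable_lsmoothing {u : ℝ → ℝ≥0∞} (hu : Measurable u) : Measurable (lsmoothing ρ b u) := by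
  have : Measurable (Function.uncurry fun y s : ℝ => u (y + b * s)) :=
    hu.comp (by fun_prop : Measurable fun p : ℝ × ℝ => p.1 + b * p.2)
  exact this.lintegral_prod_right

lemma enorm_smoothing_le (g : ℝ → ℝ) (y : ℝ) :
    ‖smoothing ρ b g y‖ₑ ≤ lsmoothing ρ b (fun x => ‖g x‖ₑ) y :=
  enorm_integral_le_lintegral_enorm _

/-- Integrability of `f` and `g` is not needed. If the right side is finite the difference is
integrable, so the two averages either both exist or both take the default value `0`. -/
lemma enorm_smoothing_sub_le {f g : ℝ → ℝ} (hf : Measurable f) (hg : Measurable g) (y : ℝ) :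
    ‖smoothing ρ b f y - smoothing ρ b g y‖ₑ ≤ lsmoothing ρ b (fun x => ‖f x - g x‖ₑ) y := by
  have hsh : Measurable fun s : ℝ => y + b * s := by fun_prop
  by_cases htop : lsmoothing ρ b (fun x => ‖f x - g x‖ₑ) y = ∞
  · rw [htop]; exact le_top
  have hi : Integrable (fun s => f (y + b * s) - g (y + b * s)) ρ :=
    ⟨((hf.comp hsh).sub (hg.comp hsh)).aestronglyMeasurable, lt_top_iff_ne_top.2 htop⟩
  by_cases hg' : Integrable (fun s => g (y + b * s)) ρ
  · have hf' : Integrable (fun s => f (y + b * s)) ρ := by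
      refine (hi.add hg').congr (ae_of_all _ fun s => ?_)
      simp
    simp only [smoothing]
    rw [← integral_sub hf' hg']
    exact enorm_integral_le_lintegral_enorm _
  · have hf' : ¬ Integrable (fun s => f (y + b * s)) ρ := fun hcon => hg' <| by
      refine (hcon.sub hi).congr (ae_of_all _ fun s => ?_)
      simp
    simp [smoothing, integral_undef hf', integral_undef hg']

variable {fε : ℝ → ℝ} {ν : Measure ℝ} [IsProbabilityMeasure ν]

/-- Smoothing is a contraction from `L^p (supMeasure fε s₀)` to `L^p ν`. -/
lemma lintegral_lsmoothing_rpow_le (hf : IsDensity fε ν) (hρ : ∀ᵐ s ∂ρ, |s| ≤ 1) {s₀ : ℝ}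
    (hb0 : 0 ≤ b) (hb : b ≤ s₀) {u : ℝ → ℝ≥0∞} (hu : Measurable u) {p : ℝ} (hp : 1 ≤ p) :
    ∫⁻ y, lsmoothing ρ b u y ^ p ∂ν ≤ ∫⁻ x, u x ^ p ∂(supMeasure fε s₀) := by
  have hm : Measurable (Function.uncurry fun y s : ℝ => u (y + b * s) ^ p) :=
    (hu.comp (by fun_prop : Measurable fun p : ℝ × ℝ => p.1 + b * p.2)).pow_const p
  -- Jensen in `s`, then Fubini; for fixed `s` the shift `b s` has size at most `s₀` and is absorbed
  -- by the supremum in `supMeasure`.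
  calc _ ≤ ∫⁻ y, ∫⁻ s, u (y + b * s) ^ p ∂ρ ∂ν :=
        lintegral_mono fun y => lintegral_rpow_le_lintegral_rpow
          (hu.comp (by fun_prop : Measurable fun s : ℝ => y + b * s)) hp
    _ = ∫⁻ s, ∫⁻ y, u (y + b * s) ^ p ∂ν ∂ρ := lintegral_lintegral_swap hm.aemeasurable
    _ ≤ ∫⁻ s, ∫⁻ x, u x ^ p ∂(supMeasure fε s₀) ∂ρ := by
        refine lintegral_mono_ae (hρ.mono fun s hs => ?_)
        refine lintegral_comp_add_le_supMeasure hf ?_ (hu.pow_const p)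
        rw [abs_mul, abs_of_nonneg hb0]
        calc b * |s| ≤ b * 1 := by gcongr
          _ ≤ s₀ := by linarith
    _ = _ := by simp

lemma lintegral_lsmoothing_sq_le (hf : IsDensity fε ν) (hρ : ∀ᵐ s ∂ρ, |s| ≤ 1) {s₀ : ℝ}
    (hb0 : 0 ≤ b) (hb : b ≤ s₀) {u : ℝ → ℝ≥0∞} (hu : Measurable u) :
    ∫⁻ y, lsmoothing ρ b u y ^ 2 ∂ν ≤ ∫⁻ x, u x ^ 2 ∂(supMeasure fε s₀) := by
  simpa using lintegral_lsmoothing_rpow_le hf hρ hb0 hb hu (p := 2) (by norm_num)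

/-- Smoothing with vanishing bandwidth converges in `L²`. -/
lemma tendsto_lintegral_smoothing_sub_sq (hf : IsDensity fε ν) {C : ℝ} (hC : ∀ x, fε x ≤ C)
    (hρ : ∀ᵐ s ∂ρ, |s| ≤ 1) {s₀ : ℝ} (hs : 0 < s₀) {b : ℕ → ℝ} (hb0 : ∀ n, 0 < b n)
    (hb : Tendsto b atTop (𝓝 0)) {g : ℝ → ℝ} (hg : Measurable g)
    (hg2 : MemLp g 2 (supMeasure fε s₀)) :
    Tendsto (fun n => ∫⁻ y, ‖smoothing ρ (b n) g y - g y‖ₑ ^ 2 ∂ν) atTop (𝓝 0) := by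
  -- Local finiteness, a consequence of the boundedness of `fε`, makes continuous compactly
  -- supported functions dense in `L²`.
  have hloc : IsLocallyFiniteMeasure (supMeasure fε s₀) := by
    refine ⟨fun x => ?_⟩
    obtain ⟨s, hs, hfin⟩ := (volume : Measure ℝ).finiteAt_nhds x
    refine ⟨s, hs, lt_of_le_of_lt (supMeasure_le hC s₀ s) ?_⟩
    simpa using ENNReal.mul_lt_top ENNReal.ofReal_lt_top hfin
  rw [ENNReal.tendsto_nhds_zero]
  intro e he
  -- The constant `10` is `2 + 4 + 4`, from splitting the square of a sum of three errors.
  obtain ⟨d, hd0, hde⟩ : ∃ d : ℝ, 0 < d ∧ ENNReal.ofReal (10 * d ^ 2) ≤ e := by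
    rcases eq_or_ne e ∞ with rfl | htop
    · exact ⟨1, one_pos, le_top⟩
    · have he' : 0 < e.toReal := ENNReal.toReal_pos he.ne' htop
      refine ⟨√(e.toReal / 10), Real.sqrt_pos.2 (by positivity), ?_⟩
      rw [Real.sq_sqrt (by positivity), mul_div_cancel₀ _ (by norm_num), ENNReal.ofReal_toReal htop]
  -- Approximation by a continuous compactly supported `φ`: the contraction property handles the
  -- smoothing of `g - φ`, uniform continuity handles the smoothing of `φ`.
  obtain ⟨φ, hφc, hφ, hφcont, -⟩ := hg2.exists_hasCompactSupport_eLpNorm_sub_le (by simp)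
    (ε := ENNReal.ofReal d) (by simpa using hd0)
  have huc : UniformContinuous φ := hφc.uniformContinuous_of_continuous hφcont
  obtain ⟨r, hr0, hr⟩ := Metric.uniformContinuous_iff.1 huc d hd0
  have hgφ : Measurable fun x => ‖g x - φ x‖ₑ := (hg.sub hφcont.measurable).enorm
  have hgφ2 : ∫⁻ x, ‖g x - φ x‖ₑ ^ 2 ∂(supMeasure fε s₀) ≤ ENNReal.ofReal (d ^ 2) := by
    have h1 := eLpNorm_nnreal_pow_eq_lintegral (μ := supMeasure fε s₀) (f := g - φ) (p := 2)
      (by norm_num)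
    have h2 : ∫⁻ x, ‖g x - φ x‖ₑ ^ 2 ∂(supMeasure fε s₀) = eLpNorm (g - φ) 2 (supMeasure fε s₀) ^ 2 := by
      simpa using h1.symm
    rw [h2, ENNReal.ofReal_pow hd0.le]
    gcongr
  filter_upwards [hb.eventually_lt_const hs, hb.eventually_lt_const hr0] with n hn1 hn2
  have hpt : ∀ y, ‖smoothing ρ (b n) g y - g y‖ₑ ≤
      lsmoothing ρ (b n) (fun x => ‖g x - φ x‖ₑ) y + (‖g y - φ y‖ₑ + ENNReal.ofReal d) := by
    intro y
    have h1 := enorm_smoothing_sub_le (ρ := ρ) (b := b n) hg hφcont.measurable y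
    have h2 : ‖smoothing ρ (b n) φ y - φ y‖ₑ ≤ ENNReal.ofReal d := by
      rw [Real.enorm_eq_ofReal_abs]
      refine ENNReal.ofReal_le_ofReal ?_
      have hsh : Continuous fun s : ℝ => φ (y + b n * s) := by fun_prop
      obtain ⟨B, hB⟩ := hφc.exists_bound_of_continuous hφcont
      have hi : Integrable (fun s => φ (y + b n * s)) ρ :=
        integrable_of_abs_le hsh.measurable fun s => hB _
      have e1 : smoothing ρ (b n) φ y - φ y = ∫ s, (φ (y + b n * s) - φ y) ∂ρ := by
        rw [integral_sub hi (integrable_const _)]; simp [smoothing]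
      rw [e1]
      have := norm_integral_le_of_norm_le_const (μ := ρ) (C := d)
        (f := fun s => φ (y + b n * s) - φ y) (hρ.mono fun s hs => by
          have : dist (y + b n * s) y < r := by
            rw [Real.dist_eq, add_sub_cancel_left, abs_mul, abs_of_pos (hb0 n)]
            calc b n * |s| ≤ b n * 1 := by have := (hb0 n).le; gcongr
              _ < r := by linarith
          rw [← dist_eq_norm]
          exact (hr this).le)
      simpa using this
    have h3 : ‖φ y - g y‖ₑ = ‖g y - φ y‖ₑ := by rw [← enorm_neg, neg_sub]
    have e : smoothing ρ (b n) g y - g y = (smoothing ρ (b n) g y - smoothing ρ (b n) φ y) +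
        ((φ y - g y) + (smoothing ρ (b n) φ y - φ y)) := by ring
    rw [e]
    refine (enorm_add_le _ _).trans (add_le_add h1 ((enorm_add_le _ _).trans ?_))
    rw [h3]
    gcongr
  calc ∫⁻ y, ‖smoothing ρ (b n) g y - g y‖ₑ ^ 2 ∂ν
      ≤ ∫⁻ y, (2 * lsmoothing ρ (b n) (fun x => ‖g x - φ x‖ₑ) y ^ 2 +
          (4 * ‖g y - φ y‖ₑ ^ 2 + 4 * ENNReal.ofReal d ^ 2)) ∂ν := by
        refine lintegral_mono fun y => ?_
        calc _ ≤ (lsmoothing ρ (b n) (fun x => ‖g x - φ x‖ₑ) y +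
              (‖g y - φ y‖ₑ + ENNReal.ofReal d)) ^ 2 := by gcongr; exact hpt y
          _ ≤ 2 * (lsmoothing ρ (b n) (fun x => ‖g x - φ x‖ₑ) y ^ 2 +
              2 * (‖g y - φ y‖ₑ ^ 2 + ENNReal.ofReal d ^ 2)) := by
              refine (ennreal_add_sq_le _ _).trans ?_
              gcongr
              exact ennreal_add_sq_le _ _
          _ = _ := by ring
    _ = 2 * ∫⁻ y, lsmoothing ρ (b n) (fun x => ‖g x - φ x‖ₑ) y ^ 2 ∂ν +
          (4 * ∫⁻ y, ‖g y - φ y‖ₑ ^ 2 ∂ν + 4 * ENNReal.ofReal d ^ 2) := by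
        rw [lintegral_add_left (((measurable_lsmoothing hgφ).pow_const 2).const_mul 2),
          lintegral_const_mul _ ((measurable_lsmoothing hgφ).pow_const 2),
          lintegral_add_left ((hgφ.pow_const 2).const_mul 4),
          lintegral_const_mul _ (hgφ.pow_const 2)]
        simp
    _ ≤ 2 * ENNReal.ofReal (d ^ 2) + (4 * ENNReal.ofReal (d ^ 2) + 4 * ENNReal.ofReal d ^ 2) := by
        have h1 := (lintegral_lsmoothing_sq_le hf hρ (hb0 n).le hn1.le hgφ).trans hgφ2
        have h2 : ∫⁻ y, ‖g y - φ y‖ₑ ^ 2 ∂ν ≤ ENNReal.ofReal (d ^ 2) :=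
          (lintegral_mono' (le_supMeasure hf hs.le) le_rfl).trans hgφ2
        gcongr
    _ = ENNReal.ofReal (10 * d ^ 2) := by
        rw [← ENNReal.ofReal_pow hd0.le, ENNReal.ofReal_mul (by norm_num)]
        norm_num
        ring
    _ ≤ e := hde

end Smoothing

/-! ### From short memory of the model to noise-driven states -/

/-- Only moments of order `s < 1` are available, and `m` and `Q` need not be independent. Since `min
1 x ≤ x^p` for `0 < p ≤ 1`, the product is taken to the power `s/2`, and Young's inequality with
weight `T` separates its factors into moments of order `s`. A large `T` makes the part with `m`
small. -/
lemma enorm_add_one_mul_le_rpow {s T Δ Q m : ℝ} (hs : 0 < s) (hs1 : s < 1) (hT : 0 < T)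
    (hΔ : 0 ≤ Δ) (hQ : 0 ≤ Q) (hm : 0 ≤ m) :
    min 1 (Δ + (1 + m) * Q) ≤ Δ ^ s + T * Q ^ s + T⁻¹ * (1 + m ^ s) := by
  have hmin : ∀ x : ℝ, ∀ p : ℝ, 0 ≤ x → 0 < p → p ≤ 1 → min 1 x ≤ x ^ p := by
    intro x p hx hp hp1
    rcases le_total x 1 with h | h
    · rw [min_eq_right h]
      rcases hx.eq_or_lt with h0 | h0
      · rw [← h0]; positivity
      · simpa using Real.rpow_le_rpow_of_exponent_ge h0 h hp1
    · rw [min_eq_left h]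
      exact Real.one_le_rpow h hp.le
  have hadd : min 1 (Δ + (1 + m) * Q) ≤ min 1 Δ + min 1 ((1 + m) * Q) := by
    have : 0 ≤ (1 + m) * Q := by positivity
    rcases le_total 1 Δ with h | h <;> rcases le_total 1 ((1 + m) * Q) with h' | h' <;>
      simp only [h, h', min_eq_left, min_eq_right]
    · linarith [min_le_left 1 (Δ + (1 + m) * Q)]
    · linarith [min_le_left 1 (Δ + (1 + m) * Q)]
    · linarith [min_le_left 1 (Δ + (1 + m) * Q)]
    · exact min_le_right _ _
  have h1 := hmin Δ s hΔ hs hs1.le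
  have h2 := hmin ((1 + m) * Q) (s / 2) (by positivity) (by positivity) (by linarith)
  rw [Real.mul_rpow (by positivity) hQ] at h2
  have hx : ((1 + m) ^ (s / 2)) ^ 2 ≤ 1 + m ^ s := by
    rw [← Real.rpow_natCast, ← Real.rpow_mul (by positivity)]
    have := Real.rpow_add_le_add_rpow (p := s) zero_le_one hm hs.le hs1.le
    simpa using this
  have hy : (Q ^ (s / 2)) ^ 2 = Q ^ s := by
    rw [← Real.rpow_natCast, ← Real.rpow_mul hQ]; norm_num
  set x := (1 + m) ^ (s / 2)
  set y := Q ^ (s / 2)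
  have hxy : x * y ≤ T⁻¹ * x ^ 2 + T * y ^ 2 := by
    have h3 : 0 ≤ T⁻¹ * (x - T * y) ^ 2 := by positivity
    have h4 : T⁻¹ * (x - T * y) ^ 2 = T⁻¹ * x ^ 2 + T * y ^ 2 - 2 * (x * y) := by
      field_simp; ring
    have h5 : 0 ≤ x * y := by positivity
    linarith
  have h6 : T⁻¹ * x ^ 2 ≤ T⁻¹ * (1 + m ^ s) := by gcongr
  rw [hy] at hxy
  linarith

lemma ofReal_gap_le {s T : ℝ} (hs : 0 < s) (hs1 : s < 1) (hT : 0 < T) (z z' : ℝ × ℝ) :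
    ENNReal.ofReal (gap z z') ≤ ‖z.1 - z'.1‖ₑ ^ s + ENNReal.ofReal T * ‖z.2 - z'.2‖ₑ ^ s +
      ENNReal.ofReal T⁻¹ * (1 + ‖z.1‖ₑ ^ s) := by
  have h := enorm_add_one_mul_le_rpow hs hs1 hT (abs_nonneg (z.1 - z'.1))
    (abs_nonneg (z.2 - z'.2)) (abs_nonneg z.1)
  refine (ENNReal.ofReal_le_ofReal h).trans (le_of_eq ?_)
  rw [ENNReal.ofReal_add (by positivity) (by positivity), ENNReal.ofReal_add (by positivity)
    (by positivity), ENNReal.ofReal_mul hT.le, ENNReal.ofReal_mul (by positivity),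
    ENNReal.ofReal_add zero_le_one (by positivity), ENNReal.ofReal_one]
  simp only [Real.enorm_eq_ofReal_abs, ENNReal.ofReal_rpow_of_nonneg (abs_nonneg _) hs.le]

namespace LocationScaleModel

variable {Ω : Type*} [MeasurableSpace Ω] {P : Measure Ω} {d : ℕ} (M : LocationScaleModel P d)

/-- The conditional mean and the squared volatility at the true parameter, as functions of the
noise. -/
noncomputable def state (t : ℤ) (ω : Ω) : ℝ × ℝ :=
  (M.meanOfNoise M.θ₀ (M.noisePast t ω), M.volOfNoise M.θ₀ (M.noisePast t ω) ^ 2)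

lemma isIIDNoise : IsIIDNoise P (P.map (M.ε 0)) M.ε :=
  ⟨M.measurable_ε, M.indep_ε, fun t => (M.identDistrib_ε t).map_eq⟩

/-- The coordinate `y 0` is never used. This makes the state at time `t` a function of the noise
strictly before `t`, hence independent of `ε t`. -/
lemma measurable_lag {E : Type*} {mE : MeasurableSpace E} {y : E → ℕ → ℝ}
    (hy : ∀ j, 1 ≤ j → Measurable fun e => y e j) :
    Measurable fun e => (fun k : ℕ => M.F (fun j => y e (k + 1 + j))) :=
  measurable_pi_lambda _ fun k => M.measurable_F.comp
    (measurable_pi_lambda _ fun j => hy _ (by omega))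

lemma measurable_meanOfNoise {E : Type*} {mE : MeasurableSpace E} {y : E → ℕ → ℝ}
    (hy : ∀ j, 1 ≤ j → Measurable fun e => y e j) (θ : M.Θ) :
    Measurable fun e => M.meanOfNoise θ (y e) :=
  M.measurable_H.comp (measurable_const.prodMk (M.measurable_lag hy))

lemma measurable_volOfNoise {E : Type*} {mE : MeasurableSpace E} {y : E → ℕ → ℝ}
    (hy : ∀ j, 1 ≤ j → Measurable fun e => y e j) (θ : M.Θ) :
    Measurable fun e => M.volOfNoise θ (y e) :=
  M.measurable_G.comp (measurable_const.prodMk (M.measurable_lag hy))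

lemma ae_lag_eq : ∀ᵐ ω ∂P, ∀ t : ℤ, (fun k : ℕ => M.X (t - 1 - k) ω) =
    fun k : ℕ => M.F (fun j => M.noisePast t ω (k + 1 + j)) := by
  filter_upwards [ae_all_iff.2 M.causal] with ω hω t
  funext k
  rw [hω]
  congr 1
  funext j
  simp only [noisePast]
  congr 1
  push_cast
  ring

lemma ae_mean_eq : ∀ᵐ ω ∂P, ∀ t θ, M.mean t θ ω = M.meanOfNoise θ (M.noisePast t ω) := by
  filter_upwards [M.ae_lag_eq] with ω hω t θ
  simp only [mean, meanOfNoise, hω t]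

lemma ae_vol_eq : ∀ᵐ ω ∂P, ∀ t θ, M.vol t θ ω = M.volOfNoise θ (M.noisePast t ω) := by
  filter_upwards [M.ae_lag_eq] with ω hω t θ
  simp only [vol, volOfNoise, hω t]

lemma measurable_mean (t : ℤ) (θ : M.Θ) : Measurable (M.mean t θ) :=
  M.measurable_H.comp (measurable_const.prodMk (measurable_pi_lambda _ fun _ => M.measurable_X _))

lemma measurable_vol (t : ℤ) (θ : M.Θ) : Measurable (M.vol t θ) :=
  M.measurable_G.comp (measurable_const.prodMk (measurable_pi_lambda _ fun _ => M.measurable_X _))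

lemma measurable_noisePast (t : ℤ) : Measurable (M.noisePast t) :=
  measurable_pi_lambda _ fun _ => M.measurable_ε _

lemma measurable_state_noiseField (t : ℤ) :
    Measurable[noiseField M.ε (Set.Iio t)] (M.state t) := by
  have hy : ∀ j, 1 ≤ j → Measurable[noiseField M.ε (Set.Iio t)] fun ω => M.noisePast t ω j :=
    fun j hj => measurable_noiseField M.ε (by simp only [Set.mem_Iio]; omega)
  exact Measurable.prodMk (m := noiseField M.ε (Set.Iio t)) (M.measurable_meanOfNoise hy M.θ₀)
    ((M.measurable_volOfNoise hy M.θ₀).pow_const 2)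

lemma map_noisePast [IsProbabilityMeasure P] (t : ℤ) :
    P.map (M.noisePast t) = Measure.infinitePi fun _ : ℕ => P.map (M.ε 0) := by
  have h := M.indep_ε.precomp (g := fun j : ℕ => t - (j : ℤ)) (fun i j hij => by
    simpa using hij)
  have h2 := (iIndepFun_iff_map_fun_eq_infinitePi_map
    (fun j : ℕ => M.measurable_ε (t - j))).1 h
  simp only [(M.identDistrib_ε _).map_eq] at h2
  exact h2

/-- Stationarity: the state is a fixed function of the noise past, and every noise past has the same
product law. -/
lemma map_state [IsProbabilityMeasure P] (t : ℤ) : P.map (M.state t) = P.map (M.state 0) := by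
  have hm : Measurable fun y : ℕ → ℝ => (M.meanOfNoise M.θ₀ y, M.volOfNoise M.θ₀ y ^ 2) :=
    (M.measurable_meanOfNoise (fun j _ => measurable_pi_apply j) M.θ₀).prodMk
      ((M.measurable_volOfNoise (fun j _ => measurable_pi_apply j) M.θ₀).pow_const 2)
  have h : ∀ t, P.map (M.state t) = (Measure.infinitePi fun _ : ℕ => P.map (M.ε 0)).map
      (fun y : ℕ → ℝ => (M.meanOfNoise M.θ₀ y, M.volOfNoise M.θ₀ y ^ 2)) := fun t => by
    rw [← M.map_noisePast t, Measure.map_map hm (M.measurable_noisePast t)]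
    rfl
  rw [h, h]

lemma measurable_splice_noiseField (i : ℤ) (ℓ : ℕ) (y : ℕ → ℝ) (j : ℕ) (hj : 1 ≤ j) :
    Measurable[noiseField M.ε (Set.Ioo (i - ℓ) i)] fun ω => splice ℓ (M.noisePast i ω) y j := by
  by_cases h : j < ℓ
  · simp only [splice, h, if_true, noisePast]
    exact measurable_noiseField M.ε ⟨by omega, by omega⟩
  · simp only [splice, h, if_false]
    exact measurable_const

lemma measurable_splice_prod (i : ℤ) (ℓ : ℕ) (j : ℕ) :
    Measurable fun p : Ω × Ω => splice ℓ (M.noisePast i p.1) (M.noisePast i p.2) j := by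
  by_cases h : j < ℓ
  · simp only [splice, h, if_true, noisePast]
    exact (M.measurable_ε _).comp measurable_fst
  · simp only [splice, h, if_false, noisePast]
    exact (M.measurable_ε _).comp measurable_snd

/-- Under short memory the state at the true parameter is driven by the noise. -/
lemma exists_isNoiseDriven [IsProbabilityMeasure P] (h : M.ShortMemory) :
    ∃ C a : ℝ, IsNoiseDriven P (P.map (M.ε 0)) M.ε M.state C a := by
  obtain ⟨-, s, a, κ, r, hs, hs1, ha, ha1, hκ, hr, hmom, hcoup, -⟩ := h
  have hθ : M.θ₀ ∈ M.nbhd r := by simpa [nbhd] using hr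
  have hstate : ∀ t, Measurable (M.state t) := fun t =>
    (M.measurable_state_noiseField t).mono (M.isIIDNoise.noiseField_le _) le_rfl
  have hD : ∫⁻ ω, ‖(M.state 0 ω).1‖ₑ ^ s ∂P < ∞ := by
    refine lt_of_le_of_lt (lintegral_mono_ae ?_) (hmom 0)
    filter_upwards [M.ae_mean_eq] with ω hω
    refine le_add_right (le_iSup₂_of_le M.θ₀ hθ ?_)
    rw [hω]; rfl
  set D := ∫⁻ ω, ‖(M.state 0 ω).1‖ₑ ^ s ∂P with hDdef
  have hDt : ∀ t, ∫⁻ ω, ‖(M.state t ω).1‖ₑ ^ s ∂P = D := fun t => by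
    have hm : Measurable fun z : ℝ × ℝ => ‖z.1‖ₑ ^ s := measurable_fst.enorm.pow_const s
    rw [hDdef, ← lintegral_map (f := fun z : ℝ × ℝ => ‖z.1‖ₑ ^ s) hm (hstate t), M.map_state t,
      lintegral_map hm (hstate 0)]
  have hρ0 : 0 < √a := Real.sqrt_pos.2 ha
  have hρ1 : √a < 1 := by rw [Real.sqrt_lt' one_pos]; simpa using ha1
  refine ⟨2 * κ + 1 + D.toReal, √a, M.isIIDNoise, M.measurable_state_noiseField, M.map_state,
    by positivity, hρ0, hρ1, fun i ℓ hℓ => ?_⟩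
  have hZ' : Measurable fun p : Ω × Ω => (M.meanCoupled i ℓ M.θ₀ p, M.volCoupled i ℓ M.θ₀ p ^ 2) :=
    (M.measurable_meanOfNoise (fun j _ => M.measurable_splice_prod i ℓ j) M.θ₀).prodMk
      ((M.measurable_volOfNoise (fun j _ => M.measurable_splice_prod i ℓ j) M.θ₀).pow_const 2)
  set Φ : Ω × Ω → ℝ≥0∞ := fun p => ‖(M.state i p.1).1 - M.meanCoupled i ℓ M.θ₀ p‖ₑ ^ s +
    ‖(M.state i p.1).2 - M.volCoupled i ℓ M.θ₀ p ^ 2‖ₑ ^ s with hΦ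
  have hst : Measurable fun p : Ω × Ω => M.state i p.1 := (hstate i).comp measurable_fst
  have hΦm : Measurable Φ :=
    ((hst.fst.sub hZ'.fst).enorm.pow_const s).add ((hst.snd.sub hZ'.snd).enorm.pow_const s)
  have hΦle : ∫⁻ p, Φ p ∂(P.prod P) ≤ ENNReal.ofReal (κ * a ^ ℓ) := by
    refine (lintegral_mono_ae ?_).trans (hcoup i ℓ hℓ)
    have hfst : Tendsto (Prod.fst : Ω × Ω → Ω) (ae (P.prod P)) (ae P) :=
      Measure.quasiMeasurePreserving_fst.tendsto_ae
    filter_upwards [hfst.eventually M.ae_mean_eq, hfst.eventually M.ae_vol_eq] with p hp hp'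
    refine add_le_add (le_iSup₂_of_le M.θ₀ hθ ?_) (le_iSup₂_of_le M.θ₀ hθ ?_)
    · rw [hp]; rfl
    · rw [hp']; rfl
  rw [lintegral_prod_symm _ hΦm.aemeasurable] at hΦle
  -- The independent copy is frozen at a point `ω'` where the mean discrepancy does not exceed its
  -- average. This yields a coupling on `Ω` itself that depends only on the noise in `(i - ℓ, i)`.
  obtain ⟨ω', hω'⟩ := exists_le_lintegral (μ := P) (f := fun y => ∫⁻ x, Φ (x, y) ∂P)
    hΦm.lintegral_prod_left'.aemeasurable
  have hω'' := hω'.trans hΦle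
  have hWm : Measurable[noiseField M.ε (Set.Ioo (i - ℓ) i)] fun ω =>
      (M.meanCoupled i ℓ M.θ₀ (ω, ω'), M.volCoupled i ℓ M.θ₀ (ω, ω') ^ 2) :=
    Measurable.prodMk (m := noiseField M.ε (Set.Ioo (i - ℓ) i))
      (M.measurable_meanOfNoise (y := fun ω => splice ℓ (M.noisePast i ω) (M.noisePast i ω'))
        (fun j hj => M.measurable_splice_noiseField i ℓ _ j hj) M.θ₀)
      ((M.measurable_volOfNoise (y := fun ω => splice ℓ (M.noisePast i ω) (M.noisePast i ω'))
        (fun j hj => M.measurable_splice_noiseField i ℓ _ j hj) M.θ₀).pow_const 2)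
  refine ⟨_, hWm, ?_⟩
  have hWm' := hWm.mono (M.isIIDNoise.noiseField_le _) le_rfl
  set W : Ω → ℝ × ℝ := fun ω => (M.meanCoupled i ℓ M.θ₀ (ω, ω'), M.volCoupled i ℓ M.θ₀ (ω, ω') ^ 2)
  -- The weight `T = a^{-ℓ/2}` balances `T a^ℓ` against `T⁻¹`; the rate therefore drops from `a` to
  -- `√a`.
  have hT : 0 < (√a ^ ℓ)⁻¹ := by positivity
  have hT1 : 1 ≤ (√a ^ ℓ)⁻¹ := (one_le_inv₀ (by positivity)).2 (pow_le_one₀ hρ0.le hρ1.le)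
  refine (ENNReal.ofReal_le_ofReal_iff (by positivity)).1 ?_
  rw [ofReal_integral_eq_lintegral_ofReal (IsNoiseDriven.integrable_gap (hstate i) hWm')
    (ae_of_all _ fun ω => gap_nonneg _ _)]
  calc ∫⁻ ω, ENNReal.ofReal (gap (M.state i ω) (W ω)) ∂P
      ≤ ∫⁻ ω, (ENNReal.ofReal (√a ^ ℓ)⁻¹ * Φ (ω, ω') +
          ENNReal.ofReal (√a ^ ℓ) * (1 + ‖(M.state i ω).1‖ₑ ^ s)) ∂P := by
        refine lintegral_mono fun ω => (ofReal_gap_le hs hs1 hT _ _).trans ?_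
        have h1 : 1 ≤ ENNReal.ofReal (√a ^ ℓ)⁻¹ := by
          rw [← ENNReal.ofReal_one]
          exact ENNReal.ofReal_le_ofReal hT1
        rw [inv_inv]
        refine add_le_add ?_ le_rfl
        simp only [hΦ]
        rw [mul_add]
        exact add_le_add (le_mul_of_one_le_left' h1) le_rfl
    _ = ENNReal.ofReal (√a ^ ℓ)⁻¹ * ∫⁻ ω, Φ (ω, ω') ∂P +
          ENNReal.ofReal (√a ^ ℓ) * (1 + D) := by
        have m1 : Measurable fun ω => Φ (ω, ω') := hΦm.comp (measurable_id.prodMk measurable_const)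
        have m2 : Measurable fun ω => ‖(M.state i ω).1‖ₑ ^ s := (hstate i).fst.enorm.pow_const s
        rw [lintegral_add_left (m1.const_mul _), lintegral_const_mul _ m1,
          lintegral_const_mul _ (m2.const_add 1), lintegral_add_left measurable_const, hDt i]
        simp
    _ ≤ ENNReal.ofReal (√a ^ ℓ)⁻¹ * ENNReal.ofReal (κ * a ^ ℓ) +
          ENNReal.ofReal (√a ^ ℓ) * (1 + D) := by gcongr
    _ = ENNReal.ofReal ((κ + 1 + D.toReal) * √a ^ ℓ) := by
        have e : (√a ^ ℓ)⁻¹ * (κ * a ^ ℓ) = κ * √a ^ ℓ := by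
          have : a ^ ℓ = √a ^ ℓ * √a ^ ℓ := by rw [← mul_pow, Real.mul_self_sqrt ha.le]
          rw [this]
          field_simp
        rw [← ENNReal.ofReal_mul hT.le, e]
        nth_rewrite 1 [← ENNReal.ofReal_toReal hD.ne]
        rw [← ENNReal.ofReal_one, ← ENNReal.ofReal_add zero_le_one ENNReal.toReal_nonneg,
          ← ENNReal.ofReal_mul (by positivity), ← ENNReal.ofReal_add (by positivity)
          (by positivity)]
        congr 1; ring
    _ ≤ _ := by
        refine ENNReal.ofReal_le_ofReal ?_
        gcongr
        linarith

end LocationScaleModel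

/-! ### Weighted densities and the marginal density -/

lemma measurable_scaled_uncurry (γ : ℝ) (p : ℕ) {κ : ℝ → ℝ} (hκ : Measurable κ) :
    Measurable fun q : ℝ × (ℝ × ℝ) => scaled γ p κ q.1 q.2 := by
  unfold scaled
  have := measurable_clampVol γ
  fun_prop

lemma lintegral_affine_density {f : ℝ → ℝ} {ν : Measure ℝ} (hf : IsDensity f ν) {c : ℝ}
    (hc : 0 < c) (m : ℝ) {u : ℝ → ℝ≥0∞} (hu : Measurable u) :
    ∫⁻ y, u (m + y * c) ∂ν = ∫⁻ x, ENNReal.ofReal (c⁻¹ * f ((x - m) * c⁻¹)) * u x := by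
  have hm : Measurable fun x => ENNReal.ofReal (f x) := hf.measurable.ennreal_ofReal
  have hu' : Measurable fun y => u (m + y * c) := hu.comp (by fun_prop)
  have hG : Measurable fun x => ENNReal.ofReal (f ((x - m) * c⁻¹)) * u x :=
    (hm.comp (by fun_prop : Measurable fun x : ℝ => (x - m) * c⁻¹)).mul hu
  have hG' : Measurable fun x => ENNReal.ofReal (f ((m + x - m) * c⁻¹)) * u (m + x) :=
    hG.comp (measurable_const_add m)
  rw [hf.eq_withDensity, lintegral_withDensity_eq_lintegral_mul _ hm hu']
  have h1 := lintegral_map hG' (measurable_mul_const c : Measurable fun y : ℝ => y * c) (μ := volume)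
  rw [Real.map_volume_mul_right hc.ne', lintegral_smul_measure, abs_of_pos (inv_pos.2 hc),
    lintegral_add_left_eq_self (fun x => ENNReal.ofReal (f ((x - m) * c⁻¹)) * u x) m] at h1
  calc _ = ∫⁻ y, ENNReal.ofReal (f ((m + y * c - m) * c⁻¹)) * u (m + y * c) := by
        refine lintegral_congr fun y => ?_
        simp only [Pi.mul_apply, add_sub_cancel_left, mul_assoc, mul_inv_cancel₀ hc.ne', mul_one]
    _ = ENNReal.ofReal c⁻¹ * ∫⁻ x, ENNReal.ofReal (f ((x - m) * c⁻¹)) * u x := h1.symm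
    _ = _ := by
        rw [← lintegral_const_mul _ hG]
        refine lintegral_congr fun x => ?_
        rw [ENNReal.ofReal_mul (inv_pos.2 hc).le, mul_assoc]

namespace LocationScaleModel

variable {Ω : Type*} [MeasurableSpace Ω] {P : Measure Ω} [IsProbabilityMeasure P] {d : ℕ}
  (M : LocationScaleModel P d) {γ : ℝ}

lemma measurable_state (t : ℤ) : Measurable (M.state t) :=
  (M.measurable_state_noiseField t).mono (M.isIIDNoise.noiseField_le _) le_rfl

lemma measurable_ratio (t : ℤ) (v : ℝ) : Measurable (M.ratio t v) :=
  ((M.measurable_mean t M.θ₀).const_sub v).div (M.measurable_vol t M.θ₀)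

lemma ae_mean_vol_eq_state (hγ : 0 < γ) (hvol : ∀ i : ℤ, ∀ᵐ ω ∂P, ∀ θ : M.Θ, γ ≤ M.vol i θ ω) :
    ∀ᵐ ω ∂P, ∀ t : ℤ, M.mean t M.θ₀ ω = (M.state t ω).1 ∧
      M.vol t M.θ₀ ω = clampVol γ (M.state t ω).2 := by
  filter_upwards [M.ae_mean_eq, M.ae_vol_eq, ae_all_iff.2 hvol] with ω h1 h2 h3 t
  refine ⟨h1 t _, ?_⟩
  have h4 := h3 t M.θ₀
  rw [h2] at h4 ⊢
  exact (clampVol_sq hγ h4).symm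

lemma ae_scaled_state_eq (hγ : 0 < γ) (hvol : ∀ i : ℤ, ∀ᵐ ω ∂P, ∀ θ : M.Θ, γ ≤ M.vol i θ ω) :
    ∀ᵐ ω ∂P, ∀ (t : ℤ) (φ : ℝ → ℝ) (v : ℝ), scaled γ 1 φ v (M.state t ω) =
      (M.vol t M.θ₀ ω)⁻¹ * φ (M.ratio t v ω) := by
  filter_upwards [M.ae_mean_vol_eq_state hγ hvol] with ω h t φ v
  rw [scaled, ratio, (h t).1, (h t).2, pow_one, div_eq_mul_inv]

lemma integrable_inv_vol (hγ : 0 < γ) (hvol : ∀ i : ℤ, ∀ᵐ ω ∂P, ∀ θ : M.Θ, γ ≤ M.vol i θ ω) :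
    Integrable (fun ω => (M.vol 0 M.θ₀ ω)⁻¹) P := by
  refine Integrable.of_bound (M.measurable_vol 0 M.θ₀).inv.aestronglyMeasurable γ⁻¹ ?_
  filter_upwards [hvol 0] with ω h
  have := h M.θ₀
  rw [Real.norm_eq_abs, abs_of_pos (inv_pos.2 (hγ.trans_le this))]
  exact inv_anti₀ hγ this

section WeightedDensity

variable {v : ℝ} {gv : ℝ → ℝ}

lemma IsWeightedDensity.measurable (h : M.IsWeightedDensity v gv) : Measurable gv := by
  obtain ⟨h, q, hh, hq, -, -, e⟩ := h
  rw [show gv = fun x => q x * h x from funext e]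
  exact hq.mul hh.measurable

lemma IsWeightedDensity.nonneg (h : M.IsWeightedDensity v gv) (x : ℝ) : 0 ≤ gv x := by
  obtain ⟨h, q, hh, -, hq, -, e⟩ := h
  rw [e]
  exact mul_nonneg (hq x) (hh.nonneg x)

/-- The defining property of the weighted density. -/
lemma IsWeightedDensity.integral_scaled (h : M.IsWeightedDensity v gv) (hγ : 0 < γ)
    (hvol : ∀ i : ℤ, ∀ᵐ ω ∂P, ∀ θ : M.Θ, γ ≤ M.vol i θ ω) {φ : ℝ → ℝ} (hφ : Measurable φ) {B : ℝ}
    (hB : ∀ x, |φ x| ≤ B) :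
    ∫ z, scaled γ 1 φ v z ∂(P.map (M.state 0)) = ∫ x, φ x * gv x := by
  obtain ⟨h, q, hh, hqm, hq, hc, e⟩ := h
  have hL := M.measurable_ratio 0 v
  have hφL : StronglyMeasurable[MeasurableSpace.comap (M.ratio 0 v) inferInstance]
      fun ω => φ (M.ratio 0 v ω) := (hφ.comp (comap_measurable _)).stronglyMeasurable
  have hint := M.integrable_inv_vol hγ hvol
  have hint2 : Integrable ((fun ω => (M.vol 0 M.θ₀ ω)⁻¹) * fun ω => φ (M.ratio 0 v ω)) P :=
    hint.mul_bdd (c := B) (hφ.comp hL).aestronglyMeasurable (ae_of_all _ fun ω => hB _)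
  -- Conditioning on the ratio replaces `1/σ` by `q`, and the density `h` of the ratio then produces
  -- `q h = gv`.
  have h1 := condExp_mul_of_stronglyMeasurable_right hφL hint2 hint
  rw [integral_map (M.measurable_state 0).aemeasurable (measurable_scaled γ 1 hφ v).aestronglyMeasurable]
  calc ∫ ω, scaled γ 1 φ v (M.state 0 ω) ∂P
      = ∫ ω, ((fun ω => (M.vol 0 M.θ₀ ω)⁻¹) * fun ω => φ (M.ratio 0 v ω)) ω ∂P := by
        refine integral_congr_ae ?_
        filter_upwards [M.ae_scaled_state_eq hγ hvol] with ω hω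
        rw [hω]; rfl
    _ = ∫ ω, q (M.ratio 0 v ω) * φ (M.ratio 0 v ω) ∂P := by
        rw [← integral_condExp hL.comap_le]
        refine integral_congr_ae ?_
        filter_upwards [h1, hc] with ω hω hω'
        rw [hω, Pi.mul_apply, hω']
    _ = ∫ x, q x * φ x ∂(P.map (M.ratio 0 v)) :=
        (integral_map hL.aemeasurable (hqm.mul hφ).aestronglyMeasurable).symm
    _ = ∫ x, h x * (q x * φ x) := integral_eq_integral_density_mul hh _
    _ = _ := by
        refine integral_congr_ae (ae_of_all _ fun x => ?_)
        simp only
        rw [e]; ring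

end WeightedDensity

/-- The marginal density is the average of the conditional densities. -/
lemma density_eq_integral_scaled (hγ : 0 < γ)
    (hvol : ∀ i : ℤ, ∀ᵐ ω ∂P, ∀ θ : M.Θ, γ ≤ M.vol i θ ω) {fε fX : ℝ → ℝ}
    (hfε : IsDensity fε (P.map (M.ε 0))) (hfX : IsDensity fX (P.map (M.X 0)))
    (hfX_cont : Continuous fX) {B L : ℝ} (hB : ∀ x, |fε x| ≤ B)
    (hL : ∀ x y, |fε x - fε y| ≤ L * |x - y|) (v : ℝ) :
    fX v = ∫ z, scaled γ 1 fε v z ∂(P.map (M.state 0)) := by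
  have hst := M.measurable_state 0
  have hπ : IsProbabilityMeasure (P.map (M.state 0)) :=
    Measure.isProbabilityMeasure_map hst.aemeasurable
  have hν := M.isIIDNoise.isProbabilityMeasure
  set p : ℝ → ℝ := fun v => ∫ z, scaled γ 1 fε v z ∂(P.map (M.state 0)) with hp
  have hL0 : 0 ≤ L := by
    have := (abs_nonneg _).trans (hL 1 0); simpa using this
  have hint : ∀ v, Integrable (scaled γ 1 fε v) (P.map (M.state 0)) := fun v =>
    integrable_of_abs_le (measurable_scaled γ 1 hfε.measurable v) (abs_scaled_le hγ 1 hB v)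
  have hpc : Continuous p := by
    refine (LipschitzWith.of_dist_le_mul (K := (γ⁻¹ ^ 2 * L).toNNReal) fun v w => ?_).continuous
    rw [Real.dist_eq, Real.dist_eq, Real.coe_toNNReal _ (by positivity), hp]
    simp only
    rw [← integral_sub (hint v) (hint w)]
    exact abs_integral_le_of_abs_le (abs_scaled_sub_le hγ 1 hL v w)
  have hnn : ∀ v z, 0 ≤ scaled γ 1 fε v z := fun v z =>
    mul_nonneg (pow_nonneg (inv_nonneg.2 (clampVol_pos hγ _).le) _) (hfε.nonneg _)
  have hXeq : P.map (M.X 0) = P.map fun ω => (M.state 0 ω).1 + M.ε 0 ω * clampVol γ (M.state 0 ω).2 := by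
    refine Measure.map_congr ?_
    filter_upwards [M.recursion 0, M.ae_mean_vol_eq_state hγ hvol] with ω h1 h2
    rw [← (h2 0).1, ← (h2 0).2, h1]
    rfl
  -- Given the state, `X 0` is an affine image of the independent variable `ε 0`, so mixing its
  -- conditional densities over the state gives a density of `X 0`.
  have hind : IndepFun (M.state 0) (M.ε 0) P :=
    M.isIIDNoise.indepFun (S := Set.Iio 0) (T := {0}) (by simp) (M.measurable_state_noiseField 0)
      (measurable_noiseField M.ε (Set.mem_singleton 0))
  have hmap := (indepFun_iff_map_prod_eq_prod_map_map hst.aemeasurable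
    (M.measurable_ε 0).aemeasurable).1 hind
  have hψ : Measurable fun q : (ℝ × ℝ) × ℝ => q.1.1 + q.2 * clampVol γ q.1.2 := by
    have := measurable_clampVol γ
    fun_prop
  have hscm := measurable_scaled_uncurry γ 1 hfε.measurable
  have hden : P.map (M.X 0) = volume.withDensity fun x => ENNReal.ofReal (p x) := by
    ext S hS
    have hu : Measurable (S.indicator (1 : ℝ → ℝ≥0∞)) := measurable_one.indicator hS
    have huψ : Measurable fun q : (ℝ × ℝ) × ℝ =>
        S.indicator (1 : ℝ → ℝ≥0∞) (q.1.1 + q.2 * clampVol γ q.1.2) := hu.comp hψ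
    have hcomp : (fun ω => (M.state 0 ω).1 + M.ε 0 ω * clampVol γ (M.state 0 ω).2) =
        (fun q : (ℝ × ℝ) × ℝ => q.1.1 + q.2 * clampVol γ q.1.2) ∘
          fun ω => (M.state 0 ω, M.ε 0 ω) := rfl
    rw [hXeq, hcomp, ← Measure.map_map hψ (hst.prodMk (M.measurable_ε 0)), hmap,
      ← lintegral_indicator_one hS, lintegral_map hu hψ, lintegral_prod _ huψ.aemeasurable]
    calc ∫⁻ z, ∫⁻ y, S.indicator 1 (z.1 + y * clampVol γ z.2) ∂(P.map (M.ε 0)) ∂(P.map (M.state 0))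
        = ∫⁻ z, ∫⁻ x, ENNReal.ofReal (scaled γ 1 fε x z) * S.indicator 1 x ∂volume ∂(P.map (M.state 0)) := by
          refine lintegral_congr fun z => ?_
          rw [lintegral_affine_density hfε (clampVol_pos hγ z.2) z.1 hu]
          simp only [scaled, pow_one]
      _ = ∫⁻ x, ∫⁻ z, ENNReal.ofReal (scaled γ 1 fε x z) * S.indicator 1 x ∂(P.map (M.state 0)) := by
          refine lintegral_lintegral_swap (Measurable.aemeasurable ?_)
          exact (hscm.comp measurable_swap).ennreal_ofReal.mul (hu.comp measurable_snd)
      _ = ∫⁻ x, S.indicator (fun x => ENNReal.ofReal (p x)) x := by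
          refine lintegral_congr fun x => ?_
          rw [lintegral_mul_const _ (measurable_scaled γ 1 hfε.measurable x).ennreal_ofReal,
            ← ofReal_integral_eq_lintegral_ofReal (hint x) (ae_of_all _ (hnn x))]
          by_cases hx : x ∈ S <;> simp [hx, hp]
      _ = _ := by rw [lintegral_indicator hS, withDensity_apply _ hS]
  have hae : (fun x => ENNReal.ofReal (fX x)) =ᵐ[volume] fun x => ENNReal.ofReal (p x) := by
    refine (withDensity_eq_iff hfX.measurable.ennreal_ofReal.aemeasurable
      hpc.measurable.ennreal_ofReal.aemeasurable ?_).1 (hfX.eq_withDensity.symm.trans hden)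
    have := Measure.isProbabilityMeasure_map (μ := P) (M.measurable_X 0).aemeasurable
    rw [← setLIntegral_univ, ← withDensity_apply _ MeasurableSet.univ, ← hfX.eq_withDensity]
    simp
  have hae' : fX =ᵐ[volume] p := by
    filter_upwards [hae] with x hx
    exact (ENNReal.ofReal_eq_ofReal_iff (hfX.nonneg x) (integral_nonneg (hnn x))).1 hx
  -- Densities are unique only almost everywhere; continuity of both versions gives the identity at
  -- each `v`.
  exact congrFun ((hfX_cont.ae_eq_iff_eq volume hpc).1 hae') v

end LocationScaleModel

/-! ### Bandwidth conditions and the block length -/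

section Bandwidth

variable {b : ℕ → ℝ} {δ : ℝ}

lemma tendsto_bandwidth_zero (hb : ∀ n, 0 < b n)
    (hb_upper : Tendsto (fun n : ℕ => (n : ℝ) * b n ^ 4) atTop (𝓝 0)) :
    Tendsto b atTop (𝓝 0) := by
  have h4 : Tendsto (fun n => b n ^ 4) atTop (𝓝 0) := by
    refine squeeze_zero' (Eventually.of_forall fun n => by have := hb n; positivity) ?_ hb_upper
    filter_upwards [eventually_ge_atTop 1] with n hn
    have h1 : (1 : ℝ) ≤ n := by exact_mod_cast hn
    have h2 : 0 < b n ^ 4 := pow_pos (hb n) 4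
    nlinarith
  have h5 : Tendsto (fun n => √(√(b n ^ 4))) atTop (𝓝 0) := by
    have := (Real.continuous_sqrt.tendsto 0).comp ((Real.continuous_sqrt.tendsto' 0 0
      Real.sqrt_zero).comp h4)
    simpa [Function.comp_def] using this
  refine h5.congr fun n => ?_
  rw [show b n ^ 4 = (b n ^ 2) ^ 2 by ring, Real.sqrt_sq (by positivity), Real.sqrt_sq (hb n).le]

/-- The bandwidth conditions leave a polynomial margin. -/
lemma eventually_rpow_le_mul_sq_bandwidth (hb : ∀ n, 0 < b n) (hδ : 0 < δ)
    (hb_lower : Tendsto (fun n : ℕ => (n : ℝ) * b n ^ (2 + δ)) atTop atTop)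
    (hb_upper : Tendsto (fun n : ℕ => (n : ℝ) * b n ^ 4) atTop (𝓝 0)) :
    ∀ᶠ n : ℕ in atTop, (n : ℝ) ^ (δ / 4) ≤ n * b n ^ 2 := by
  filter_upwards [hb_lower.eventually_ge_atTop 1, hb_upper.eventually_lt_const one_pos,
    eventually_ge_atTop 1] with n h1 h2 hn
  have hn0 : (0 : ℝ) < n := by exact_mod_cast hn
  have hbn := hb n
  -- `n b⁴ < 1` gives `b^δ ≤ n^{-δ/4}`, so dividing `n b^{2+δ} ≥ 1` by `b^δ` yields the margin.
  have h3 : (n : ℝ) ^ (δ / 4) * b n ^ δ ≤ 1 := by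
    have e : (n : ℝ) ^ (δ / 4) * b n ^ δ = ((n : ℝ) * b n ^ 4) ^ (δ / 4) := by
      rw [Real.mul_rpow hn0.le (by positivity), ← Real.rpow_natCast (b n) 4, ← Real.rpow_mul hbn.le]
      congr 2
      push_cast
      ring
    rw [e]
    exact Real.rpow_le_one (by positivity) h2.le (by positivity)
  have h4 : (n : ℝ) * b n ^ (2 + δ) = n * b n ^ 2 * b n ^ δ := by
    rw [Real.rpow_add hbn, Real.rpow_two, mul_assoc]
  rw [h4] at h1
  have h5 : 0 < b n ^ δ := Real.rpow_pos_of_pos hbn δ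
  exact le_of_mul_le_mul_right (h3.trans h1) h5

lemma tendsto_sq_mul_pow_ceil_rpow {a τ : ℝ} (ha : 0 < a) (ha1 : a < 1) (hτ : 0 < τ) :
    Tendsto (fun n : ℕ => (n : ℝ) ^ 2 * a ^ ⌈(n : ℝ) ^ τ⌉₊) atTop (𝓝 0) := by
  have hl : 0 < -Real.log a := neg_pos.2 (Real.log_neg ha ha1)
  have h1 := tendsto_rpow_mul_exp_neg_mul_atTop_nhds_zero (2 / τ) _ hl
  have h2 := h1.comp ((tendsto_rpow_atTop hτ).comp tendsto_natCast_atTop_atTop)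
  refine squeeze_zero (fun n => by positivity) (fun n => ?_) h2
  simp only [Function.comp_apply, neg_neg]
  rw [← Real.rpow_mul (Nat.cast_nonneg n), mul_div_cancel₀ _ hτ.ne', Real.rpow_two]
  gcongr
  rw [← Real.rpow_def_of_pos ha, ← Real.rpow_natCast]
  exact Real.rpow_le_rpow_of_exponent_ge ha ha1.le (Nat.le_ceil _)

/-- The length `⌈n^{δ/16}⌉` works: `ℓ²` is of order `n^{δ/8}`, below the margin `n^{δ/4} ≤ n b²`,
while `a^ℓ` decays faster than any power and beats `√n b⁻² ≤ n²`. -/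
lemma exists_block_length (hb : ∀ n, 0 < b n) (hδ : 0 < δ)
    (hb_lower : Tendsto (fun n : ℕ => (n : ℝ) * b n ^ (2 + δ)) atTop atTop)
    (hb_upper : Tendsto (fun n : ℕ => (n : ℝ) * b n ^ 4) atTop (𝓝 0)) {a : ℝ} (ha : 0 < a)
    (ha1 : a < 1) :
    ∃ ℓ : ℕ → ℕ, (∀ n, 1 ≤ n → 1 ≤ ℓ n) ∧
      Tendsto (fun n : ℕ => (ℓ n : ℝ) ^ 2 / (n * b n ^ 2)) atTop (𝓝 0) ∧
      Tendsto (fun n : ℕ => √(n : ℝ) * (b n ^ 2)⁻¹ * a ^ ℓ n) atTop (𝓝 0) := by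
  have hτ : 0 < δ / 16 := by positivity
  have hev := eventually_rpow_le_mul_sq_bandwidth hb hδ hb_lower hb_upper
  refine ⟨fun n => ⌈(n : ℝ) ^ (δ / 16)⌉₊, fun n hn => ?_, ?_, ?_⟩
  · exact Nat.one_le_ceil_iff.2 (Real.rpow_pos_of_pos (by exact_mod_cast hn) _)
  · have h0 : Tendsto (fun n : ℕ => 4 * (n : ℝ) ^ (-(δ / 8))) atTop (𝓝 0) := by
      simpa using (tendsto_natCast_rpow_neg (by linarith : -(δ / 8) < 0)).const_mul 4
    refine squeeze_zero' (Eventually.of_forall fun n => by have := hb n; positivity) ?_ h0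
    filter_upwards [hev, eventually_ge_atTop 1] with n h1 hn
    have hn0 : (0 : ℝ) < n := by exact_mod_cast hn
    have hn1 : (1 : ℝ) ≤ n := by exact_mod_cast hn
    have hx1 : 1 ≤ (n : ℝ) ^ (δ / 16) := Real.one_le_rpow hn1 hτ.le
    have hc : (⌈(n : ℝ) ^ (δ / 16)⌉₊ : ℝ) ≤ 2 * (n : ℝ) ^ (δ / 16) := by
      have := (Nat.ceil_lt_add_one (by positivity : 0 ≤ (n : ℝ) ^ (δ / 16))).le
      linarith
    have hpos : 0 < (n : ℝ) ^ (δ / 4) := Real.rpow_pos_of_pos hn0 _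
    calc (⌈(n : ℝ) ^ (δ / 16)⌉₊ : ℝ) ^ 2 / (n * b n ^ 2)
        ≤ (2 * (n : ℝ) ^ (δ / 16)) ^ 2 / (n : ℝ) ^ (δ / 4) := by gcongr
      _ = 4 * ((n : ℝ) ^ (δ / 16 * 2) / (n : ℝ) ^ (δ / 4)) := by
          rw [Real.rpow_mul hn0.le, Real.rpow_two]; ring
      _ = _ := by
          rw [← Real.rpow_sub hn0]
          congr 2
          ring
  · refine squeeze_zero' (Eventually.of_forall fun n => by have := hb n; positivity) ?_
      (tendsto_sq_mul_pow_ceil_rpow ha ha1 hτ)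
    filter_upwards [hev, eventually_ge_atTop 1] with n h1 hn
    have hn1 : (1 : ℝ) ≤ n := by exact_mod_cast hn
    have hx1 : 1 ≤ (n : ℝ) ^ (δ / 4) := Real.one_le_rpow hn1 (by positivity)
    have h2 : (b n ^ 2)⁻¹ ≤ n := by
      rw [inv_le_iff_one_le_mul₀ (pow_pos (hb n) 2)]
      linarith
    have h3 : √(n : ℝ) ≤ n := by
      rw [Real.sqrt_le_left (by linarith)]
      nlinarith
    rw [sq (n : ℝ)]
    gcongr

end Bandwidth

/-! ### Decomposition of the remainder -/

/-- The smoothing bias of a twice differentiable density is of second order. -/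
lemma abs_integral_pairKernel_sub_le {K : ℝ → ℝ} (hK : IsKernel K) {f : ℝ → ℝ} {ν : Measure ℝ}
    (hf : IsDensity f ν) {A B : ℝ} (hA : ∀ x, |f x| ≤ A) (hd : Differentiable ℝ f)
    (hB : ∀ x y, |deriv f x - deriv f y| ≤ B * |x - y|) {γ b : ℝ} (hγ : 0 < γ) (hb : 0 < b)
    (v : ℝ) (z : ℝ × ℝ) :
    |∫ y, pairKernel γ K b v z y ∂ν - scaled γ 1 f v z| ≤ γ⁻¹ * (B * b ^ 2) := by
  have hρ := isProbabilityMeasure_kernelMeasure hK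
  have hs := ae_kernelMeasure_abs_le hK
  have hB0 : 0 ≤ B := by
    have := (abs_nonneg _).trans (hB 1 0); simpa using this
  simp only [pairKernel, scaled, pow_one]
  set x := (v - z.1) * (clampVol γ z.2)⁻¹
  rw [integral_const_mul, integral_eq_integral_density_mul hf]
  simp_rw [mul_comm (f _)]
  rw [integral_kernel_mul_comp_sub hK hb, ← mul_sub, abs_mul,
    abs_of_pos (inv_pos.2 (clampVol_pos hγ z.2))]
  have h1 : Integrable (fun s => f (x - b * s)) (kernelMeasure K) :=
    integrable_of_abs_le (hf.measurable.comp (by fun_prop)) fun s => hA _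
  have h2 : Integrable (fun s : ℝ => deriv f x * (-(b * s))) (kernelMeasure K) := by
    have : Integrable (fun s : ℝ => s) (kernelMeasure K) :=
      Integrable.of_bound measurable_id.aestronglyMeasurable 1 hs
    exact ((this.const_mul b).neg).const_mul _
  -- The first-order Taylor term may be subtracted freely because `K` has mean zero.
  have e : ∫ s, f (x - b * s) ∂(kernelMeasure K) - f x =
      ∫ s, (f (x - b * s) - f x - deriv f x * (-(b * s))) ∂(kernelMeasure K) := by
    have h12 : Integrable (fun s => f (x - b * s) - f x) (kernelMeasure K) :=
      h1.sub (integrable_const _)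
    rw [integral_sub h12 h2, integral_sub h1 (integrable_const _),
      integral_const_mul, integral_neg, integral_const_mul, integral_kernelMeasure_id hK]
    simp
  have h3 : |∫ s, f (x - b * s) ∂(kernelMeasure K) - f x| ≤ B * b ^ 2 := by
    rw [e]
    have := norm_integral_le_of_norm_le_const (μ := kernelMeasure K) (C := B * b ^ 2)
      (f := fun s => f (x - b * s) - f x - deriv f x * (-(b * s))) (hs.mono fun s hs => by
        have h4 := abs_taylor_le hd hB x (-(b * s))
        rw [← sub_eq_add_neg] at h4
        refine h4.trans ?_
        have : s ^ 2 ≤ 1 := by rw [← sq_abs]; nlinarith [abs_nonneg s]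
        have h5 : (-(b * s)) ^ 2 = b ^ 2 * s ^ 2 := by ring
        rw [h5]
        calc B * (b ^ 2 * s ^ 2) ≤ B * (b ^ 2 * 1) := by gcongr
          _ = _ := by ring)
    simpa using this
  exact mul_le_mul (inv_clampVol_le hγ z.2) h3 (abs_nonneg _) (inv_nonneg.2 hγ.le)

/-- Regrouping of a normalized double sum into its degenerate part and its projections. -/
lemma sqrt_mul_sum_sub_eq {n : ℕ} (hn : 1 ≤ n) (u κν φ : ℕ → ℝ) (κ D : ℕ → ℕ → ℝ) (ψ : ℕ → ℝ)
    (c f : ℝ) (h : ∀ i j, D i j = κ i j - κν i - u j + c) :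
    √(n : ℝ) * (((n : ℝ) ^ 2)⁻¹ * ∑ i ∈ Finset.Icc 1 n, ∑ j ∈ Finset.Icc 1 n, κ i j - f) -
        (√(n : ℝ))⁻¹ * ∑ i ∈ Finset.Icc 1 n, (ψ i + φ i - 2 * f) -
        (√(n : ℝ))⁻¹ * ∑ j ∈ Finset.Icc 1 n, (u j - ψ j - (c - f)) =
      (√(n : ℝ))⁻¹ * (n : ℝ)⁻¹ * ∑ i ∈ Finset.Icc 1 n, ∑ j ∈ Finset.Icc 1 n, D i j +
        (√(n : ℝ))⁻¹ * ∑ i ∈ Finset.Icc 1 n, (κν i - φ i) := by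
  have hn0 : (0 : ℝ) < n := by exact_mod_cast hn
  simp only [h, Finset.sum_sub_distrib, Finset.sum_add_distrib, Finset.sum_const, Nat.card_Icc,
    Nat.add_sub_cancel, nsmul_eq_mul, ← Finset.mul_sum]
  set S := ∑ i ∈ Finset.Icc 1 n, ∑ j ∈ Finset.Icc 1 n, κ i j
  set a1 := ∑ i ∈ Finset.Icc 1 n, u i
  set a2 := ∑ i ∈ Finset.Icc 1 n, κν i
  set a3 := ∑ i ∈ Finset.Icc 1 n, φ i
  set a4 := ∑ i ∈ Finset.Icc 1 n, ψ i
  have hs : 0 < √(n : ℝ) := Real.sqrt_pos.2 hn0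
  have hs2 : (n : ℝ) = √(n : ℝ) ^ 2 := (Real.sq_sqrt hn0.le).symm
  set r := √(n : ℝ)
  rw [hs2]
  field_simp
  ring

namespace LocationScaleModel

variable {Ω : Type*} [MeasurableSpace Ω] {P : Measure Ω} [IsProbabilityMeasure P] {d : ℕ}
  (M : LocationScaleModel P d) {γ : ℝ} {K fε fX : ℝ → ℝ} {b : ℕ → ℝ} {α β s₀ : ℝ} {g : ℝ → ℝ → ℝ}

/-- The marginal density is the mean of the weighted density. -/
lemma density_eq_integral_weightedDensity (hγ : 0 < γ)
    (hvol : ∀ i : ℤ, ∀ᵐ ω ∂P, ∀ θ : M.Θ, γ ≤ M.vol i θ ω)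
    (hfε : IsDensity fε (P.map (M.ε 0))) (hfX : IsDensity fX (P.map (M.X 0)))
    (hfX_cont : Continuous fX) {B L : ℝ} (hB : ∀ x, |fε x| ≤ B)
    (hL : ∀ x y, |fε x - fε y| ≤ L * |x - y|) {v : ℝ} {gv : ℝ → ℝ}
    (hg : M.IsWeightedDensity v gv) : ∫ y, gv y ∂(P.map (M.ε 0)) = fX v := by
  rw [M.density_eq_integral_scaled hγ hvol hfε hfX hfX_cont hB hL,
    IsWeightedDensity.integral_scaled M hg hγ hvol hfε.measurable hB,
    integral_eq_integral_density_mul hfε]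

/-- This identifies the projection on the noise: the average over the state is an integral of the
rescaled kernel against `gv`. -/
lemma integral_pairKernel_eq_smoothing (hK : IsKernel K) (hγ : 0 < γ)
    (hvol : ∀ i : ℤ, ∀ᵐ ω ∂P, ∀ θ : M.Θ, γ ≤ M.vol i θ ω) {v : ℝ} {gv : ℝ → ℝ}
    (hg : M.IsWeightedDensity v gv) {b : ℝ} (hb : 0 < b) (y : ℝ) :
    ∫ z, pairKernel γ K b v z y ∂(P.map (M.state 0)) = smoothing (kernelMeasure K) b gv y := by
  obtain ⟨Q, -, hQ⟩ := hK.exists_bound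
  have hm : Measurable (bump K b y) := by
    have := hK.continuous.measurable
    unfold bump
    fun_prop
  simp only [pairKernel]
  rw [IsWeightedDensity.integral_scaled M hg hγ hvol hm (abs_bump_le hQ hb y),
    integral_kernel_mul_comp hK hb]
  rfl

/-- The remainder is the sum of a degenerate double sum, a smoothing bias, and an empirical process
of smoothing errors. -/
lemma ae_remainder_eq (hγ : 0 < γ) (hvol : ∀ i : ℤ, ∀ᵐ ω ∂P, ∀ θ : M.Θ, γ ≤ M.vol i θ ω)
    (hK : IsKernel K) (hb : ∀ n, 0 < b n) (hfε : IsDensity fε (P.map (M.ε 0)))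
    (hfX : IsDensity fX (P.map (M.X 0)))
    (hfX_cont : Continuous fX) {B L : ℝ} (hB : ∀ x, |fε x| ≤ B)
    (hL : ∀ x y, |fε x - fε y| ≤ L * |x - y|)
    (hg : ∀ v ∈ Set.Icc α β, M.IsWeightedDensity v (g v))
    (hgi : ∀ v ∈ Set.Icc α β, Integrable (g v) (P.map (M.ε 0))) :
    ∀ᵐ ω ∂P, ∀ n : ℕ, 1 ≤ n → ∀ v ∈ Set.Icc α β,
      M.remainder K b fε fX g n v ω - empProc (P.map (M.ε 0)) M.ε n
          (fun y => smoothing (kernelMeasure K) (b n) (g v) y - g v y) ω =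
        (√(n : ℝ))⁻¹ * (n : ℝ)⁻¹ * ∑ i ∈ Finset.Icc 1 n, ∑ j ∈ Finset.Icc 1 n,
          degenerate (P.map (M.state 0)) (P.map (M.ε 0)) (pairKernel γ K (b n) v)
            (M.state i ω) (M.ε j ω) +
        (√(n : ℝ))⁻¹ * ∑ i ∈ Finset.Icc 1 n,
          (∫ y, pairKernel γ K (b n) v (M.state i ω) y ∂(P.map (M.ε 0)) -
            scaled γ 1 fε v (M.state i ω)) := by
  have hν := M.isIIDNoise.isProbabilityMeasure
  have hπ : IsProbabilityMeasure (P.map (M.state 0)) :=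
    Measure.isProbabilityMeasure_map (M.measurable_state 0).aemeasurable
  obtain ⟨Q, -, hQ⟩ := hK.exists_bound
  filter_upwards [M.ae_scaled_state_eq hγ hvol] with ω hω n hn v hv
  have hκm : Measurable (Function.uncurry (pairKernel γ K (b n) v)) :=
    measurable_pairKernel hK.continuous v
  have hκb := abs_pairKernel_le hγ hQ (hb n) v
  have hsm : (fun y => ∫ z, pairKernel γ K (b n) v z y ∂(P.map (M.state 0))) =
      smoothing (kernelMeasure K) (b n) (g v) :=
    funext fun y => M.integral_pairKernel_eq_smoothing hK hγ hvol (hg v hv) (hb n) y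
  set c := ∫ z, ∫ y, pairKernel γ K (b n) v z y ∂(P.map (M.ε 0)) ∂(P.map (M.state 0)) with hc
  -- Integrability is read off from the other representation, as an average of a bounded kernel.
  have hsi : Integrable (smoothing (kernelMeasure K) (b n) (g v)) (P.map (M.ε 0)) := by
    rw [← hsm]
    exact integrable_of_abs_le (measurable_integral_left hκm)
      fun y => abs_integral_le_of_abs_le fun z => hκb z y
  have hcs : ∫ y, smoothing (kernelMeasure K) (b n) (g v) y ∂(P.map (M.ε 0)) = c := by
    rw [← hsm, hc, integral_integral_swap (integrable_of_abs_le hκm fun p => hκb p.1 p.2)]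
  have hgX := M.density_eq_integral_weightedDensity hγ hvol hfε hfX hfX_cont hB hL (hg v hv)
  rw [← sqrt_mul_sum_sub_eq hn (fun j => smoothing (kernelMeasure K) (b n) (g v) (M.ε j ω))
    (fun i => ∫ y, pairKernel γ K (b n) v (M.state i ω) y ∂(P.map (M.ε 0)))
    (fun i => scaled γ 1 fε v (M.state i ω))
    (fun i j => pairKernel γ K (b n) v (M.state i ω) (M.ε j ω))
    (fun i j => degenerate (P.map (M.state 0)) (P.map (M.ε 0)) (pairKernel γ K (b n) v)
            (M.state i ω) (M.ε j ω)) (fun i => g v (M.ε i ω)) c (fX v)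
    (fun i j => by simp only [degenerate, ← hsm, hc])]
  have e1 : M.estimator K b n v ω = ((n : ℝ) ^ 2)⁻¹ * ∑ i ∈ Finset.Icc 1 n, ∑ j ∈ Finset.Icc 1 n,
      pairKernel γ K (b n) v (M.state i ω) (M.ε j ω) := by
    simp only [estimator, pairKernel, hω, bump]
  have e2 : M.leadingTerm fε fX g n v ω = (√(n : ℝ))⁻¹ * ∑ i ∈ Finset.Icc 1 n,
      (g v (M.ε i ω) + scaled γ 1 fε v (M.state i ω) - 2 * fX v) := by
    simp only [leadingTerm, hω, ratio]
  have e3 : empProc (P.map (M.ε 0)) M.ε n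
      (fun y => smoothing (kernelMeasure K) (b n) (g v) y - g v y) ω = (√(n : ℝ))⁻¹ *
      ∑ j ∈ Finset.Icc 1 n, (smoothing (kernelMeasure K) (b n) (g v) (M.ε j ω) - g v (M.ε j ω) -
        (c - fX v)) := by
    simp only [empProc]
    rw [integral_sub hsi (hgi v hv), hcs, hgX]
  rw [remainder, e1, e2, e3]

/-- Up to a uniformly negligible term, the remainder is the empirical process of the smoothing
errors. -/
lemma isLittleOP_iSup_remainder_sub_empProc (h_memory : M.ShortMemory) (hγ : 0 < γ)
    (hvol : ∀ i : ℤ, ∀ᵐ ω ∂P, ∀ θ : M.Θ, γ ≤ M.vol i θ ω)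
    (hK : IsKernel K) (hb : ∀ n, 0 < b n) {δ : ℝ} (hδ₀ : 0 < δ)
    (hb_lower : Tendsto (fun n : ℕ => (n : ℝ) * b n ^ (2 + δ)) atTop atTop)
    (hb_upper : Tendsto (fun n : ℕ => (n : ℝ) * b n ^ 4) atTop (𝓝 0))
    (hfε : IsDensity fε (P.map (M.ε 0))) (hfX : IsDensity fX (P.map (M.X 0)))
    (hfX_cont : Continuous fX) {B : ℝ} (hB : ∀ x, |fε x| ≤ B) (hd : Differentiable ℝ fε)
    (hL : ∀ x y, |fε x - fε y| ≤ B * |x - y|)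
    (hL' : ∀ x y, |deriv fε x - deriv fε y| ≤ B * |x - y|) (hαβ : α ≤ β)
    (hg : ∀ v ∈ Set.Icc α β, M.IsWeightedDensity v (g v))
    (hgi : ∀ v ∈ Set.Icc α β, Integrable (g v) (P.map (M.ε 0))) :
    IsLittleOP P (fun n ω => ⨆ v ∈ Set.Icc α β, ‖M.remainder K b fε fX g n v ω -
      empProc (P.map (M.ε 0)) M.ε n
        (fun y => smoothing (kernelMeasure K) (b n) (g v) y - g v y) ω‖ₑ) := by
  intro η hη
  have hν := M.isIIDNoise.isProbabilityMeasure
  obtain ⟨C, a, hnd⟩ := M.exists_isNoiseDriven h_memory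
  have hB0 : 0 ≤ B := (abs_nonneg _).trans (hB 0)
  obtain ⟨Q, hQ0, hQ⟩ := exists_measure_iSup_degenerate_gt_le hnd hK hγ hB0
    (measure_le_of_density_le hfε fun x => (le_abs_self _).trans (hB x)) hαβ
  obtain ⟨ℓ, hℓ1, hℓ2, hℓ3⟩ := exists_block_length hb hδ₀ hb_lower hb_upper hnd.rate_pos
    hnd.rate_lt_one
  -- The condition on the pairs near the diagonal is the square root of `hℓ2`.
  have hℓ4 : Tendsto (fun n : ℕ => Q * ((ℓ n : ℝ) / (√(n : ℝ) * b n))) atTop (𝓝 0) := by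
    have h1 := (Real.continuous_sqrt.tendsto' 0 0 Real.sqrt_zero).comp hℓ2
    have h2 := h1.const_mul Q
    rw [mul_zero] at h2
    refine h2.congr fun n => ?_
    simp only [Function.comp_apply]
    rw [Real.sqrt_div (by positivity), Real.sqrt_sq (by positivity), Real.sqrt_mul (by positivity),
      Real.sqrt_sq (hb n).le]
  -- The normalized bias is of order `√n b² = √(n b⁴)`.
  have hbias : Tendsto (fun n : ℕ => γ⁻¹ * B * √((n : ℝ) * b n ^ 4)) atTop (𝓝 0) := by
    have h1 := (Real.continuous_sqrt.tendsto' 0 0 Real.sqrt_zero).comp hb_upper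
    simpa [Function.comp_def] using h1.const_mul (γ⁻¹ * B)
  have hlim : Tendsto (fun n : ℕ => ENNReal.ofReal (Q * (√(n : ℝ) * (b n ^ 2)⁻¹ * a ^ ℓ n / (η / 2) +
      (ℓ n : ℝ) ^ 2 / (n * b n ^ 2) / (η / 2) ^ 2))) atTop (𝓝 0) := by
    have h1 := (((hℓ3.div_const (η / 2)).add (hℓ2.div_const ((η / 2) ^ 2))).const_mul Q)
    simp only [zero_div, add_zero, mul_zero] at h1
    simpa using ENNReal.tendsto_ofReal h1
  refine tendsto_of_tendsto_of_tendsto_of_le_of_le' tendsto_const_nhds hlim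
    (Eventually.of_forall fun n => zero_le) ?_
  filter_upwards [eventually_ge_atTop 1,
    (tendsto_bandwidth_zero hb hb_upper).eventually_le_const one_pos,
    hℓ4.eventually_le_const (half_pos hη), hbias.eventually_le_const (half_pos hη)]
    with n hn hbn hℓn hbiasn
  refine (measure_mono_ae ?_).trans (hQ n (ℓ n) (b n) (η / 2) hn (hℓ1 n hn) (hb n) hbn
    (half_pos hη) hℓn)
  filter_upwards [M.ae_remainder_eq hγ hvol hK hb hfε hfX hfX_cont hB hL hg hgi] with ω hω hlt
  have hlt' : ENNReal.ofReal η < ⨆ v ∈ Set.Icc α β, ‖M.remainder K b fε fX g n v ω -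
      empProc (P.map (M.ε 0)) M.ε n
        (fun y => smoothing (kernelMeasure K) (b n) (g v) y - g v y) ω‖ₑ := hlt
  show ENNReal.ofReal (η / 2) < _
  obtain ⟨v, hv⟩ := lt_iSup_iff.1 hlt'
  obtain ⟨hvI, hv⟩ := lt_iSup_iff.1 hv
  refine lt_iSup_iff.2 ⟨v, lt_iSup_iff.2 ⟨hvI, ?_⟩⟩
  rw [hω n hn v hvI, Real.enorm_eq_ofReal_abs, ENNReal.ofReal_lt_ofReal_iff_of_nonneg hη.le] at hv
  rw [Real.enorm_eq_ofReal_abs, ENNReal.ofReal_lt_ofReal_iff_of_nonneg (half_pos hη).le]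
  have hbias2 : |(√(n : ℝ))⁻¹ * ∑ i ∈ Finset.Icc 1 n,
      (∫ y, pairKernel γ K (b n) v (M.state i ω) y ∂(P.map (M.ε 0)) -
        scaled γ 1 fε v (M.state i ω))| ≤ η / 2 := by
    refine le_trans ?_ hbiasn
    rw [abs_mul, abs_of_nonneg (by positivity : 0 ≤ (√(n : ℝ))⁻¹)]
    have hsum := (Finset.abs_sum_le_sum_abs (fun i : ℕ =>
      ∫ y, pairKernel γ K (b n) v (M.state i ω) y ∂(P.map (M.ε 0)) -
        scaled γ 1 fε v (M.state i ω)) (Finset.Icc 1 n)).trans (Finset.sum_le_sum fun i _ =>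
      abs_integral_pairKernel_sub_le hK hfε hB hd hL' hγ (hb n) v (M.state i ω))
    rw [Finset.sum_const, Nat.card_Icc, Nat.add_sub_cancel, nsmul_eq_mul] at hsum
    have hn0 : (0 : ℝ) < n := by exact_mod_cast hn
    have e : √((n : ℝ) * b n ^ 4) = √(n : ℝ) * b n ^ 2 := by
      rw [Real.sqrt_mul hn0.le, show b n ^ 4 = (b n ^ 2) ^ 2 by ring, Real.sqrt_sq (by positivity)]
    rw [e]
    calc _ ≤ (√(n : ℝ))⁻¹ * (n * (γ⁻¹ * (B * b n ^ 2))) := by gcongr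
      _ = ((√(n : ℝ))⁻¹ * n) * (γ⁻¹ * (B * b n ^ 2)) := by ring
      _ = _ := by
        have : (√(n : ℝ))⁻¹ * n = √(n : ℝ) := by
          rw [inv_mul_eq_div, Real.div_sqrt]
        rw [this]; ring
  have := (hv.trans_le (abs_add_le _ _))
  linarith

end LocationScaleModel

/-! ### Stochastic orders and boundedness of the leading terms -/

section StochasticOrder

variable {Ω : Type*} [MeasurableSpace Ω] {P : Measure Ω} {X Y Z : ℕ → Ω → ℝ≥0∞}

lemma measure_gt_le_add_of_le_add {x y z : Ω → ℝ≥0∞} (h : ∀ᵐ ω ∂P, z ω ≤ x ω + y ω) {c c' : ℝ}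
    (hc : 0 ≤ c) (hc' : 0 ≤ c') :
    P {ω | ENNReal.ofReal (c + c') < z ω} ≤
      P {ω | ENNReal.ofReal c < x ω} + P {ω | ENNReal.ofReal c' < y ω} := by
  refine (measure_mono_ae ?_).trans (measure_union_le _ _)
  filter_upwards [h] with ω hω hlt
  have hlt' : ENNReal.ofReal (c + c') < z ω := hlt
  by_contra hcon
  have h1 : ¬ (ENNReal.ofReal c < x ω ∨ ENNReal.ofReal c' < y ω) := hcon
  rw [not_or, not_lt, not_lt] at h1
  rw [ENNReal.ofReal_add hc hc'] at hlt'
  exact absurd (hlt'.trans_le (hω.trans (add_le_add h1.1 h1.2))) (lt_irrefl _)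

lemma IsLittleOP.of_le_add (hX : IsLittleOP P X) (hY : IsLittleOP P Y)
    (h : ∀ n, ∀ᵐ ω ∂P, Z n ω ≤ X n ω + Y n ω) : IsLittleOP P Z := by
  intro η hη
  have h1 := (hX (η / 2) (half_pos hη)).add (hY (η / 2) (half_pos hη))
  rw [add_zero] at h1
  refine tendsto_of_tendsto_of_tendsto_of_le_of_le tendsto_const_nhds h1 (fun n => zero_le)
    fun n => ?_
  have := measure_gt_le_add_of_le_add (h n) (half_pos hη).le (half_pos hη).le
  rwa [add_halves] at this

lemma IsBigOP.of_le_add (hX : IsBigOP P X) (hY : IsBigOP P Y)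
    (h : ∀ n, ∀ᵐ ω ∂P, Z n ω ≤ X n ω + Y n ω) : IsBigOP P Z := by
  intro η hη
  obtain ⟨c, hc⟩ := hX (η / 2) (half_pos hη)
  obtain ⟨c', hc'⟩ := hY (η / 2) (half_pos hη)
  refine ⟨max c 0 + max c' 0, ?_⟩
  filter_upwards [hc, hc'] with n h1 h2
  refine (measure_gt_le_add_of_le_add (h n) (le_max_right _ _) (le_max_right _ _)).trans ?_
  rw [← add_halves η, ENNReal.ofReal_add (half_pos hη).le (half_pos hη).le]
  simp only [ENNReal.ofReal_max, ENNReal.ofReal_zero, zero_le, max_eq_left]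
  exact add_le_add h1 h2

lemma IsLittleOP.isBigOP (hX : IsLittleOP P X) : IsBigOP P X := fun η hη =>
  ⟨1, (hX 1 one_pos).eventually_le_const (by simpa using hη)⟩

lemma isBigOP_of_measure_le {Q : ℝ}
    (h : ∀ n c, 0 < c → P {ω | ENNReal.ofReal c < X n ω} ≤ ENNReal.ofReal (Q / c ^ 2)) :
    IsBigOP P X := by
  intro η hη
  have hs : 0 < √((|Q| + 1) / η) := Real.sqrt_pos.2 (by positivity)
  refine ⟨√((|Q| + 1) / η), Eventually.of_forall fun n => (h n _ hs).trans ?_⟩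
  refine ENNReal.ofReal_le_ofReal ?_
  rw [Real.sq_sqrt (by positivity), div_le_iff₀ (by positivity), mul_div_cancel₀ _ hη.ne']
  linarith [le_abs_self Q]

end StochasticOrder

section Empirical

variable {Ω : Type*} [MeasurableSpace Ω] {P : Measure Ω} [IsProbabilityMeasure P] {ν : Measure ℝ}
  {ε : ℤ → Ω → ℝ}

/-- Chebyshev's inequality for the empirical process. -/
lemma measure_enorm_empProc_gt_le (h : IsIIDNoise P ν ε) {φ : ℝ → ℝ} (hφ : Measurable φ)
    (n : ℕ) {c : ℝ} (hc : 0 < c) :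
    P {ω | ENNReal.ofReal c < ‖empProc ν ε n φ ω‖ₑ} ≤
      (∫⁻ x, ‖φ x‖ₑ ^ 2 ∂ν) / ENNReal.ofReal (c ^ 2) := by
  rcases eq_or_ne (∫⁻ x, ‖φ x‖ₑ ^ 2 ∂ν) ∞ with htop | htop
  · rw [htop, ENNReal.top_div_of_ne_top ENNReal.ofReal_ne_top]
    exact le_top
  have hφ2 : MemLp φ 2 ν := by
    refine ⟨hφ.aestronglyMeasurable, ?_⟩
    rw [eLpNorm_lt_top_iff_lintegral_rpow_enorm_lt_top (by norm_num) (by norm_num)]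
    simpa using lt_top_iff_ne_top.2 htop
  have h1 := measure_abs_gt_le (memLp_empProc h hφ hφ2 n) hc
  have h2 : {ω | ENNReal.ofReal c < ‖empProc ν ε n φ ω‖ₑ} = {ω | c < |empProc ν ε n φ ω|} := by
    ext ω
    simp only [Set.mem_ofPred_eq]
    rw [Real.enorm_eq_ofReal_abs, ENNReal.ofReal_lt_ofReal_iff_of_nonneg hc.le]
  have h3 : ∫⁻ x, ‖φ x‖ₑ ^ 2 ∂ν = ENNReal.ofReal (∫ x, φ x ^ 2 ∂ν) := by
    rw [ofReal_integral_eq_lintegral_ofReal hφ2.integrable_sq (ae_of_all _ fun x => sq_nonneg _)]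
    refine lintegral_congr fun x => ?_
    rw [Real.enorm_eq_ofReal_abs, ← ENNReal.ofReal_pow (abs_nonneg _), sq_abs]
  rw [h2, h3, ← ENNReal.ofReal_div_of_pos (by positivity)]
  refine h1.trans (ENNReal.ofReal_le_ofReal ?_)
  gcongr
  exact integral_sq_empProc_le h hφ hφ2 n

lemma isLittleOP_empProc (h : IsIIDNoise P ν ε) {φ : ℕ → ℝ → ℝ} (hφ : ∀ n, Measurable (φ n))
    (hlim : Tendsto (fun n => ∫⁻ x, ‖φ n x‖ₑ ^ 2 ∂ν) atTop (𝓝 0)) :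
    IsLittleOP P (fun n ω => ‖empProc ν ε n (φ n) ω‖ₑ) := by
  intro η hη
  have h1 := ENNReal.Tendsto.div_const hlim (b := ENNReal.ofReal (η ^ 2))
    (Or.inr (by simpa using by positivity))
  rw [ENNReal.zero_div] at h1
  exact tendsto_of_tendsto_of_tendsto_of_le_of_le tendsto_const_nhds h1 (fun n => zero_le)
    fun n => measure_enorm_empProc_gt_le h (hφ n) n hη

lemma isBigOP_empProc (h : IsIIDNoise P ν ε) {φ : ℝ → ℝ} (hφ : Measurable φ)
    (hφ2 : ∫⁻ x, ‖φ x‖ₑ ^ 2 ∂ν < ∞) :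
    IsBigOP P (fun n ω => ‖empProc ν ε n φ ω‖ₑ) := by
  refine isBigOP_of_measure_le (Q := (∫⁻ x, ‖φ x‖ₑ ^ 2 ∂ν).toReal) fun n c hc => ?_
  rw [ENNReal.ofReal_div_of_pos (by positivity), ENNReal.ofReal_toReal hφ2.ne]
  exact measure_enorm_empProc_gt_le h hφ n hc

end Empirical

/-- The normalized sums of the conditional densities are uniformly bounded in probability. -/
lemma IsNoiseDriven.isBigOP_iSup_sum_scaled {Ω : Type*} [MeasurableSpace Ω] {P : Measure Ω}
    [IsProbabilityMeasure P] {ν : Measure ℝ} {ε : ℤ → Ω → ℝ} {Z : ℤ → Ω → ℝ × ℝ} {C a : ℝ}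
    (h : IsNoiseDriven P ν ε Z C a) {γ : ℝ} (hγ : 0 < γ) {f : ℝ → ℝ} {B : ℝ}
    (hB : ∀ x, |f x| ≤ B) (hd : Differentiable ℝ f) (hB' : ∀ x, |deriv f x| ≤ B)
    (hL' : ∀ x y, |deriv f x - deriv f y| ≤ B * |x - y|) {α β : ℝ} (hαβ : α ≤ β) :
    IsBigOP P (fun n ω => ⨆ v ∈ Set.Icc α β, ‖(√(n : ℝ))⁻¹ * ∑ i ∈ Finset.Icc 1 n,
      (scaled γ 1 f v (Z i ω) - ∫ z, scaled γ 1 f v z ∂(P.map (Z 0)))‖ₑ) := by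
  have hπ := h.isProbabilityMeasure_map 0
  have hB0 : 0 ≤ B := (abs_nonneg _).trans (hB 0)
  have hL := abs_sub_le_of_abs_deriv_le hd hB'
  have ha := h.rate_pos
  have ha1 := sub_pos.2 h.rate_lt_one
  have hC := h.nonneg
  obtain ⟨C₁, hC₁, h1⟩ := exists_abs_scaled_sub_le_gap hγ 1 (|α| + |β|)
  obtain ⟨C₂, hC₂, h2⟩ := exists_abs_scaled_increment_sub_le_gap hγ (|α| + |β|)
  have hV : ∀ v ∈ Set.Icc α β, |v| ≤ |α| + |β| := fun v hv => by
    refine abs_le.2 ⟨?_, ?_⟩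
    · linarith [hv.1, neg_abs_le α, abs_nonneg β]
    · linarith [hv.2, le_abs_self β, abs_nonneg α]
  have hm : ∀ v, Measurable (scaled γ 1 f v) := measurable_scaled γ 1 hd.continuous.measurable
  have hγi : 0 < γ⁻¹ := inv_pos.2 hγ
  set G := 4 + 4 * C * (a / (1 - a)) with hG
  have hG0 : 0 ≤ G := by positivity
  -- The variance bound requires one constant that is both a bound of the function and a Lipschitz
  -- constant for `gap`; hence the sums. For increments it carries the factor `|v - w|`, so their
  -- second moments are of order `|v - w|²`.
  set D₁ := γ⁻¹ * B + C₁ * (B + B) with hD₁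
  set D₂ := γ⁻¹ ^ 2 * B + C₂ * B with hD₂
  have hint : ∀ v, Integrable (scaled γ 1 f v) (P.map (Z 0)) := fun v =>
    integrable_of_abs_le (hm v) (abs_scaled_le hγ 1 hB v)
  have hnorm : ∀ (n : ℕ) (u : ℝ), 0 ≤ u → (√(n : ℝ))⁻¹ ^ 2 * (n * u) ≤ u := fun n u hu => by
    rcases Nat.eq_zero_or_pos n with rfl | hn
    · simpa using hu
    · have : (0 : ℝ) < n := by exact_mod_cast hn
      rw [inv_pow, Real.sq_sqrt this.le, inv_mul_cancel_left₀ this.ne']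
  refine isBigOP_of_measure_le (Q := 4 * (D₁ ^ 2 * G + 1 * (D₂ ^ 2 * G) * (β - α) ^ 2 / 2 +
    2 * (D₁ ^ 2 * G) / 1)) fun n c hc => ?_
  rw [mul_div_right_comm]
  set S : ℝ → Ω → ℝ := fun v ω => (√(n : ℝ))⁻¹ * ∑ i ∈ Finset.Icc 1 n,
    (scaled γ 1 f v (Z i ω) - ∫ z, scaled γ 1 f v z ∂(P.map (Z 0))) with hS
  have hSbd : ∀ v, Measurable (S v) := fun v => by
    have hmZ : ∀ i : ℕ, Measurable fun ω => scaled γ 1 f v (Z i ω) := fun i =>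
      (hm v).comp (h.measurable i)
    exact (Finset.measurable_fun_sum _ fun i _ => (hmZ i).sub_const _).const_mul _
  have hinc : ∀ v w ω, S v ω - S w ω = (√(n : ℝ))⁻¹ * ∑ i ∈ Finset.Icc 1 n,
      ((scaled γ 1 f v (Z i ω) - scaled γ 1 f w (Z i ω)) -
        ∫ z, (scaled γ 1 f v z - scaled γ 1 f w z) ∂(P.map (Z 0))) := fun v w ω => by
    simp only [hS]
    rw [← mul_sub, ← Finset.sum_sub_distrib, integral_sub (hint v) (hint w)]
    congr 1
    exact Finset.sum_congr rfl fun i _ => by ring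
  -- Here no bandwidth enters, so values and difference quotients are both of order one and `τ = 1`
  -- suffices.
  refine measure_iSup_gt_le (Λ := (√(n : ℝ))⁻¹ * (n * (2 * (γ⁻¹ ^ 2 * B)))) hαβ one_pos hc
    (fun v _ => ?_) (fun v hv => ?_) (fun v hv w hw => ?_) (fun ω v hv w hw => ?_)
  · refine memLp_of_abs_le (hSbd v) (B := (√(n : ℝ))⁻¹ * (n * (2 * (γ⁻¹ ^ 1 * B)))) (fun ω => ?_) 2
    rw [hS, abs_mul, abs_of_nonneg (by positivity : 0 ≤ (√(n : ℝ))⁻¹)]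
    have := (Finset.abs_sum_le_sum_abs (fun i : ℕ => scaled γ 1 f v (Z i ω) -
      ∫ z, scaled γ 1 f v z ∂(P.map (Z 0))) (Finset.Icc 1 n)).trans
      (Finset.sum_le_card_nsmul _ _ (2 * (γ⁻¹ ^ 1 * B)) fun i _ => by
        have e1 := abs_scaled_le hγ 1 hB v (Z i ω)
        have e2 : |∫ z, scaled γ 1 f v z ∂(P.map (Z 0))| ≤ γ⁻¹ ^ 1 * B :=
          abs_integral_le_of_abs_le (abs_scaled_le hγ 1 hB v)
        exact (abs_sub _ _).trans (by linarith))
    rw [Nat.card_Icc, Nat.add_sub_cancel, nsmul_eq_mul] at this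
    gcongr
  · have := h.integral_sq_sum_le (hm v) (B := D₁) (fun z => by
      have := abs_scaled_le hγ 1 hB v z
      rw [pow_one] at this
      have : 0 ≤ C₁ * (B + B) := by positivity
      linarith) (fun z z' => by
      refine (h1 f B B hB hL v (hV v hv) z z').trans ?_
      have := gap_nonneg z z'
      gcongr
      have : 0 ≤ γ⁻¹ * B := by positivity
      linarith) n
    simp only [mul_pow]
    rw [integral_const_mul]
    refine le_trans (mul_le_mul_of_nonneg_left this (by positivity)) (hnorm n _ (by positivity))
  · have := h.integral_sq_sum_le ((hm v).sub (hm w)) (B := D₂ * |v - w|) (fun z => by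
      refine (abs_scaled_sub_le hγ 1 hL v w z).trans ?_
      have : 0 ≤ C₂ * B := by positivity
      refine mul_le_mul_of_nonneg_right ?_ (abs_nonneg _)
      rw [hD₂]
      linarith) (fun z z' => by
      refine (h2 f B hd hB' hL' v w (hV v hv) (hV w hw) z z').trans ?_
      have := gap_nonneg z z'
      gcongr
      have : 0 ≤ γ⁻¹ ^ 2 * B := by positivity
      linarith) n
    rw [integral_congr_ae (ae_of_all P fun ω => by rw [hinc v w ω, mul_pow]), integral_const_mul]
    refine le_trans (mul_le_mul_of_nonneg_left this (by positivity))
      ((hnorm n _ (by positivity)).trans (le_of_eq ?_))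
    rw [mul_pow, sq_abs]
    ring
  · rw [hinc, abs_mul, abs_of_nonneg (by positivity : 0 ≤ (√(n : ℝ))⁻¹)]
    have := (Finset.abs_sum_le_sum_abs (fun i : ℕ =>
      ((scaled γ 1 f v (Z i ω) - scaled γ 1 f w (Z i ω)) -
        ∫ z, (scaled γ 1 f v z - scaled γ 1 f w z) ∂(P.map (Z 0)))) (Finset.Icc 1 n)).trans
      (Finset.sum_le_card_nsmul _ _ (2 * (γ⁻¹ ^ 2 * B * |v - w|)) fun i _ => by
        have e1 := abs_scaled_sub_le hγ 1 hL v w (Z i ω)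
        have e2 : |∫ z, (scaled γ 1 f v z - scaled γ 1 f w z) ∂(P.map (Z 0))| ≤
            γ⁻¹ ^ (1 + 1) * B * |v - w| :=
          abs_integral_le_of_abs_le (abs_scaled_sub_le hγ 1 hL v w)
        norm_num at e1 e2
        refine (abs_sub _ _).trans ?_
        norm_num
        linarith)
    rw [Nat.card_Icc, Nat.add_sub_cancel, nsmul_eq_mul] at this
    calc _ ≤ (√(n : ℝ))⁻¹ * (n * (2 * (γ⁻¹ ^ 2 * B * |v - w|))) := by gcongr
      _ = _ := by ring

/-! ### From finite nets to uniform statements -/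

section FiniteNet

variable {Ω : Type*} [MeasurableSpace Ω] {P : Measure Ω} {ι : Type*}

lemma IsLittleOP.sum {Z : ι → ℕ → Ω → ℝ≥0∞} (s : Finset ι) (h : ∀ v ∈ s, IsLittleOP P (Z v)) :
    IsLittleOP P (fun n ω => ∑ v ∈ s, Z v n ω) := by
  classical
  induction s using Finset.induction_on with
  | empty => intro η hη; simp
  | insert v s hv ih =>
    refine IsLittleOP.of_le_add (h v (Finset.mem_insert_self v s))
      (ih fun u hu => h u (Finset.mem_insert_of_mem hu)) fun n => ae_of_all _ fun ω => ?_
    rw [Finset.sum_insert hv]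

lemma IsBigOP.sum {Z : ι → ℕ → Ω → ℝ≥0∞} (s : Finset ι) (h : ∀ v ∈ s, IsBigOP P (Z v)) :
    IsBigOP P (fun n ω => ∑ v ∈ s, Z v n ω) := by
  classical
  induction s using Finset.induction_on with
  | empty => intro η hη; exact ⟨0, by simp⟩
  | insert v s hv ih =>
    refine IsBigOP.of_le_add (h v (Finset.mem_insert_self v s))
      (ih fun u hu => h u (Finset.mem_insert_of_mem hu)) fun n => ae_of_all _ fun ω => ?_
    rw [Finset.sum_insert hv]

variable {Y : ℕ → ι → Ω → ℝ}

lemma iSup_enorm_le_add_sum {y : ι → ℝ} {π : ι → ι} (hfin : (Set.range π).Finite) :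
    ⨆ v, ‖y v‖ₑ ≤ (⨆ v, ‖y v - y (π v)‖ₑ) + ∑ u ∈ hfin.toFinset, ‖y u‖ₑ := by
  refine iSup_le fun v => ?_
  have h1 : ‖y v‖ₑ ≤ ‖y v - y (π v)‖ₑ + ‖y (π v)‖ₑ := by
    simpa using enorm_add_le (y v - y (π v)) (y (π v))
  refine h1.trans (add_le_add (le_iSup (fun v => ‖y v - y (π v)‖ₑ) v) ?_)
  exact Finset.single_le_sum (f := fun u => ‖y u‖ₑ) (fun _ _ => zero_le)
    (hfin.mem_toFinset.2 (Set.mem_range_self v))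

lemma measure_iSup_enorm_gt_le {y : ι → Ω → ℝ} {η c : ℝ} (hη : 0 ≤ η) (hc : η ≤ c) :
    P {ω | ENNReal.ofReal c < ⨆ v, ‖y v ω‖ₑ} ≤ P {ω | ∃ v, η < |y v ω|} := by
  refine measure_mono fun ω hω => ?_
  obtain ⟨v, hv⟩ := lt_iSup_iff.1 (show ENNReal.ofReal c < ⨆ v, ‖y v ω‖ₑ from hω)
  rw [Real.enorm_eq_ofReal_abs, ENNReal.ofReal_lt_ofReal_iff_of_nonneg (hη.trans hc)] at hv
  exact ⟨v, hc.trans_lt hv⟩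

/-- Pointwise convergence in probability is uniform under asymptotic equicontinuity. -/
lemma isLittleOP_iSup_of_equicontinuity
    (hp : ∀ v, IsLittleOP P (fun n ω => ‖Y n v ω‖ₑ))
    (heq : ∀ η : ℝ, 0 < η → ∃ π : ι → ι, (Set.range π).Finite ∧ ∀ᶠ n in atTop,
      P {ω | ∃ v, η < |Y n v ω - Y n (π v) ω|} ≤ ENNReal.ofReal η) :
    IsLittleOP P (fun n ω => ⨆ v, ‖Y n v ω‖ₑ) := by
  intro η hη
  rw [ENNReal.tendsto_nhds_zero]
  intro e he
  obtain ⟨e', he', hee⟩ : ∃ e' : ℝ, 0 < e' ∧ ENNReal.ofReal e' + ENNReal.ofReal e' ≤ e := by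
    rcases eq_or_ne e ∞ with rfl | htop
    · exact ⟨1, one_pos, le_top⟩
    · have := ENNReal.toReal_pos he.ne' htop
      refine ⟨e.toReal / 2, half_pos this, ?_⟩
      rw [← ENNReal.ofReal_add (half_pos this).le (half_pos this).le, add_halves,
        ENNReal.ofReal_toReal htop]
  -- Equicontinuity has a single parameter for threshold and probability; the minimum makes it serve
  -- both.
  obtain ⟨π, hfin, hπ⟩ := heq (min (η / 2) e') (lt_min (half_pos hη) he')
  have hsum := IsLittleOP.sum (P := P) hfin.toFinset fun v _ => hp v
  filter_upwards [hπ, (hsum (η / 2) (half_pos hη)).eventually_le_const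
    (ENNReal.ofReal_pos.2 he')] with n h1 h2
  have h3 := measure_gt_le_add_of_le_add (P := P) (ae_of_all _ fun ω =>
    iSup_enorm_le_add_sum (y := fun v => Y n v ω) hfin) (half_pos hη).le (half_pos hη).le
  rw [add_halves] at h3
  refine h3.trans ((add_le_add ?_ h2).trans hee)
  refine (measure_iSup_enorm_gt_le (y := fun v ω => Y n v ω - Y n (π v) ω)
    (lt_min (half_pos hη) he').le (min_le_left _ _)).trans (h1.trans ?_)
  exact ENNReal.ofReal_le_ofReal (min_le_right _ _)

lemma isBigOP_iSup_of_equicontinuity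
    (hp : ∀ v, IsBigOP P (fun n ω => ‖Y n v ω‖ₑ))
    (heq : ∀ η : ℝ, 0 < η → ∃ π : ι → ι, (Set.range π).Finite ∧ ∀ᶠ n in atTop,
      P {ω | ∃ v, η < |Y n v ω - Y n (π v) ω|} ≤ ENNReal.ofReal η) :
    IsBigOP P (fun n ω => ⨆ v, ‖Y n v ω‖ₑ) := by
  intro η hη
  have hη2 : 0 < min 1 (η / 2) := lt_min one_pos (half_pos hη)
  obtain ⟨π, hfin, hπ⟩ := heq _ hη2
  obtain ⟨c, hc⟩ := IsBigOP.sum (P := P) hfin.toFinset (fun v _ => hp v) (η / 2) (half_pos hη)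
  refine ⟨1 + max c 0, ?_⟩
  filter_upwards [hπ, hc] with n h1 h2
  have h3 := measure_gt_le_add_of_le_add (P := P) (ae_of_all _ fun ω =>
    iSup_enorm_le_add_sum (y := fun v => Y n v ω) hfin) zero_le_one (le_max_right c 0)
  refine h3.trans ?_
  rw [← add_halves η, ENNReal.ofReal_add (half_pos hη).le (half_pos hη).le]
  refine add_le_add ?_ ?_
  · refine (measure_iSup_enorm_gt_le (y := fun v ω => Y n v ω - Y n (π v) ω)
      hη2.le (min_le_left _ _)).trans (h1.trans ?_)
    exact ENNReal.ofReal_le_ofReal (min_le_right _ _)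
  · simpa only [ENNReal.ofReal_max, ENNReal.ofReal_zero, zero_le, max_eq_left] using h2

end FiniteNet

/-! ### Nets from bracketing numbers and equicontinuity of the two processes -/

/-- An almost everywhere measurable function has a measurable majorant that agrees with it almost
everywhere. -/
lemma exists_measurable_ge_ae_eq {E : Type*} [MeasurableSpace E] {μ : Measure E} {u : E → ℝ≥0∞}
    (hu : AEMeasurable u μ) : ∃ w : E → ℝ≥0∞, Measurable w ∧ (∀ x, u x ≤ w x) ∧ w =ᵐ[μ] u := by
  set S := toMeasurable μ {x | u x ≠ hu.mk u x} with hS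
  have hS0 : μ S = 0 := by
    rw [hS, measure_toMeasurable]
    exact hu.ae_eq_mk
  have hSm : MeasurableSet S := measurableSet_toMeasurable _ _
  refine ⟨hu.mk u + S.indicator fun _ => ∞, hu.measurable_mk.add (measurable_const.indicator hSm),
    fun x => ?_, ?_⟩
  · by_cases hx : x ∈ S
    · simp [hx]
    · have : u x = hu.mk u x := by
        by_contra hne
        exact hx (subset_toMeasurable _ _ hne)
      simp [hx, this]
  · have h1 : ∀ᵐ x ∂μ, x ∉ S := measure_eq_zero_iff_ae_notMem.1 hS0
    filter_upwards [h1, hu.ae_eq_mk] with x hx hx'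
    simp [hx, hx']

lemma exists_brackets_of_bracketingNumber_le {μ : Measure ℝ} {𝓕 : Set (ℝ → ℝ)} {r x : ℝ}
    (hx : 0 ≤ x) (h : (bracketingNumber μ 𝓕 r : ℝ≥0∞) ≤ ENNReal.ofReal x) :
    ∃ (N : ℕ) (l u : Fin N → ℝ → ℝ), (N : ℝ) ≤ x ∧ (∀ k, IsBracket μ r (l k) (u k)) ∧
      ∀ f ∈ 𝓕, ∃ k, ∀ x, l k x ≤ f x ∧ f x ≤ u k x := by
  have hne : bracketingNumber μ 𝓕 r ≠ ⊤ := by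
    rintro htop
    rw [htop, ENat.toENNReal_top, top_le_iff] at h
    exact ENNReal.ofReal_ne_top h
  obtain ⟨m, hm⟩ := ENat.ne_top_iff_exists.1 hne
  have hlt : bracketingNumber μ 𝓕 r < ((m + 1 : ℕ) : ℕ∞) := by
    rw [← hm]; exact_mod_cast Nat.lt_succ_self m
  unfold bracketingNumber at hlt
  obtain ⟨N, hN⟩ := iInf_lt_iff.1 hlt
  obtain ⟨⟨l, u, hb, hc⟩, hN⟩ := iInf_lt_iff.1 hN
  refine ⟨N, l, u, ?_, hb, hc⟩
  have h1 : N ≤ m := Nat.lt_succ_iff.1 (by exact_mod_cast hN)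
  rw [← hm] at h
  have h2 : (m : ℝ) ≤ x := by
    have h3 : ENNReal.ofReal m ≤ ENNReal.ofReal x := by simpa using h
    exact (ENNReal.ofReal_le_ofReal_iff hx).1 h3
  exact (Nat.cast_le.2 h1).trans h2

/-- A finite net with measurable majorants of the distances to the net. -/
lemma exists_net_of_bracketingNumber_le {μ : Measure ℝ} {α β : ℝ} (hαβ : α ≤ β) {g : ℝ → ℝ → ℝ}
    {r x : ℝ} (hr : 0 < r) (hx : 0 ≤ x)
    (h : (bracketingNumber μ (g '' Set.Icc α β) r : ℝ≥0∞) ≤ ENNReal.ofReal x) :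
    ∃ (π : Set.Icc α β → Set.Icc α β) (w : Set.Icc α β → ℝ → ℝ≥0∞) (hfin : (Set.range π).Finite),
      (hfin.toFinset.card : ℝ) ≤ x ∧ (∀ v, Measurable (w v)) ∧
      (∀ (v : Set.Icc α β) y, ‖g v y - g (π v) y‖ₑ ≤ w (π v) y) ∧
      ∀ v, ∫⁻ y, w v y ^ 2 ∂μ ≤ ENNReal.ofReal (r ^ 2) := by
  obtain ⟨N, l, u, hN, hb, hc⟩ := exists_brackets_of_bracketingNumber_le hx h
  have hne : Nonempty (Set.Icc α β) := ⟨⟨α, le_rfl, hαβ⟩⟩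
  choose c hcl using fun v : Set.Icc α β => hc (g v) (Set.mem_image_of_mem g v.2)
  -- The bracket ends are measurable only up to null sets, whereas the width has to dominate at
  -- every point; the measurable majorant reconciles the two without changing the norm.
  choose G hG hGle hGae using fun k => exists_measurable_ge_ae_eq (μ := μ)
    ((hb k).2.1.sub (hb k).1).aestronglyMeasurable.enorm
  -- The net point is a representative lying in the same bracket as `v`. The two differ by at most
  -- the width, and that width is determined by the representative alone.
  have hcc : ∀ v, c (Function.invFun c (c v)) = c v := fun v => Function.invFun_eq ⟨v, rfl⟩
  have hsub : (Set.range fun v => Function.invFun c (c v)) ⊆ Set.range (Function.invFun c) := by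
    rintro _ ⟨v, rfl⟩
    exact Set.mem_range_self _
  have hfin := (Set.finite_range (Function.invFun c)).subset hsub
  refine ⟨fun v => Function.invFun c (c v), fun v => G (c v), hfin, ?_, fun v => hG _,
    fun v y => ?_, fun v => ?_⟩
  · refine le_trans (Nat.cast_le.2 ?_) hN
    have h1 : hfin.toFinset ⊆ Finset.univ.image (Function.invFun c) := fun v hv => by
      obtain ⟨k, hk⟩ := hsub (hfin.mem_toFinset.1 hv)
      exact Finset.mem_image.2 ⟨k, Finset.mem_univ k, hk⟩
    refine (Finset.card_le_card h1).trans (Finset.card_image_le.trans ?_)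
    simp
  · simp only [hcc]
    refine le_trans ?_ (hGle (c v) y)
    have h1 := hcl v y
    have h2 := hcl (Function.invFun c (c v)) y
    rw [hcc] at h2
    rw [Real.enorm_eq_ofReal_abs, Real.enorm_eq_ofReal_abs]
    refine ENNReal.ofReal_le_ofReal ?_
    rw [Pi.sub_apply]
    refine le_trans ?_ (le_abs_self _)
    rw [abs_le]
    constructor <;> linarith [h1.1, h1.2, h2.1, h2.2]
  · have h1 : ∫⁻ y, G (c v) y ^ 2 ∂μ = eLpNorm (u (c v) - l (c v)) 2 μ ^ 2 := by
      have h2 := eLpNorm_nnreal_pow_eq_lintegral (μ := μ) (f := u (c v) - l (c v)) (p := 2)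
        (by norm_num)
      simp only [ENNReal.coe_ofNat, NNReal.coe_ofNat, ENNReal.rpow_ofNat] at h2
      rw [h2]
      refine lintegral_congr_ae ?_
      filter_upwards [hGae (c v)] with y hy
      rw [hy]
    simp only
    rw [h1, ENNReal.ofReal_pow hr.le]
    gcongr
    exact (hb (c v)).2.2.2.le

/-- Dyadic nets of a family with polynomial bracketing numbers. -/
lemma HasPolynomialBracketing.exists_nets {μ : Measure ℝ} {α β : ℝ} {g : ℝ → ℝ → ℝ}
    (hαβ : α ≤ β) (h : HasPolynomialBracketing μ α β g) :
    ∃ (A D : ℝ) (π : ℕ → Set.Icc α β → Set.Icc α β) (w : ℕ → Set.Icc α β → ℝ → ℝ≥0∞)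
      (hfin : ∀ k, (Set.range (π k)).Finite), 1 ≤ A ∧ 1 ≤ D ∧
      (∀ k, ((hfin k).toFinset.card : ℝ) ≤ A * D ^ k) ∧ (∀ k v, Measurable (w k v)) ∧
      (∀ k (v : Set.Icc α β) y, ‖g v y - g (π k v) y‖ₑ ≤ w k (π k v) y) ∧
      ∀ k v, ∫⁻ y, w k v y ^ 2 ∂μ ≤ ENNReal.ofReal (((2⁻¹ : ℝ) ^ (k + 1)) ^ 2) := by
  obtain ⟨-, -, η, C, hη, hC, hN⟩ := h
  -- Half of the nominal radius `2⁻ᵏ` is used, since for smoothing errors the majorant is the sum of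
  -- a width and a smoothed width.
  have hr : ∀ k : ℕ, 0 < (2⁻¹ : ℝ) ^ (k + 1) := fun k => by positivity
  choose π w hfin hcard hw hdom hw2 using fun k : ℕ =>
    exists_net_of_bracketingNumber_le hαβ (hr k)
      (mul_nonneg hC.le (Real.rpow_nonneg (hr k).le (-η)))
      (hN _ (hr k) (pow_le_one₀ (by norm_num) (by norm_num)))
  refine ⟨max 1 (C * 2 ^ η), 2 ^ η, π, w, hfin, le_max_left _ _,
    Real.one_le_rpow (by norm_num) hη.le, fun k => (hcard k).trans ?_, hw, hdom, hw2⟩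
  have e : ((2⁻¹ : ℝ) ^ (k + 1)) ^ (-η) = 2 ^ η * (2 ^ η) ^ k := by
    rw [inv_pow, Real.inv_rpow (by positivity), Real.rpow_neg (by positivity), inv_inv, pow_succ',
      Real.mul_rpow (by norm_num) (by positivity), ← Real.rpow_natCast 2 k,
      ← Real.rpow_natCast (2 ^ η) k, ← Real.rpow_mul (by norm_num), ← Real.rpow_mul (by norm_num),
      mul_comm η]
  rw [e, ← mul_assoc]
  have : C * 2 ^ η ≤ max 1 (C * 2 ^ η) := le_max_right _ _
  gcongr

section Equicontinuity

variable {Ω : Type*} [MeasurableSpace Ω] {P : Measure Ω} [IsProbabilityMeasure P] {ν : Measure ℝ}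
  {ε : ℤ → Ω → ℝ} {fε : ℝ → ℝ} {α β s₀ : ℝ} {g : ℝ → ℝ → ℝ}

lemma exists_measurable_envelope {μ : Measure ℝ} (hg0 : ∀ v ∈ Set.Icc α β, ∀ x, 0 ≤ g v x)
    (h : HasPolynomialBracketing μ α β g) :
    ∃ (E : ℝ → ℝ≥0∞) (o Q : ℝ), Measurable E ∧ 0 < o ∧ 0 ≤ Q ∧
      (∀ v ∈ Set.Icc α β, ∀ x, ‖g v x‖ₑ ≤ E x) ∧ ∫⁻ x, E x ^ (2 + o) ∂μ = ENNReal.ofReal Q := by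
  obtain ⟨hm, ⟨o, ho, -, hfin⟩, -⟩ := h
  obtain ⟨E, hE, hle, hae⟩ := exists_measurable_ge_ae_eq hm
  refine ⟨E, o, (∫⁻ x, envelope α β g x ^ (2 + o) ∂μ).toReal, hE, ho, ENNReal.toReal_nonneg,
    fun v hv x => ?_, ?_⟩
  · rw [Real.enorm_eq_ofReal (hg0 v hv x)]
    exact (le_iSup₂_of_le (f := fun v _ => ENNReal.ofReal (g v x)) v hv le_rfl).trans (hle x)
  · rw [ENNReal.ofReal_toReal hfin.ne]
    refine lintegral_congr_ae ?_
    filter_upwards [hae] with x hx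
    rw [hx]

lemma exists_empProc_net (h : IsIIDNoise P ν ε) (hfε : IsDensity fε ν) (hs : 0 < s₀)
    (hαβ : α ≤ β) (hgm : ∀ v ∈ Set.Icc α β, Measurable (g v))
    (hg0 : ∀ v ∈ Set.Icc α β, ∀ x, 0 ≤ g v x)
    (hbr : HasPolynomialBracketing (supMeasure fε s₀) α β g) {η : ℝ} (hη : 0 < η) :
    ∃ π : Set.Icc α β → Set.Icc α β, (Set.range π).Finite ∧ ∀ᶠ n : ℕ in atTop,
      P {ω | ∃ v, η < |empProc ν ε n (g (v : Set.Icc α β)) ω - empProc ν ε n (g (π v)) ω|} ≤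
        ENNReal.ofReal η := by
  obtain ⟨A, D, π, w, hfin, hA, hD, hcard, hw, hdom, hw2⟩ := hbr.exists_nets hαβ
  obtain ⟨E, o, Q, hE, ho, hQ0, hgE, hEQ⟩ := exists_measurable_envelope hg0 hbr
  have hle := le_supMeasure hfε hs.le
  obtain ⟨k₀, hk₀⟩ := exists_empProc_equicontinuity h (f := fun _ (v : Set.Icc α β) => g v)
    (w := fun _ k v => w k v) (E := fun _ => E) (π := π) hA hD ho hQ0 (fun _ v => hgm v v.2)
    (fun _ k v => hw k v) (fun _ => hE) (fun _ v x => hgE v v.2 x)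
    (fun _ k v x _ => hdom k v x)
    (Eventually.of_forall fun n k v => (lintegral_mono' hle le_rfl).trans ((hw2 k _).trans
      (ENNReal.ofReal_le_ofReal (by
        have : (2⁻¹ : ℝ) ^ (k + 1) ≤ 2⁻¹ ^ k :=
          pow_le_pow_of_le_one (by norm_num) (by norm_num) (Nat.le_succ k)
        gcongr))))
    (Eventually.of_forall fun n => (lintegral_mono' hle le_rfl).trans hEQ.le) hfin hcard hη
  exact ⟨π k₀, hfin k₀, hk₀⟩

/-- The class varies with `n` but the net of the family `g` serves every large `n`: smoothing a
majorant of `g v - g (π k v)` majorizes the difference of the smoothed functions, and its `L²(ν)`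
norm is at most the `L²(μ)` norm of the original. The envelope is treated in the same way with
exponent `2 + o`. -/
lemma exists_empProc_smoothing_sub_net (h : IsIIDNoise P ν ε) (hfε : IsDensity fε ν) (hs : 0 < s₀)
    {ρ : Measure ℝ} [IsProbabilityMeasure ρ] (hρ : ∀ᵐ s ∂ρ, |s| ≤ 1)
    {b : ℕ → ℝ} (hb0 : ∀ n, 0 < b n) (hb : Tendsto b atTop (𝓝 0))
    (hαβ : α ≤ β) (hgm : ∀ v ∈ Set.Icc α β, Measurable (g v))
    (hg0 : ∀ v ∈ Set.Icc α β, ∀ x, 0 ≤ g v x)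
    (hbr : HasPolynomialBracketing (supMeasure fε s₀) α β g) {η : ℝ} (hη : 0 < η) :
    ∃ π : Set.Icc α β → Set.Icc α β, (Set.range π).Finite ∧ ∀ᶠ n : ℕ in atTop,
      P {ω | ∃ v, η < |empProc ν ε n (fun y => smoothing ρ (b n) (g (v : Set.Icc α β)) y - g v y) ω -
        empProc ν ε n (fun y => smoothing ρ (b n) (g (π v)) y - g (π v) y) ω|} ≤
        ENNReal.ofReal η := by
  have hν := h.isProbabilityMeasure
  obtain ⟨A, D, π, w, hfin, hA, hD, hcard, hw, hdom, hw2⟩ := hbr.exists_nets hαβ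
  obtain ⟨E, o, Q, hE, ho, hQ0, hgE, hEQ⟩ := exists_measurable_envelope hg0 hbr
  have hle := le_supMeasure hfε hs.le
  have hmono : ∀ {u u' : ℝ → ℝ≥0∞} (n : ℕ) (y : ℝ), (∀ x, u x ≤ u' x) →
      lsmoothing ρ (b n) u y ≤ lsmoothing ρ (b n) u' y :=
    fun n y huu => lintegral_mono fun s => huu _
  obtain ⟨k₀, hk₀⟩ := exists_empProc_equicontinuity h
    (f := fun n (v : Set.Icc α β) y => smoothing ρ (b n) (g v) y - g v y)
    (w := fun n k v y => lsmoothing ρ (b n) (w k v) y + w k v y)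
    (E := fun n y => lsmoothing ρ (b n) E y + E y) (π := π)
    (Q := 2 ^ (1 + o) * (2 * Q)) hA hD ho (by positivity)
    (fun n v => (measurable_smoothing (hgm v v.2)).sub (hgm v v.2))
    (fun n k v => (measurable_lsmoothing (hw k v)).add (hw k v))
    (fun n => (measurable_lsmoothing hE).add hE)
    (fun n v x => (enorm_sub_le).trans (add_le_add
      ((enorm_smoothing_le _ _).trans (hmono n x (hgE v v.2))) (hgE v v.2 x)))
    (fun n k v x _ => by
      rw [sub_sub_sub_comm]
      exact enorm_sub_le.trans (add_le_add ((enorm_smoothing_sub_le (hgm v v.2) (hgm _ (π k v).2)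
        x).trans (hmono n x (hdom k v))) (hdom k v x)))
    (by
      filter_upwards [hb.eventually_le_const hs] with n hn k v
      have m1 := (measurable_lsmoothing (ρ := ρ) (b := b n) (hw k (π k v))).pow_const 2
      have m2 := (hw k (π k v)).pow_const 2
      calc ∫⁻ x, (lsmoothing ρ (b n) (w k (π k v)) x + w k (π k v) x) ^ 2 ∂ν
          ≤ ∫⁻ x, 2 * (lsmoothing ρ (b n) (w k (π k v)) x ^ 2 + w k (π k v) x ^ 2) ∂ν :=
            lintegral_mono fun x => ennreal_add_sq_le _ _
        _ = 2 * (∫⁻ x, lsmoothing ρ (b n) (w k (π k v)) x ^ 2 ∂ν +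
              ∫⁻ x, w k (π k v) x ^ 2 ∂ν) := by
            rw [lintegral_const_mul' _ _ (by simp), lintegral_add_left m1]
        _ ≤ 2 * (ENNReal.ofReal (((2⁻¹ : ℝ) ^ (k + 1)) ^ 2) +
              ENNReal.ofReal (((2⁻¹ : ℝ) ^ (k + 1)) ^ 2)) := by
            gcongr
            · exact (lintegral_lsmoothing_sq_le hfε hρ (hb0 n).le hn (hw k _)).trans (hw2 k _)
            · exact (lintegral_mono' hle le_rfl).trans (hw2 k _)
        _ = _ := by
            rw [← ENNReal.ofReal_add (by positivity) (by positivity)]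
            rw [show (2 : ℝ≥0∞) = ENNReal.ofReal 2 by simp, ← ENNReal.ofReal_mul (by norm_num)]
            congr 1
            rw [pow_succ]
            ring)
    (by
      filter_upwards [hb.eventually_le_const hs] with n hn
      have m1 := (measurable_lsmoothing (ρ := ρ) (b := b n) hE).pow_const (2 + o)
      have m2 := hE.pow_const (2 + o)
      calc ∫⁻ x, (lsmoothing ρ (b n) E x + E x) ^ (2 + o) ∂ν
          ≤ ∫⁻ x, 2 ^ (1 + o) * (lsmoothing ρ (b n) E x ^ (2 + o) + E x ^ (2 + o)) ∂ν :=
            lintegral_mono fun x => by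
              have := ENNReal.rpow_add_le_mul_rpow_add_rpow (lsmoothing ρ (b n) E x) (E x)
                (p := 2 + o) (by linarith)
              rwa [show 2 + o - 1 = 1 + o by ring] at this
        _ = 2 ^ (1 + o) * (∫⁻ x, lsmoothing ρ (b n) E x ^ (2 + o) ∂ν +
              ∫⁻ x, E x ^ (2 + o) ∂ν) := by
            rw [lintegral_const_mul' _ _ (ENNReal.rpow_ne_top_of_nonneg (by linarith) (by simp)),
              lintegral_add_left m1]
        _ ≤ 2 ^ (1 + o) * (ENNReal.ofReal Q + ENNReal.ofReal Q) := by
            gcongr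
            · exact (lintegral_lsmoothing_rpow_le hfε hρ (hb0 n).le hn hE (by linarith)).trans
                hEQ.le
            · exact (lintegral_mono' hle le_rfl).trans hEQ.le
        _ = _ := by
            rw [← ENNReal.ofReal_add hQ0 hQ0, ← two_mul,
              ENNReal.ofReal_mul (p := 2 ^ (1 + o)) (by positivity), ← ENNReal.ofReal_rpow_of_pos (by norm_num)]
            simp)
    hfin hcard hη
  exact ⟨π k₀, hfin k₀, hk₀⟩

end Equicontinuity

/-! ### The leading term and the theorem -/

namespace LocationScaleModel

variable {Ω : Type*} [MeasurableSpace Ω] {P : Measure Ω} [IsProbabilityMeasure P] {d : ℕ}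
  (M : LocationScaleModel P d) {γ : ℝ} {fε fX : ℝ → ℝ} {g : ℝ → ℝ → ℝ}

/-- The leading term is an empirical process plus a normalized sum of conditional densities. -/
lemma ae_leadingTerm_eq (hγ : 0 < γ) (hvol : ∀ i : ℤ, ∀ᵐ ω ∂P, ∀ θ : M.Θ, γ ≤ M.vol i θ ω)
    (hfε : IsDensity fε (P.map (M.ε 0))) (hfX : IsDensity fX (P.map (M.X 0)))
    (hfX_cont : Continuous fX) {B L : ℝ} (hB : ∀ x, |fε x| ≤ B)
    (hL : ∀ x y, |fε x - fε y| ≤ L * |x - y|) {I : Set ℝ}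
    (hg : ∀ v ∈ I, M.IsWeightedDensity v (g v)) :
    ∀ᵐ ω ∂P, ∀ n : ℕ, ∀ v ∈ I, M.leadingTerm fε fX g n v ω =
      empProc (P.map (M.ε 0)) M.ε n (g v) ω + (√(n : ℝ))⁻¹ * ∑ i ∈ Finset.Icc 1 n,
        (scaled γ 1 fε v (M.state i ω) - ∫ z, scaled γ 1 fε v z ∂(P.map (M.state 0))) := by
  filter_upwards [M.ae_scaled_state_eq hγ hvol] with ω hω n v hv
  rw [← M.density_eq_integral_scaled hγ hvol hfε hfX hfX_cont hB hL v, empProc,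
    M.density_eq_integral_weightedDensity hγ hvol hfε hfX hfX_cont hB hL (hg v hv), leadingTerm,
    ← mul_add, ← Finset.sum_add_distrib]
  congr 1
  refine Finset.sum_congr rfl fun i _ => ?_
  rw [hω, ratio]
  ring

end LocationScaleModel

lemma enorm_le_enorm_sub_add_enorm (x y : ℝ) : ‖x‖ₑ ≤ ‖x - y‖ₑ + ‖y‖ₑ := by
  simpa using enorm_add_le (x - y) y

lemma biSup_enorm_le_add {I : Set ℝ} {x y z : ℝ → ℝ} (h : ∀ v ∈ I, x v = y v + z v) :
    ⨆ v ∈ I, ‖x v‖ₑ ≤ (⨆ v ∈ I, ‖y v‖ₑ) + ⨆ v ∈ I, ‖z v‖ₑ := by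
  refine iSup₂_le fun v hv => ?_
  rw [h v hv]
  exact (enorm_add_le _ _).trans (add_le_add
    (le_iSup₂_of_le (f := fun v _ => ‖y v‖ₑ) v hv le_rfl)
    (le_iSup₂_of_le (f := fun v _ => ‖z v‖ₑ) v hv le_rfl))

theorem theorem1 {Ω : Type*} [MeasurableSpace Ω] {P : Measure Ω} [IsProbabilityMeasure P] {d : ℕ}
    (M : LocationScaleModel P d)
    -- the noise density, and the (continuous) marginal density
    (fε fX : ℝ → ℝ) (hfε : IsDensity fε (P.map (M.ε 0)))
    (hfX : IsDensity fX (P.map (M.X 0))) (hfX_cont : Continuous fX)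
    -- the kernel and the bandwidth
    (K : ℝ → ℝ) (hK : IsKernel K)
    (b : ℕ → ℝ) (hb : ∀ n, 0 < b n) (δ : ℝ) (hδ₀ : 0 < δ) (hδ₁ : δ < 1)
    (hb_lower : Tendsto (fun n : ℕ => (n : ℝ) * b n ^ (2 + δ)) atTop atTop)
    (hb_upper : Tendsto (fun n : ℕ => (n : ℝ) * b n ^ 4) atTop (𝓝 0))
    -- the compact interval and the family of functions on it
    (α β : ℝ) (hαβ : α ≤ β) (s₀ : ℝ) (hs₀ : 0 < s₀) (g : ℝ → ℝ → ℝ)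
    (h_memory : M.ShortMemory) (h_smooth : IsSmoothBounded fε)
    (hg : IsSquareIntegrableFamily M fε α β s₀ g) :
    (∀ v ∈ Set.Icc α β,
      IsLittleOP P (fun n ω => ‖M.remainder K b fε fX g n v ω‖ₑ) ∧
      IsBigOP P (fun n ω => ‖√(n : ℝ) * (M.estimator K b n v ω - fX v)‖ₑ)) ∧
    (HasPolynomialBracketing (supMeasure fε s₀) α β g →
      IsLittleOP P (fun n ω => ⨆ v ∈ Set.Icc α β, ‖M.remainder K b fε fX g n v ω‖ₑ) ∧
      IsBigOP P (fun n ω => ENNReal.ofReal √(n : ℝ) *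
        ⨆ v ∈ Set.Icc α β, ‖M.estimator K b n v ω - fX v‖ₑ)) := by
  obtain ⟨γ, hγ, hvol, -⟩ := h_memory.1
  obtain ⟨hd, hd', B, hB⟩ := h_smooth
  have hB₀ : ∀ x, |fε x| ≤ B := fun x => (hB x).1
  have hB₁ : ∀ x, |deriv fε x| ≤ B := fun x => (hB x).2.1
  have hL := abs_sub_le_of_abs_deriv_le hd hB₁
  have hL' := abs_sub_le_of_abs_deriv_le hd' fun x => (hB x).2.2
  have hnoise := M.isIIDNoise
  have hν := hnoise.isProbabilityMeasure
  have hρ := isProbabilityMeasure_kernelMeasure hK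
  have hρs := ae_kernelMeasure_abs_le hK
  have hb0 := tendsto_bandwidth_zero hb hb_upper
  have hgw := hg.isWeightedDensity
  have hgm : ∀ v ∈ Set.Icc α β, Measurable (g v) := fun v hv => (hgw v hv).measurable
  have hg2 : ∀ v ∈ Set.Icc α β, MemLp (g v) 2 (supMeasure fε s₀) := fun v hv => by
    refine ⟨(hgm v hv).aestronglyMeasurable, ?_⟩
    rw [eLpNorm_lt_top_iff_lintegral_rpow_enorm_lt_top (by norm_num) (by norm_num)]
    simpa using hg.square_integrable v hv
  have hle := le_supMeasure hfε hs₀.le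
  have hgi : ∀ v ∈ Set.Icc α β, Integrable (g v) (P.map (M.ε 0)) := fun v hv =>
    ((hg2 v hv).mono_measure hle).integrable (by norm_num)
  -- The degenerate part and the bias are uniformly small without any bracketing, so this serves
  -- both assertions. Bracketing is needed only for the two empirical processes indexed by `g v` and
  -- by its smoothing error.
  have hdiff := M.isLittleOP_iSup_remainder_sub_empProc h_memory hγ hvol hK hb hδ₀ hb_lower hb_upper
    hfε hfX hfX_cont hB₀ hd hL hL' hαβ hgw hgi
  obtain ⟨C, a, hnd⟩ := M.exists_isNoiseDriven h_memory
  have hcond := hnd.isBigOP_iSup_sum_scaled hγ hB₀ hd hB₁ hL' hαβ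
  have hlead := M.ae_leadingTerm_eq hγ hvol hfε hfX hfX_cont hB₀ hL hgw
  have hsmooth : ∀ v ∈ Set.Icc α β, IsLittleOP P fun n ω => ‖empProc (P.map (M.ε 0)) M.ε n
      (fun y => smoothing (kernelMeasure K) (b n) (g v) y - g v y) ω‖ₑ := fun v hv =>
    isLittleOP_empProc hnoise (fun n => (measurable_smoothing (hgm v hv)).sub (hgm v hv))
      (tendsto_lintegral_smoothing_sub_sq hfε (fun x => (le_abs_self _).trans (hB₀ x)) hρs hs₀ hb hb0
        (hgm v hv) (hg2 v hv))
  have hemp : ∀ v ∈ Set.Icc α β, IsBigOP P fun n ω => ‖empProc (P.map (M.ε 0)) M.ε n (g v) ω‖ₑ :=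
    fun v hv => isBigOP_empProc hnoise (hgm v hv)
      ((lintegral_mono' hle le_rfl).trans_lt (hg.square_integrable v hv))
  have hsplit : ∀ (n : ℕ) v ω, √(n : ℝ) * (M.estimator K b n v ω - fX v) =
      M.remainder K b fε fX g n v ω + M.leadingTerm fε fX g n v ω := fun n v ω => by
    rw [LocationScaleModel.remainder, sub_add_cancel]
  refine ⟨fun v hv => ?_, fun hbr => ?_⟩
  · have hrem : IsLittleOP P fun n ω => ‖M.remainder K b fε fX g n v ω‖ₑ := by
      refine IsLittleOP.of_le_add hdiff (hsmooth v hv) fun n => ae_of_all _ fun ω => ?_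
      refine (enorm_le_enorm_sub_add_enorm _ _).trans (add_le_add ?_ le_rfl)
      exact le_iSup₂_of_le (f := fun v _ => ‖M.remainder K b fε fX g n v ω -
        empProc (P.map (M.ε 0)) M.ε n
          (fun y => smoothing (kernelMeasure K) (b n) (g v) y - g v y) ω‖ₑ) v hv le_rfl
    refine ⟨hrem, ?_⟩
    have hleadO : IsBigOP P fun n ω => ‖M.leadingTerm fε fX g n v ω‖ₑ := by
      refine IsBigOP.of_le_add (hemp v hv) hcond fun n => ?_
      filter_upwards [hlead] with ω hω
      rw [hω n v hv]
      refine (enorm_add_le _ _).trans (add_le_add le_rfl ?_)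
      exact le_iSup₂_of_le (f := fun v _ => ‖(√(n : ℝ))⁻¹ * ∑ i ∈ Finset.Icc 1 n,
        (scaled γ 1 fε v (M.state i ω) - ∫ z, scaled γ 1 fε v z ∂(P.map (M.state 0)))‖ₑ)
        v hv le_rfl
    refine IsBigOP.of_le_add hrem.isBigOP hleadO fun n => ae_of_all _ fun ω => ?_
    rw [hsplit]
    exact enorm_add_le _ _
  · have hg0 : ∀ v ∈ Set.Icc α β, ∀ x, 0 ≤ g v x := fun v hv => (hgw v hv).nonneg
    have hsmoothU : IsLittleOP P fun n ω => ⨆ v ∈ Set.Icc α β, ‖empProc (P.map (M.ε 0)) M.ε n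
        (fun y => smoothing (kernelMeasure K) (b n) (g v) y - g v y) ω‖ₑ := by
      simp only [iSup_subtype']
      exact isLittleOP_iSup_of_equicontinuity (fun v => hsmooth v v.2) fun η hη =>
        exists_empProc_smoothing_sub_net hnoise hfε hs₀ hρs hb hb0 hαβ hgm hg0 hbr hη
    have hempU : IsBigOP P fun n ω => ⨆ v ∈ Set.Icc α β,
        ‖empProc (P.map (M.ε 0)) M.ε n (g v) ω‖ₑ := by
      simp only [iSup_subtype']
      exact isBigOP_iSup_of_equicontinuity (fun v => hemp v v.2) fun η hη =>
        exists_empProc_net hnoise hfε hs₀ hαβ hgm hg0 hbr hη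
    have hremU : IsLittleOP P fun n ω => ⨆ v ∈ Set.Icc α β, ‖M.remainder K b fε fX g n v ω‖ₑ :=
      IsLittleOP.of_le_add hdiff hsmoothU fun n => ae_of_all _ fun ω =>
        biSup_enorm_le_add fun v _ => (sub_add_cancel _ _).symm
    refine ⟨hremU, ?_⟩
    have hleadU : IsBigOP P fun n ω => ⨆ v ∈ Set.Icc α β, ‖M.leadingTerm fε fX g n v ω‖ₑ := by
      refine IsBigOP.of_le_add hempU hcond fun n => ?_
      filter_upwards [hlead] with ω hω
      exact biSup_enorm_le_add fun v hv => hω n v hv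
    refine IsBigOP.of_le_add hremU.isBigOP hleadU fun n => ae_of_all _ fun ω => ?_
    have e : ENNReal.ofReal √(n : ℝ) = ‖√(n : ℝ)‖ₑ := (Real.enorm_eq_ofReal (Real.sqrt_nonneg _)).symm
    simp only [e, ENNReal.mul_iSup, ← enorm_mul]
    exact biSup_enorm_le_add fun v _ => hsplit n v ω
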